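/- Let $N\ge 1$ and let $v_1,\dots,v_N:\mathbb R\to\mathbb C$ be square-integrable functions with compact support. In $L^2(\mathbb R)$ consider the operators $$H_0=i^{-N}\partial^N,\qquad H=i^{-N}\partial^N+v_N(x)\partial^{N-1}+\dots+v_2(x)\partial+v_1(x),\qquad \partial=d/dx,$$ both with domain the Sobolev class $\mathsf H^N(\mathbb R)$, and let $\sigma(H_0)$, $\sigma(H)$ be their spectra. Normalized Wronskian. For $z\notin\sigma(H_0)$ let $\zeta_1,\dots,\zeta_N$ be the $N$ distinct solutions of $\zeta^N=i^Nz$, numbered in any order; none of them is purely imaginary. Let $u_j(\cdot,z)$ be the solution of $$i^{-N}u^{(N)}+v_Nu^{(N-1)}+\dots+v_2u'+v_1u=zu$$ (that is, $u^{(N-1)}$ is locally absolutely continuous and the equation holds almost everywhere) such that $u_j(x,z)=e^{\zeta_jx}$ for $x$ to the left of the supports of all $v_k$ if $\operatorname{Re}\zeta_j>0$, and for $x$ to the right of the supports of all $v_k$ if $\operatorname{Re}\zeta_j<0$. Set $$\mathsf W(x,z)=\det\big(u_j^{(k-1)}(x,z)\big)_{k,j=1}^N,\qquad \mathsf W_0(x,z)=\det\big(\zeta_j^{k-1}e^{\zeta_jx}\big)_{k,j=1}^N,\qquad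 \Delta(x,z)=\mathsf W(x,z)/\mathsf W_0(x,z).$$ ($\mathsf W_0$ does not depend on $x$ if $N\ge 2$.) Then $\Delta(x,z)$ is well defined for all $x\in\mathbb R$ and $z\notin\sigma(H_0)$, independently of the numbering of the $\zeta_j$. Theorem. Let $z\notin\sigma(H)$. Then the resolvents $R(z)=(H-z)^{-1}$ and $R_0(z)=(H_0-z)^{-1}$ are integral operators with kernels $R(x,y,z)$ and $R_0(x,y,z)$ that are continuous for $x\ne y$. For $N\ge2$ both kernels are continuous on $\mathbb R^2$; for $N=1$ their difference is continuous on $\mathbb R^2$ (after extension by continuity to the diagonal, which defines its diagonal values). For every $x\in\mathbb R$ the function $\Delta(x,\cdot)$ is complex differentiable at $z$, $\Delta(x,z)\neq0$, the following limit exists, and $$\lim_{x_1\to-\infty,\;x_2\to+\infty}\int_{x_1}^{x_2}\big(R(y,y,z)-R_0(y,y,z)\big)\,dy=-\Delta(x,z)^{-1}\,\partial_z\Delta(x,z).$$ -/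

import Mathlib

open MeasureTheory Filter Topology

noncomputable section

namespace ArbitraryOrder

/-- `u` has `N - 1` continuous derivatives and `u^(N-1)` is locally absolutely continuous, so that
`u^(N)` exists almost everywhere (here `N ≥ 1`). -/
def IsLocallyRegular (N : ℕ) (u : ℝ → ℂ) : Prop :=
  ContDiff ℝ ((N - 1 : ℕ) : ℕ∞) u ∧
    ∀ a b : ℝ, AbsolutelyContinuousOnInterval (iteratedDeriv (N - 1) u) a b

/-- The Sobolev class `H^N(ℝ)`, through the regular representative: `u, …, u^(N-1)` are locally
absolutely continuous and `u, u', …, u^(N)` are square integrable. -/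
def IsSobolev (N : ℕ) (u : ℝ → ℂ) : Prop :=
  IsLocallyRegular N u ∧ ∀ k ≤ N, MemLp (iteratedDeriv k u) 2 volume

/-- The differential expression
`i^(-N) u^(N) + v_N u^(N-1) + ⋯ + v_2 u' + v_1 u`; the entry `v j`, `j = 0, …, N-1`, is the
coefficient `v_{j+1}` of `u^(j)`. -/
def diffExpr {N : ℕ} (v : Fin N → ℝ → ℂ) (u : ℝ → ℂ) (x : ℝ) : ℂ :=
  (Complex.I ^ N)⁻¹ * iteratedDeriv N u x + ∑ j : Fin N, v j x * iteratedDeriv (j : ℕ) u x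

/-- The graph of the operator `H = i^(-N) ∂^N + v_N ∂^(N-1) + ⋯ + v_1` in `L²(ℝ)` with domain
`H^N(ℝ)`: the pairs `(φ, H φ)`. For `v = 0` this is the free operator `H₀`. -/
def operatorGraph {N : ℕ} (v : Fin N → ℝ → ℂ) :
    Set (Lp ℂ 2 (volume : Measure ℝ) × Lp ℂ 2 (volume : Measure ℝ)) :=
  {p | ∃ u : ℝ → ℂ, IsSobolev N u ∧ p.1 =ᵐ[volume] u ∧ p.2 =ᵐ[volume] diffExpr v u}

/-- `R = (H - z)⁻¹`: the graph of the bounded operator `R` is the inverse of the graph of `H - z`. -/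
def IsResolvent {N : ℕ} (v : Fin N → ℝ → ℂ) (z : ℂ)
    (R : Lp ℂ 2 (volume : Measure ℝ) →L[ℂ] Lp ℂ 2 (volume : Measure ℝ)) : Prop :=
  ∀ f φ : Lp ℂ 2 (volume : Measure ℝ),
    R f = φ ↔ ∃ g : Lp ℂ 2 (volume : Measure ℝ), (φ, g) ∈ operatorGraph v ∧ g - z • φ = f

/-- The spectrum `σ(H)`: the `z` for which `H - z` has no bounded everywhere defined inverse. -/
def operatorSpectrum {N : ℕ} (v : Fin N → ℝ → ℂ) : Set ℂ :=
  {z | ¬ ∃ R : Lp ℂ 2 (volume : Measure ℝ) →L[ℂ] Lp ℂ 2 (volume : Measure ℝ), IsResolvent v z R}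

/-- `K(x, y)` is the integral kernel, continuous away from the diagonal, of the resolvent
`(H - z)⁻¹`. -/
def IsResolventKernel {N : ℕ} (v : Fin N → ℝ → ℂ) (z : ℂ) (K : ℝ → ℝ → ℂ) : Prop :=
  ContinuousOn (fun p : ℝ × ℝ => K p.1 p.2) {p | p.1 ≠ p.2} ∧
    ∃ R : Lp ℂ 2 (volume : Measure ℝ) →L[ℂ] Lp ℂ 2 (volume : Measure ℝ), IsResolvent v z R ∧
      ∀ f : Lp ℂ 2 (volume : Measure ℝ), ∀ᵐ x : ℝ,
        Integrable (fun y => K x y * f y) ∧ R f x = ∫ y, K x y * f y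

/-- The kernels `K = R(·,·,z)` and `K₀ = R₀(·,·,z)` of the resolvents of `H` and `H₀`, normalized
so that the diagonal values of `K - K₀` are meaningful: for `N ≥ 2` both kernels are continuous
on the plane; for `N = 1` they jump across the diagonal, but their difference is continuous. -/
def IsResolventKernelPair {N : ℕ} (v : Fin N → ℝ → ℂ) (z : ℂ) (K K₀ : ℝ → ℝ → ℂ) : Prop :=
  IsResolventKernel v z K ∧ IsResolventKernel (0 : Fin N → ℝ → ℂ) z K₀ ∧
    (2 ≤ N → Continuous (fun p : ℝ × ℝ => K p.1 p.2) ∧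
      Continuous (fun p : ℝ × ℝ => K₀ p.1 p.2)) ∧
    Continuous (fun p : ℝ × ℝ => K p.1 p.2 - K₀ p.1 p.2)

/-- `u` is a solution of
`i^(-N) u^(N) + v_N u^(N-1) + ⋯ + v_2 u' + v_1 u = z u` (almost everywhere). -/
def IsSolution {N : ℕ} (v : Fin N → ℝ → ℂ) (z : ℂ) (u : ℝ → ℂ) : Prop :=
  IsLocallyRegular N u ∧ ∀ᵐ x : ℝ, diffExpr v u x = z * u x

/-- The determinant of the Wronskian matrix, whose rows are
`(u_1^(k)(x), …, u_N^(k)(x))`, `k = 0, …, N-1`. -/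
def wronskian {N : ℕ} (u : Fin N → ℝ → ℂ) (x : ℝ) : ℂ :=
  Matrix.det (Matrix.of fun k j : Fin N => iteratedDeriv (k : ℕ) (u j) x)

/-- `ζ` enumerates the `N` solutions of `ζ^N = i^N z`, none of them purely imaginary, and `u j` is
a solution of the differential equation that equals `exp (ζ_j x)` to the left of the supports of
all coefficients if `Re ζ_j > 0`, and to the right of them if `Re ζ_j < 0`. -/
structure IsDistinguishedSystem {N : ℕ} (v : Fin N → ℝ → ℂ) (z : ℂ) (ζ : Fin N → ℂ)
    (u : Fin N → ℝ → ℂ) : Prop where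
  injective : Function.Injective ζ
  root : ∀ j, ζ j ^ N = Complex.I ^ N * z
  re_ne_zero : ∀ j, (ζ j).re ≠ 0
  solution : ∀ j, IsSolution v z (u j)
  left : ∀ j, 0 < (ζ j).re → ∀ x : ℝ, (∀ k, ∀ y ∈ tsupport (v k), x < y) →
    u j x = Complex.exp (ζ j * x)
  right : ∀ j, (ζ j).re < 0 → ∀ x : ℝ, (∀ k, ∀ y ∈ tsupport (v k), y < x) →
    u j x = Complex.exp (ζ j * x)

/-- `d = W(x,z) / W₀(x,z)`, where `W` is the Wronskian of a distinguished system of solutions and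
`W₀` the Wronskian of the exponentials `exp (ζ_j x)`. -/
def IsNormalizedWronskian {N : ℕ} (v : Fin N → ℝ → ℂ) (x : ℝ) (z d : ℂ) : Prop :=
  ∃ (ζ : Fin N → ℂ) (u : Fin N → ℝ → ℂ), IsDistinguishedSystem v z ζ u ∧
    d = wronskian u x / wronskian (fun j y => Complex.exp (ζ j * (y : ℂ))) x

open Classical in
/-- The normalized Wronskian `Δ(x,z)` (with value `0` where there is none, that is, for
`z ∈ σ(H₀)`). -/
def normalizedWronskian {N : ℕ} (v : Fin N → ℝ → ℂ) (x : ℝ) (z : ℂ) : ℂ :=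
  if h : ∃ d, IsNormalizedWronskian v x z d then h.choose else 0

end ArbitraryOrder

end

/-! Write the equation as a first order system Y' = A Y for the matrix Y of the jets u_j^(k), k < N.
The spectral parameter enters A affinely, with a slope E whose only nonzero entry is i^N, in the
last row and first column. Since Y⁻¹ solves the adjoint system, L = Y⁻¹ ∂_z Y satisfies L' = Y⁻¹ E
Y, and the j-th diagonal entry of the right side is i^N u_j (Y⁻¹)_{j,N-1}
(`inv_mul_companionSlope_mul`). By variation of constants the sum of these entries over Re ζ_j < 0
is the resolvent kernel on the diagonal, taken from the side y ≤ x. The sum over all j is an entry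
of Y Y⁻¹ = 1 times i^N, hence the same with and without the potentials.

Let D_j be the j-th diagonal entry of L minus its free counterpart. Then the full sum of the D_j
does not depend on x, and by Jacobi's formula it is the logarithmic derivative of Δ. The integral of
R - R₀ along the diagonal is the increment of the partial sum over Re ζ_j < 0. At +∞ the D_j with Re
ζ_j < 0 tend to 0. At -∞ those with Re ζ_j > 0 do, so there the partial sum tends to the full sum.
The limit of the integral is therefore minus the full sum (`tendsto_integral_greenKernel_sub`).

The D_j decay because beyond the supports Y = Y₀ M with a constant matrix M, some of whose columns
are unit vectors: the surviving terms carry exp((ζ_j - ζ_k)x) with an exponent of the right sign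
(`jetLogDeriv_sub_eq`).

Three facts about z ∉ σ(H) support this. A resonance argument shows that z is not a real N-th power,
so that the ζ_j exist off the imaginary axis (`ne_pow_of_isResolvent`) and H₀ has a resolvent at z
(`exists_isResolvent_zero`). A zero of the Wronskian would produce an eigenfunction
(`IsDistinguishedSystem.det_jetMatrix_ne_zero`). The kernels are unique off the diagonal, so any
admissible pair may be replaced by the Green functions (`IsResolventKernelPair.sub_eq`). -/

namespace ArbitraryOrder

/-! ### Primitives of locally integrable functions -/

/-- Composition with a Lipschitz map preserves absolute continuity. -/
theorem absolutelyContinuousOnInterval_comp_lipschitz {X Y : Type*} [PseudoMetricSpace X]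
    [PseudoMetricSpace Y] {f : ℝ → X} {g : X → Y} {K : NNReal} {a b : ℝ}
    (hg : LipschitzOnWith K g (f '' Set.uIcc a b))
    (hf : AbsolutelyContinuousOnInterval f a b) :
    AbsolutelyContinuousOnInterval (fun x => g (f x)) a b := by
  rw [absolutelyContinuousOnInterval_iff] at hf ⊢
  intro ε hε
  obtain ⟨δ, hδ, h⟩ := hf (ε / (K + 1)) (by positivity)
  refine ⟨δ, hδ, fun E hE hl => ?_⟩
  have h1 := h E hE hl
  calc _ ≤ ∑ i ∈ Finset.range E.1, (K : ℝ) * dist (f (E.2 i).1) (f (E.2 i).2) := by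
        refine Finset.sum_le_sum fun i hi => ?_
        have := hE.1 i hi
        exact hg.dist_le_mul _ (Set.mem_image_of_mem _ this.1) _ (Set.mem_image_of_mem _ this.2)
    _ = K * ∑ i ∈ Finset.range E.1, dist (f (E.2 i).1) (f (E.2 i).2) := by rw [Finset.mul_sum]
    _ ≤ K * (ε / (K + 1)) := by gcongr
    _ < ε := by
        rw [mul_div_assoc', div_lt_iff₀ (by positivity)]
        nlinarith

/-- `F` is a primitive of the locally integrable function `f`. -/
def IsPrimitive (F f : ℝ → ℂ) : Prop :=
  LocallyIntegrable f ∧ ∀ x y : ℝ, F y - F x = ∫ t in x..y, f t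

theorem intervalIntegrable_of_locallyIntegrable {E : Type*} [NormedAddCommGroup E] {f : ℝ → E}
    (hf : LocallyIntegrable f) (x y : ℝ) : IntervalIntegrable f volume x y :=
  intervalIntegrable_iff.mpr
    ((hf.integrableOn_isCompact isCompact_uIcc).mono_set Set.uIoc_subset_uIcc)

theorem locallyIntegrable_of_intervalIntegrable {E : Type*} [NormedAddCommGroup E] {f : ℝ → E}
    (hf : ∀ x y : ℝ, IntervalIntegrable f volume x y) : LocallyIntegrable f := by
  intro x
  refine ⟨Set.Icc (x - 1) (x + 1), Icc_mem_nhds (by linarith) (by linarith), ?_⟩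
  rw [integrableOn_Icc_iff_integrableOn_Ioc]
  exact (intervalIntegrable_iff_integrableOn_Ioc_of_le (by linarith)).1 (hf _ _)

theorem locallyIntegrable_congr {E : Type*} [NormedAddCommGroup E] {f g : ℝ → E}
    (hf : LocallyIntegrable f) (h : f =ᵐ[volume] g) : LocallyIntegrable g := fun x => by
  obtain ⟨s, hs, hi⟩ := hf x
  exact ⟨s, hs, hi.congr (ae_restrict_of_ae h)⟩

/-- Functions continuous and locally integrable multiply to a locally integrable function. -/
theorem locallyIntegrable_continuous_mul {f g : ℝ → ℂ} (hf : Continuous f)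
    (hg : LocallyIntegrable g) : LocallyIntegrable fun x => f x * g x :=
  locallyIntegrable_of_intervalIntegrable fun x y =>
    (intervalIntegrable_of_locallyIntegrable hg x y).continuousOn_mul hf.continuousOn

theorem locallyIntegrable_mul_continuous {f g : ℝ → ℂ} (hf : LocallyIntegrable f)
    (hg : Continuous g) : LocallyIntegrable fun x => f x * g x := by
  simpa only [mul_comm] using locallyIntegrable_continuous_mul hg hf

theorem locallyIntegrable_finset_sum' {ι E : Type*} [NormedAddCommGroup E] (s : Finset ι)
    {f : ι → ℝ → E} (hf : ∀ i ∈ s, LocallyIntegrable (f i)) :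
    LocallyIntegrable fun x => ∑ i ∈ s, f i x := by
  classical
  induction s using Finset.induction_on with
  | empty => simpa using (locallyIntegrable_zero : LocallyIntegrable (fun _ : ℝ => (0 : E)) volume)
  | insert i s his ih =>
    simp only [Finset.sum_insert his]
    exact (hf i (by simp)).add (ih fun j hj => hf j (by simp [hj]))

/-- The indefinite integral of a complex function is absolutely continuous. -/
theorem absolutelyContinuousOnInterval_integral {f : ℝ → ℂ} (hf : LocallyIntegrable f)
    (c a b : ℝ) : AbsolutelyContinuousOnInterval (fun x => ∫ t in c..x, f t) a b := by
  have hi := fun x y => intervalIntegrable_of_locallyIntegrable hf x y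
  -- The statement for real integrands is used with the base point inside the interval, so the
  -- interval is enlarged to contain c and the result restricted afterwards.
  wlog hc : c ∈ Set.uIcc a b generalizing a b
  · refine (this (min (min a b) c) (max (max a b) c) ?_).mono ?_
    · grind [Set.mem_uIcc]
    · intro x hx
      grind [Set.mem_uIcc]
  have hre : AbsolutelyContinuousOnInterval (fun x => ∫ t in c..x, (f t).re) a b :=
    IntervalIntegrable.absolutelyContinuousOnInterval_intervalIntegral
      ⟨(hi a b).1.re, (hi a b).2.re⟩ hc
  have him : AbsolutelyContinuousOnInterval (fun x => ∫ t in c..x, (f t).im) a b :=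
    IntervalIntegrable.absolutelyContinuousOnInterval_intervalIntegral
      ⟨(hi a b).1.im, (hi a b).2.im⟩ hc
  have h1 := absolutelyContinuousOnInterval_comp_lipschitz (g := ((↑) : ℝ → ℂ))
    (Complex.isometry_ofReal.lipschitz.lipschitzOnWith) hre
  have h2 := absolutelyContinuousOnInterval_comp_lipschitz (g := ((↑) : ℝ → ℂ))
    (Complex.isometry_ofReal.lipschitz.lipschitzOnWith) him
  convert! h1.add (h2.const_smul Complex.I) using 1
  funext x
  simp only [Pi.add_apply, smul_eq_mul]
  have hr := Complex.reCLM.intervalIntegral_comp_comm (hi c x)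
  have hm := Complex.imCLM.intervalIntegral_comp_comm (hi c x)
  simp only [Complex.reCLM_apply, Complex.imCLM_apply] at hr hm
  rw [hr, hm]
  apply Complex.ext <;> simp

theorem ae_hasDerivAt_of_absolutelyContinuous {F : ℝ → ℝ}
    (hF : ∀ a b : ℝ, AbsolutelyContinuousOnInterval F a b) :
    ∀ᵐ x : ℝ, HasDerivAt F (deriv F x) x := by
  have h := ae_all_iff.2 fun n : ℕ => (hF (-n) n).ae_differentiableAt
  filter_upwards [h] with x hx
  obtain ⟨n, hn⟩ := exists_nat_ge |x|
  refine (hx n ?_).hasDerivAt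
  rw [Set.mem_uIcc]
  exact Or.inl (abs_le.1 hn)

/-- The derivative of a complex absolutely continuous function. -/
theorem exists_derivative_of_absolutelyContinuous {F : ℝ → ℂ}
    (hF : ∀ a b : ℝ, AbsolutelyContinuousOnInterval F a b) :
    LocallyIntegrable (deriv F) ∧ ∀ᵐ x : ℝ, HasDerivAt F (deriv F x) x := by
  have h1 : ∀ a b, AbsolutelyContinuousOnInterval (fun x => (F x).re) a b := fun a b =>
    absolutelyContinuousOnInterval_comp_lipschitz (g := Complex.re)
      (Complex.reCLM.lipschitz.lipschitzOnWith) (hF a b)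
  have h2 : ∀ a b, AbsolutelyContinuousOnInterval (fun x => (F x).im) a b := fun a b =>
    absolutelyContinuousOnInterval_comp_lipschitz (g := Complex.im)
      (Complex.imCLM.lipschitz.lipschitzOnWith) (hF a b)
  have hd : ∀ᵐ x : ℝ, HasDerivAt F
      (((deriv (fun x => (F x).re) x : ℝ) : ℂ) + Complex.I * ((deriv (fun x => (F x).im) x : ℝ) : ℂ)) x := by
    filter_upwards [ae_hasDerivAt_of_absolutelyContinuous h1,
      ae_hasDerivAt_of_absolutelyContinuous h2] with x hx1 hx2
    have := hx1.ofReal_comp.add (hx2.ofReal_comp.const_mul Complex.I)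
    convert! this using 1
    funext y
    apply Complex.ext <;> simp
  refine ⟨?_, hd.mono fun x hx => hx.differentiableAt.hasDerivAt⟩
  refine locallyIntegrable_congr (f := fun x => ((deriv (fun x => (F x).re) x : ℝ) : ℂ) +
    Complex.I * ((deriv (fun x => (F x).im) x : ℝ) : ℂ)) ?_ (hd.mono fun x hx => hx.deriv.symm)
  have hr : ∀ G : ℝ → ℝ, (∀ a b, AbsolutelyContinuousOnInterval G a b) →
      LocallyIntegrable fun x => ((deriv G x : ℝ) : ℂ) := fun G hG =>
    locallyIntegrable_of_intervalIntegrable fun x y =>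
      ⟨(hG x y).intervalIntegrable_deriv.1.ofReal, (hG x y).intervalIntegrable_deriv.2.ofReal⟩
  exact (hr _ h1).add (locallyIntegrable_continuous_mul continuous_const (hr _ h2))

namespace IsPrimitive

variable {F G f g : ℝ → ℂ}

theorem absolutelyContinuous (h : IsPrimitive F f) (a b : ℝ) :
    AbsolutelyContinuousOnInterval F a b := by
  have h1 := absolutelyContinuousOnInterval_integral h.1 0 a b
  have h2 : AbsolutelyContinuousOnInterval (fun _ : ℝ => F 0) a b :=
    (contDiff_const (n := 1)).contDiffOn.absolutelyContinuousOnInterval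
  convert! h1.add h2 using 1
  funext x
  simp [← h.2 0 x]

theorem continuous (h : IsPrimitive F f) : Continuous F := by
  refine continuous_iff_continuousAt.2 fun x => ?_
  refine (h.absolutelyContinuous (x - 1) (x + 1)).continuousOn.continuousAt ?_
  rw [Set.uIcc_of_le (by linarith)]
  exact Icc_mem_nhds (by linarith) (by linarith)

theorem ae_hasDerivAt (h : IsPrimitive F f) : ∀ᵐ x : ℝ, HasDerivAt F (f x) x := by
  filter_upwards [LocallyIntegrable.ae_hasDerivAt_integral h.1] with x hx
  have := (hx 0).add_const (F 0)
  convert! this using 1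
  funext y
  simp [← h.2 0 y]

/-- The difference of F and the indefinite integral of f is absolutely continuous with derivative
zero almost everywhere, hence constant on each interval. This turns equations holding almost
everywhere into integral equations. -/
theorem of_ae_hasDerivAt (hF : ∀ a b : ℝ, AbsolutelyContinuousOnInterval F a b)
    (hf : LocallyIntegrable f) (hd : ∀ᵐ x : ℝ, HasDerivAt F (f x) x) : IsPrimitive F f := by
  refine ⟨hf, fun x y => ?_⟩
  have hac := (hF x y).sub (absolutelyContinuousOnInterval_integral hf x x y)
  obtain ⟨C, hC⟩ := hac.const_of_ae_hasDerivAt_zero (by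
    filter_upwards [hd, LocallyIntegrable.ae_hasDerivAt_integral hf] with t h1 h2 _
    simpa using h1.sub (h2 x))
  have h1 := hC x (by simp)
  have h2 := hC y (by simp)
  simp only [Pi.sub_apply, intervalIntegral.integral_same, sub_zero] at h1 h2
  rw [h1, ← h2]
  ring

theorem of_absolutelyContinuous (hF : ∀ a b : ℝ, AbsolutelyContinuousOnInterval F a b) :
    IsPrimitive F (deriv F) :=
  of_ae_hasDerivAt hF (exists_derivative_of_absolutelyContinuous hF).1
    (exists_derivative_of_absolutelyContinuous hF).2

theorem of_hasDerivAt (hd : ∀ x, HasDerivAt F (f x) x) (hf : Continuous f) : IsPrimitive F f :=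
  ⟨hf.locallyIntegrable, fun x y =>
    (intervalIntegral.integral_eq_sub_of_hasDerivAt (fun t _ => hd t)
      (hf.intervalIntegrable x y)).symm⟩

theorem hasDerivAt (h : IsPrimitive F f) (hf : Continuous f) (x : ℝ) : HasDerivAt F (f x) x := by
  have := (hf.integral_hasStrictDerivAt 0 x).hasDerivAt.add_const (F 0)
  convert! this using 1
  funext y
  simp [← h.2 0 y]

theorem congr_ae (h : IsPrimitive F f) (hfg : f =ᵐ[volume] g) : IsPrimitive F g :=
  ⟨locallyIntegrable_congr h.1 hfg, fun x y => by
    rw [h.2, intervalIntegral.integral_congr_ae (hfg.mono fun t ht _ => ht)]⟩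

theorem const (c : ℂ) : IsPrimitive (fun _ => c) (fun _ => 0) :=
  ⟨locallyIntegrable_zero, fun x y => by simp⟩

theorem add (h : IsPrimitive F f) (h' : IsPrimitive G g) :
    IsPrimitive (fun x => F x + G x) (fun x => f x + g x) :=
  ⟨h.1.add h'.1, fun x y => by
    rw [intervalIntegral.integral_add (intervalIntegrable_of_locallyIntegrable h.1 x y)
      (intervalIntegrable_of_locallyIntegrable h'.1 x y), ← h.2, ← h'.2]
    ring⟩

theorem const_mul (h : IsPrimitive F f) (c : ℂ) :
    IsPrimitive (fun x => c * F x) (fun x => c * f x) :=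
  ⟨locallyIntegrable_continuous_mul continuous_const h.1, fun x y => by
    rw [intervalIntegral.integral_const_mul, ← h.2]
    ring⟩

theorem sub (h : IsPrimitive F f) (h' : IsPrimitive G g) :
    IsPrimitive (fun x => F x - G x) (fun x => f x - g x) := by
  convert! h.add (h'.const_mul (-1)) using 2 <;> ring

theorem sum {ι : Type*} (s : Finset ι) {F f : ι → ℝ → ℂ} (h : ∀ i ∈ s, IsPrimitive (F i) (f i)) :
    IsPrimitive (fun x => ∑ i ∈ s, F i x) (fun x => ∑ i ∈ s, f i x) := by
  classical
  induction s using Finset.induction_on with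
  | empty => simpa using const 0
  | insert i s his ih =>
    simp only [Finset.sum_insert his]
    exact (h i (by simp)).add (ih fun j hj => h j (by simp [hj]))

/-- The product rule. -/
theorem mul (h : IsPrimitive F f) (h' : IsPrimitive G g) :
    IsPrimitive (fun x => F x * G x) (fun x => f x * G x + F x * g x) := by
  refine of_ae_hasDerivAt (fun a b => ?_) ?_ ?_
  · exact (h.absolutelyContinuous a b).smul (h'.absolutelyContinuous a b)
  · exact (locallyIntegrable_mul_continuous h.1 h'.continuous).add
      (locallyIntegrable_continuous_mul h.continuous h'.1)
  · filter_upwards [h.ae_hasDerivAt, h'.ae_hasDerivAt] with x h1 h2 using h1.mul h2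

theorem integral (hf : LocallyIntegrable f) (c : ℝ) :
    IsPrimitive (fun x => ∫ t in c..x, f t) f :=
  ⟨hf, fun _ _ => intervalIntegral.integral_interval_sub_left
    (intervalIntegrable_of_locallyIntegrable hf _ _)
    (intervalIntegrable_of_locallyIntegrable hf _ _)⟩

theorem eq_of_ae_zero (h : IsPrimitive F f) (h0 : f =ᵐ[volume] 0) (x y : ℝ) : F x = F y := by
  have := (h.congr_ae h0).2 y x
  simpa [sub_eq_zero] using this

end IsPrimitive

end ArbitraryOrder

set_option linter.unusedSectionVars false

namespace ArbitraryOrder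

/-! ### Linear systems with locally integrable coefficients -/

theorem abs_integral_mono_of_nonneg {f g : ℝ → ℝ} {a b : ℝ}
    (hf : ∀ t, 0 ≤ f t) (hfg : ∀ t ∈ Set.uIoc a b, f t ≤ g t)
    (hg : IntervalIntegrable g volume a b) : |∫ t in a..b, f t| ≤ |∫ t in a..b, g t| := by
  rw [← Real.norm_eq_abs]
  refine intervalIntegral.norm_integral_le_abs_of_norm_le ?_ hg
  rw [ae_restrict_iff' measurableSet_uIoc]
  exact ae_of_all _ fun t ht => by rw [Real.norm_of_nonneg (hf t)]; exact hfg t ht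

theorem continuous_integral_of_locallyIntegrable {ρ : ℝ → ℝ} (hρ : LocallyIntegrable ρ) (a : ℝ) :
    Continuous fun t => ∫ s in a..t, ρ s :=
  intervalIntegral.continuous_primitive (fun x y => intervalIntegrable_of_locallyIntegrable hρ x y) a

theorem locallyIntegrable_mul_continuous_real {ρ g : ℝ → ℝ} (hρ : LocallyIntegrable ρ)
    (hg : Continuous g) : LocallyIntegrable fun t => ρ t * g t :=
  locallyIntegrable_of_intervalIntegrable fun x y =>
    (intervalIntegrable_of_locallyIntegrable hρ x y).mul_continuousOn hg.continuousOn

/-- The integral of `ρ exp (c ∫ ρ)`. -/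
theorem integral_mul_exp_integral {ρ : ℝ → ℝ} (hρ : LocallyIntegrable ρ) (a x c : ℝ) :
    ∫ t in a..x, ρ t * Real.exp (c * ∫ s in a..t, ρ s) * c =
      Real.exp (c * ∫ s in a..x, ρ s) - 1 := by
  set α : ℝ → ℝ := fun t => ∫ s in a..t, ρ s with hα
  have hac : AbsolutelyContinuousOnInterval α a x :=
    IntervalIntegrable.absolutelyContinuousOnInterval_intervalIntegral
      (intervalIntegrable_of_locallyIntegrable hρ a x) (by simp)
  obtain ⟨C, hC⟩ := hac.exists_bound
  -- On the bounded range of the indefinite integral the exponential is Lipschitz, so the composite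
  -- is absolutely continuous and the fundamental theorem applies although ρ is only locally
  -- integrable.
  have hcd : ContDiff ℝ 1 fun y : ℝ => Real.exp (c * y) :=
    Real.contDiff_exp.comp (contDiff_const.mul contDiff_id)
  obtain ⟨K, hK⟩ := (hcd.contDiffOn (s := Set.Icc (-C) C)).exists_lipschitzOnWith
    (by decide) (convex_Icc _ _) isCompact_Icc
  have hac2 := absolutelyContinuousOnInterval_comp_lipschitz (hK.mono (by
    rintro _ ⟨t, ht, rfl⟩
    exact abs_le.1 (hC t ht))) hac
  have h := hac2.integral_deriv_eq_sub
  have h0 : α a = 0 := by simp [hα]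
  rw [h0] at h
  simp only [mul_zero, Real.exp_zero] at h
  rw [← h]
  refine intervalIntegral.integral_congr_ae ?_
  filter_upwards [LocallyIntegrable.ae_hasDerivAt_integral hρ] with t ht _
  have := (((ht a).const_mul c).exp).deriv
  rw [this]
  ring

/-- On either side of a the integrand has an explicit primitive. The rate 2 in the exponent produces
the factor 1/2, which makes the integral operator halve a weighted sup norm, both in the Grönwall
bound and in the fixed point argument for existence. -/
theorem abs_integral_mul_exp_abs_integral_le {ρ : ℝ → ℝ} (hρ : LocallyIntegrable ρ)
    (h0 : ∀ t, 0 ≤ ρ t) (a x : ℝ) :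
    |∫ t in a..x, ρ t * Real.exp (2 * |∫ s in a..t, ρ s|)| ≤
      Real.exp (2 * |∫ s in a..x, ρ s|) / 2 := by
  rcases le_total a x with hax | hax
  · have hpos : ∀ t, a ≤ t → 0 ≤ ∫ s in a..t, ρ s := fun t ht =>
      intervalIntegral.integral_nonneg ht fun s _ => h0 s
    have h := integral_mul_exp_integral hρ a x 2
    rw [intervalIntegral.integral_mul_const] at h
    have : ∫ t in a..x, ρ t * Real.exp (2 * |∫ s in a..t, ρ s|) =
        ∫ t in a..x, ρ t * Real.exp (2 * ∫ s in a..t, ρ s) := by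
      refine intervalIntegral.integral_congr fun t ht => ?_
      rw [Set.uIcc_of_le hax] at ht
      simp only [abs_of_nonneg (hpos t ht.1)]
    rw [this, abs_of_nonneg (hpos x hax), abs_of_nonneg
      (intervalIntegral.integral_nonneg hax fun s _ => mul_nonneg (h0 s) (Real.exp_pos _).le)]
    linarith
  · have hneg : ∀ t, t ≤ a → ∫ s in a..t, ρ s ≤ 0 := fun t ht => by
      rw [intervalIntegral.integral_symm]
      exact neg_nonpos.2 (intervalIntegral.integral_nonneg ht fun s _ => h0 s)
    have h := integral_mul_exp_integral hρ a x (-2)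
    rw [intervalIntegral.integral_mul_const] at h
    have : ∫ t in a..x, ρ t * Real.exp (2 * |∫ s in a..t, ρ s|) =
        ∫ t in a..x, ρ t * Real.exp (-2 * ∫ s in a..t, ρ s) := by
      refine intervalIntegral.integral_congr fun t ht => ?_
      rw [Set.uIcc_of_ge hax] at ht
      simp only [abs_of_nonpos (hneg t ht.2)]
      ring_nf
    have hle : ∫ t in a..x, ρ t * Real.exp (-2 * ∫ s in a..t, ρ s) ≤ 0 := by
      rw [intervalIntegral.integral_symm]
      exact neg_nonpos.2 (intervalIntegral.integral_nonneg hax fun s _ =>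
        mul_nonneg (h0 s) (Real.exp_pos _).le)
    rw [this, abs_of_nonpos (hneg x hax), abs_of_nonpos hle]
    rw [show 2 * -(∫ s in a..x, ρ s) = -2 * ∫ s in a..x, ρ s by ring]
    linarith

/-- A Grönwall bound with a locally integrable coefficient. -/
theorem norm_le_of_le_integral {E : Type*} [NormedAddCommGroup E] {ρ : ℝ → ℝ}
    (hρ : LocallyIntegrable ρ) (h0 : ∀ t, 0 ≤ ρ t) {D : ℝ → E} (hD : Continuous D) {a x c : ℝ}
    (h : ∀ t ∈ Set.uIcc a x, ‖D t‖ ≤ c + |∫ s in a..t, ρ s * ‖D s‖|) :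
    ‖D x‖ ≤ 2 * c * Real.exp (2 * |∫ s in a..x, ρ s|) := by
  have hαc := continuous_integral_of_locallyIntegrable hρ a
  have hφ : Continuous fun t => Real.exp (-(2 * |∫ s in a..t, ρ s|)) * ‖D t‖ := by fun_prop
  -- Let M be the maximum of the weighted norm, attained at s. With e the weight at s, the integral
  -- inequality there reads M e ≤ c + M e / 2, whence M ≤ 2c.
  obtain ⟨s, hs, hmax⟩ := (isCompact_uIcc (a := a) (b := x)).exists_isMaxOn
    ⟨a, by simp⟩ hφ.continuousOn
  set M := Real.exp (-(2 * |∫ s in a..s, ρ s|)) * ‖D s‖ with hM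
  have hM0 : 0 ≤ M := by positivity
  have hb : ∀ t ∈ Set.uIcc a x, ‖D t‖ ≤ M * Real.exp (2 * |∫ s in a..t, ρ s|) := fun t ht => by
    have := hmax ht
    simp only [Set.mem_ofPred_eq] at this
    rw [← hM] at this
    calc ‖D t‖ = Real.exp (-(2 * |∫ s in a..t, ρ s|)) * ‖D t‖ *
          Real.exp (2 * |∫ s in a..t, ρ s|) := by
          rw [mul_right_comm, ← Real.exp_add]; simp
      _ ≤ _ := by gcongr
  have hsub : Set.uIcc a s ⊆ Set.uIcc a x := Set.uIcc_subset_uIcc_left hs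
  have h1 : |∫ t in a..s, ρ t * ‖D t‖| ≤ M * (Real.exp (2 * |∫ s in a..s, ρ s|) / 2) := by
    calc |∫ t in a..s, ρ t * ‖D t‖|
        ≤ |∫ t in a..s, M * (ρ t * Real.exp (2 * |∫ s in a..t, ρ s|))| := by
          refine abs_integral_mono_of_nonneg (fun t => mul_nonneg (h0 t) (norm_nonneg _))
            (fun t ht => ?_) ?_
          · have := mul_le_mul_of_nonneg_left (hb t (hsub (Set.uIoc_subset_uIcc ht))) (h0 t)
            linarith
          · refine IntervalIntegrable.const_mul ?_ M
            exact intervalIntegrable_of_locallyIntegrable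
              (locallyIntegrable_mul_continuous_real hρ (by fun_prop)) _ _
      _ ≤ _ := by
          rw [intervalIntegral.integral_const_mul, abs_mul, abs_of_nonneg hM0]
          gcongr
          exact abs_integral_mul_exp_abs_integral_le hρ h0 a s
  have h2 := h s hs
  have hE1 : (1 : ℝ) ≤ Real.exp (2 * |∫ s in a..s, ρ s|) := Real.one_le_exp (by positivity)
  have hDs : ‖D s‖ = M * Real.exp (2 * |∫ s in a..s, ρ s|) := by
    rw [hM, mul_right_comm, ← Real.exp_add]; simp
  have hc : 0 ≤ c := by
    have := h a (by simp)
    simp at this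
    exact (norm_nonneg _).trans this
  have hM2 : M ≤ 2 * c := by
    rw [hDs] at h2
    set e := Real.exp (2 * |∫ s in a..s, ρ s|)
    have : M * e ≤ 2 * c := by linarith
    nlinarith
  exact (hb x (by simp)).trans (by gcongr)

/-! ### Matrix systems: a priori bounds, existence, adjoint solutions -/

variable {m n p : Type*} [Fintype m] [Fintype n] [Fintype p]

/-- Entrywise primitives of matrix functions. -/
def IsMatrixPrimitive {m n : Type*} (F G : ℝ → Matrix m n ℂ) : Prop :=
  ∀ i j, IsPrimitive (fun x => F x i j) (fun x => G x i j)

namespace IsMatrixPrimitive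

theorem mul {F F' : ℝ → Matrix m n ℂ} {G G' : ℝ → Matrix n p ℂ} (hF : IsMatrixPrimitive F F')
    (hG : IsMatrixPrimitive G G') :
    IsMatrixPrimitive (fun x => F x * G x) (fun x => F' x * G x + F x * G' x) := fun i j => by
  simp only [Matrix.mul_apply, Matrix.add_apply, ← Finset.sum_add_distrib]
  exact IsPrimitive.sum _ fun k _ => (hF i k).mul (hG k j)

theorem const {m n : Type*} (C : Matrix m n ℂ) : IsMatrixPrimitive (fun _ => C) (fun _ => 0) :=
  fun i j => IsPrimitive.const (C i j)

theorem mul_const {F F' : ℝ → Matrix m n ℂ} (hF : IsMatrixPrimitive F F') (C : Matrix n p ℂ) :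
    IsMatrixPrimitive (fun x => F x * C) (fun x => F' x * C) := by
  simpa using hF.mul (const C)

theorem const_mul {F F' : ℝ → Matrix n p ℂ} (hF : IsMatrixPrimitive F F') (C : Matrix m n ℂ) :
    IsMatrixPrimitive (fun x => C * F x) (fun x => C * F' x) := by
  simpa using (const C).mul hF

theorem transpose {m n : Type*} {F F' : ℝ → Matrix m n ℂ} (hF : IsMatrixPrimitive F F') :
    IsMatrixPrimitive (fun x => (F x).transpose) (fun x => (F' x).transpose) :=
  fun i j => hF j i

theorem sub {m n : Type*} {F F' G G' : ℝ → Matrix m n ℂ} (hF : IsMatrixPrimitive F F')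
    (hG : IsMatrixPrimitive G G') :
    IsMatrixPrimitive (fun x => F x - G x) (fun x => F' x - G' x) := fun i j =>
  (hF i j).sub (hG i j)

theorem continuous {m n : Type*} {F F' : ℝ → Matrix m n ℂ} (hF : IsMatrixPrimitive F F') :
    Continuous F :=
  continuous_matrix fun i j => (hF i j).continuous

theorem eq_of_zero {m n : Type*} {F F' : ℝ → Matrix m n ℂ} (hF : IsMatrixPrimitive F F')
    {x y : ℝ} (h : ∀ t ∈ Set.uIoc x y, F' t = 0) : F x = F y := by
  ext i j
  have h1 := (hF i j).2 x y
  rw [intervalIntegral.integral_congr_ae (g := fun _ => 0)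
    (ae_of_all _ fun t ht => by simp [h t ht])] at h1
  simp only [intervalIntegral.integral_zero, sub_eq_zero] at h1
  exact h1.symm

end IsMatrixPrimitive

/-- The sum of the absolute values of the entries of a matrix. -/
noncomputable def entrySum (A : Matrix m n ℂ) : ℝ := ∑ i, ∑ j, ‖A i j‖

theorem entrySum_nonneg (A : Matrix m n ℂ) : 0 ≤ entrySum A :=
  Finset.sum_nonneg fun _ _ => Finset.sum_nonneg fun _ _ => norm_nonneg _

theorem row_sum_le_entrySum (A : Matrix m n ℂ) (i : m) : ∑ j, ‖A i j‖ ≤ entrySum A :=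
  Finset.single_le_sum (f := fun i => ∑ j, ‖A i j‖)
    (fun _ _ => Finset.sum_nonneg fun _ _ => norm_nonneg _) (Finset.mem_univ i)

theorem norm_mulVec_le (A : Matrix m n ℂ) (y : n → ℂ) (i : m) :
    ‖∑ j, A i j * y j‖ ≤ entrySum A * ‖y‖ := by
  calc ‖∑ j, A i j * y j‖ ≤ ∑ j, ‖A i j‖ * ‖y‖ := by
        refine (norm_sum_le _ _).trans (Finset.sum_le_sum fun j _ => ?_)
        rw [norm_mul]
        gcongr
        exact norm_le_pi_norm y j
    _ ≤ entrySum A * ‖y‖ := by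
        rw [← Finset.sum_mul]
        gcongr
        exact row_sum_le_entrySum A i

/-- Entrywise local integrability of a matrix function. -/
def LocallyIntegrableEntries {m n : Type*} (A : ℝ → Matrix m n ℂ) : Prop :=
  ∀ i j, LocallyIntegrable fun x => A x i j

theorem locallyIntegrable_entrySum {A : ℝ → Matrix m n ℂ} (hA : LocallyIntegrableEntries A) :
    LocallyIntegrable fun x => entrySum (A x) :=
  locallyIntegrable_finset_sum' _ fun i _ => locallyIntegrable_finset_sum' _ fun j _ =>
    fun x => (hA i j x).norm

/-- A priori bound for solutions of a linear system. -/
theorem norm_solution_le {A : ℝ → Matrix n n ℂ} {Y : ℝ → n → ℂ}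
    (hY : ∀ i, IsPrimitive (fun x => Y x i) (fun x => ∑ j, A x i j * Y x j))
    {ρ : ℝ → ℝ} (hρ : LocallyIntegrable ρ) (hAρ : ∀ x, entrySum (A x) ≤ ρ x) (a x : ℝ) :
    ‖Y x‖ ≤ 2 * ‖Y a‖ * Real.exp (2 * |∫ s in a..x, ρ s|) := by
  have hc : Continuous Y := continuous_pi fun i => (hY i).continuous
  have h0 : ∀ t, 0 ≤ ρ t := fun t => (entrySum_nonneg _).trans (hAρ t)
  refine norm_le_of_le_integral hρ h0 hc fun t _ => ?_
  refine (pi_norm_le_iff_of_nonneg (by positivity)).2 fun i => ?_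
  have h1 := (hY i).2 a t
  have h2 : ‖∫ s in a..t, ∑ j, A s i j * Y s j‖ ≤ |∫ s in a..t, ρ s * ‖Y s‖| := by
    refine intervalIntegral.norm_integral_le_abs_of_norm_le (ae_of_all _ fun s => ?_) ?_
    · exact (norm_mulVec_le _ _ _).trans (by gcongr; exact hAρ s)
    · exact intervalIntegrable_of_locallyIntegrable
        (locallyIntegrable_mul_continuous_real hρ hc.norm) _ _
  calc ‖Y t i‖ = ‖Y a i + (Y t i - Y a i)‖ := by ring_nf
    _ ≤ ‖Y a i‖ + ‖Y t i - Y a i‖ := norm_add_le _ _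
    _ ≤ _ := by
        rw [h1]
        gcongr
        exact norm_le_pi_norm (Y a) i

/-- Existence of solutions of linear systems with locally integrable coefficients. -/
theorem exists_solution {A : ℝ → Matrix n n ℂ} (hA : LocallyIntegrableEntries A) (a : ℝ)
    (c : n → ℂ) : ∃ Y : ℝ → n → ℂ, Y a = c ∧
      ∀ i, IsPrimitive (fun x => Y x i) (fun x => ∑ j, A x i j * Y x j) := by
  classical
  set ρ : ℝ → ℝ := fun x => entrySum (A x) with hρdef
  have hρ : LocallyIntegrable ρ := locallyIntegrable_entrySum hA
  have h0 : ∀ t, 0 ≤ ρ t := fun t => entrySum_nonneg _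
  have hαc := continuous_integral_of_locallyIntegrable hρ a
  -- The unknown is g = Y / e in the bounded continuous functions on the whole line. In this weight
  -- the integral equation is a contraction of ratio 1/2, so one fixed point gives a global
  -- solution.
  set e : ℝ → ℝ := fun x => Real.exp (2 * |∫ s in a..x, ρ s|) with he
  have hec : Continuous e := by fun_prop
  have hepos : ∀ x, 0 < e x := fun x => Real.exp_pos _
  have he1 : ∀ x, 1 ≤ e x := fun x => Real.one_le_exp (by positivity)
  have hli : ∀ g : ℝ → n → ℂ, Continuous g → ∀ i,
      LocallyIntegrable fun t => ∑ j, A t i j * ((e t : ℂ) * g t j) := fun g hg i =>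
    locallyIntegrable_finset_sum' _ fun j _ =>
      locallyIntegrable_mul_continuous (hA i j) (by fun_prop)
  have hest : ∀ g : ℝ → n → ℂ, Continuous g → ∀ C, (∀ t, ‖g t‖ ≤ C) → ∀ x i,
      ‖∫ t in a..x, ∑ j, A t i j * ((e t : ℂ) * g t j)‖ ≤ C * (e x / 2) := by
    intro g hg C hC x i
    have hC0 : 0 ≤ C := (norm_nonneg _).trans (hC 0)
    calc ‖∫ t in a..x, ∑ j, A t i j * ((e t : ℂ) * g t j)‖
        ≤ |∫ t in a..x, C * (ρ t * e t)| := by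
          refine intervalIntegral.norm_integral_le_abs_of_norm_le (ae_of_all _ fun s => ?_) ?_
          · refine (norm_mulVec_le (A s) (fun j => (e s : ℂ) * g s j) i).trans ?_
            have : ‖fun j => (e s : ℂ) * g s j‖ ≤ e s * C := by
              refine (pi_norm_le_iff_of_nonneg (mul_nonneg (hepos s).le hC0)).2 fun j => ?_
              rw [norm_mul, Complex.norm_real, Real.norm_of_nonneg (hepos s).le]
              exact mul_le_mul_of_nonneg_left ((norm_le_pi_norm _ j).trans (hC s)) (hepos s).le
            calc _ ≤ ρ s * (e s * C) := mul_le_mul_of_nonneg_left this (h0 s)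
              _ = _ := by ring
          · exact (intervalIntegrable_of_locallyIntegrable
              (locallyIntegrable_mul_continuous_real hρ hec) _ _).const_mul C
      _ ≤ _ := by
          rw [intervalIntegral.integral_const_mul, abs_mul, abs_of_nonneg hC0]
          gcongr
          exact abs_integral_mul_exp_abs_integral_le hρ h0 a x
  have hcont : ∀ g : ℝ → n → ℂ, Continuous g → Continuous fun x => fun i =>
      ((e x)⁻¹ : ℂ) * (c i + ∫ t in a..x, ∑ j, A t i j * ((e t : ℂ) * g t j)) := by
    intro g hg
    refine continuous_pi fun i => ?_
    have h1 : Continuous fun x => ((e x)⁻¹ : ℂ) :=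
      (Complex.continuous_ofReal.comp hec).inv₀ fun x =>
        Complex.ofReal_ne_zero.2 (hepos x).ne'
    exact h1.mul (continuous_const.add (IsPrimitive.integral (hli g hg i) a).continuous)
  have hinv : ∀ x (w : ℂ) C, ‖w‖ ≤ C * e x → ‖((e x)⁻¹ : ℂ) * w‖ ≤ C := fun x w C hw => by
    rw [norm_mul, norm_inv, Complex.norm_real, Real.norm_of_nonneg (hepos x).le,
      inv_mul_le_iff₀ (hepos x)]
    linarith
  let T : BoundedContinuousFunction ℝ (n → ℂ) → BoundedContinuousFunction ℝ (n → ℂ) := fun g =>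
    BoundedContinuousFunction.ofNormedAddCommGroup _ (hcont g g.continuous) (‖c‖ + ‖g‖) (by
      intro x
      refine (pi_norm_le_iff_of_nonneg (by positivity)).2 fun i => hinv _ _ _ ?_
      have h2 := hest g g.continuous ‖g‖ g.norm_coe_le_norm x i
      have h3 := norm_le_pi_norm c i
      refine (norm_add_le _ _).trans ?_
      nlinarith [he1 x, norm_nonneg c, norm_nonneg g])
  have hT : ContractingWith (1 / 2) T := by
    refine ⟨by
      rw [← NNReal.coe_lt_coe]; norm_num, LipschitzWith.of_dist_le_mul fun g h => ?_⟩
    refine (BoundedContinuousFunction.dist_le (by positivity)).2 fun x => ?_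
    rw [dist_eq_norm]
    refine (pi_norm_le_iff_of_nonneg (by positivity)).2 fun i => ?_
    have hsub : (T g x - T h x) i = ((e x)⁻¹ : ℂ) *
        ∫ t in a..x, ∑ j, A t i j * ((e t : ℂ) * (g - h) t j) := by
      have : ∀ t, ∑ j, A t i j * ((e t : ℂ) * (g - h) t j) =
          (∑ j, A t i j * ((e t : ℂ) * g t j)) - ∑ j, A t i j * ((e t : ℂ) * h t j) := fun t => by
        rw [← Finset.sum_sub_distrib]
        exact Finset.sum_congr rfl fun j _ => by
          simp only [BoundedContinuousFunction.coe_sub, Pi.sub_apply]; ring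
      simp only [this]
      rw [intervalIntegral.integral_sub
        (intervalIntegrable_of_locallyIntegrable (hli g g.continuous i) _ _)
        (intervalIntegrable_of_locallyIntegrable (hli h h.continuous i) _ _)]
      simp only [T, BoundedContinuousFunction.coe_ofNormedAddCommGroup, Pi.sub_apply]
      ring
    rw [hsub]
    refine hinv _ _ _ ?_
    have := hest (g - h : BoundedContinuousFunction ℝ (n → ℂ)) (g - h).continuous ‖g - h‖
      (g - h).norm_coe_le_norm x i
    rw [dist_eq_norm]
    have hco : (((1 / 2 : NNReal)) : ℝ) = 1 / 2 := by norm_num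
    rw [hco]
    linarith
  set g := hT.fixedPoint T
  have hg : T g = g := hT.fixedPoint_isFixedPt
  have hgx : ∀ x i, (e x : ℂ) * g x i = c i + ∫ t in a..x, ∑ j, A t i j * ((e t : ℂ) * g t j) := by
    intro x i
    have h1 : (T g) x i = g x i := by rw [hg]
    rw [← h1]
    simp only [T, BoundedContinuousFunction.coe_ofNormedAddCommGroup]
    rw [mul_inv_cancel_left₀]
    exact_mod_cast (hepos x).ne'
  refine ⟨fun x i => (e x : ℂ) * g x i, ?_, fun i => ⟨hli g g.continuous i, fun x y => ?_⟩⟩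
  · funext i
    have := hgx a i
    rw [intervalIntegral.integral_same, add_zero] at this
    exact this
  · have h1 := (IsPrimitive.integral (hli g g.continuous i) a).2 x y
    have h2 := hgx x i
    have h3 := hgx y i
    calc (e y : ℂ) * g y i - (e x : ℂ) * g x i = _ := by rw [h2, h3, add_sub_add_left_eq_sub]
      _ = _ := h1

variable [DecidableEq n]

/-- The fundamental matrix, normalized at `a`. -/
theorem exists_fundamentalMatrix {A : ℝ → Matrix n n ℂ} (hA : LocallyIntegrableEntries A) (a : ℝ) :
    ∃ U : ℝ → Matrix n n ℂ, U a = 1 ∧ IsMatrixPrimitive U fun x => A x * U x := by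
  choose Y hYa hY using fun j : n => exists_solution hA a (fun i => (1 : Matrix n n ℂ) i j)
  refine ⟨fun x => Matrix.of fun i j => Y j x i, ?_, fun i j => ?_⟩
  · ext i j
    simp [hYa]
  · simpa [Matrix.mul_apply] using hY j i

/-- The inverse of the fundamental matrix solves the adjoint system. -/
theorem exists_inverse_fundamentalMatrix {A : ℝ → Matrix n n ℂ} (hA : LocallyIntegrableEntries A)
    (a : ℝ) : ∃ V : ℝ → Matrix n n ℂ, V a = 1 ∧ IsMatrixPrimitive V fun x => -(V x * A x) := by
  -- Transposing V' = -V A gives a system with coefficient -Aᵀ on the left, so the existence theorem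
  -- applies and no inverse has to be differentiated.
  obtain ⟨U, hUa, hU⟩ := exists_fundamentalMatrix (A := fun x => -(A x).transpose)
    (fun i j => LocallyIntegrable.neg (hA j i)) a
  refine ⟨fun x => (U x).transpose, by simp [hUa], fun i j => ?_⟩
  have := hU.transpose i j
  convert this using 3
  simp [Matrix.mul_apply, mul_comm]

/-- The derivative of V Y is -V A Y + V A Y = 0. This conservation law is the source of uniqueness
and of the invertibility of solution matrices. -/
theorem left_inverse_solution {A : ℝ → Matrix n n ℂ} {V : ℝ → Matrix n n ℂ}
    {Y : ℝ → Matrix n p ℂ} (hV : IsMatrixPrimitive V fun x => -(V x * A x))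
    (hY : IsMatrixPrimitive Y fun x => A x * Y x) (x y : ℝ) : V x * Y x = V y * Y y := by
  refine (hV.mul hY).eq_of_zero (x := x) (y := y) fun t _ => ?_
  rw [Matrix.neg_mul, Matrix.mul_assoc, neg_add_cancel]

/-- Solution matrices that are invertible at one point are invertible everywhere, and their
inverses solve the adjoint system. -/
theorem inverse_solution {A : ℝ → Matrix n n ℂ} (hA : LocallyIntegrableEntries A)
    {Y : ℝ → Matrix n n ℂ} (hY : IsMatrixPrimitive Y fun x => A x * Y x) {a : ℝ}
    (ha : (Y a).det ≠ 0) :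
    (∀ x, (Y x).det ≠ 0) ∧ IsMatrixPrimitive (fun x => (Y x)⁻¹) fun x => -((Y x)⁻¹ * A x) := by
  obtain ⟨V, hVa, hV⟩ := exists_inverse_fundamentalMatrix hA a
  have h1 : ∀ x, ((Y a)⁻¹ * V x) * Y x = 1 := fun x => by
    rw [Matrix.mul_assoc, left_inverse_solution hV hY x a, hVa, Matrix.one_mul,
      Matrix.nonsing_inv_mul _ (isUnit_iff_ne_zero.2 ha)]
  have h2 : ∀ x, (Y x)⁻¹ = (Y a)⁻¹ * V x := fun x => Matrix.inv_eq_left_inv (h1 x)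
  refine ⟨fun x => ?_, ?_⟩
  · have := congrArg Matrix.det (h1 x)
    rw [Matrix.det_mul, Matrix.det_one] at this
    exact right_ne_zero_of_mul (by rw [this]; exact one_ne_zero)
  · rw [show (fun x => (Y x)⁻¹) = fun x => (Y a)⁻¹ * V x from funext h2]
    have := hV.const_mul (Y a)⁻¹
    convert! this using 2 with x
    rw [h2 x]
    rw [Matrix.mul_neg, Matrix.mul_assoc]

/-- Solutions of systems that coincide on an interval. -/
theorem solution_eq_on {A A₀ : ℝ → Matrix n n ℂ} (hA₀ : LocallyIntegrableEntries A₀)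
    {Y : ℝ → Matrix n p ℂ} (hY : IsMatrixPrimitive Y fun x => A x * Y x)
    {Y₀ : ℝ → Matrix n p ℂ} (hY₀ : IsMatrixPrimitive Y₀ fun x => A₀ x * Y₀ x) {a x : ℝ}
    (h : ∀ t ∈ Set.uIcc a x, A t = A₀ t) (ha : Y a = Y₀ a) : Y x = Y₀ x := by
  obtain ⟨V, hVa, hV⟩ := exists_inverse_fundamentalMatrix hA₀ a
  obtain ⟨U, hUa, hU⟩ := exists_fundamentalMatrix hA₀ a
  -- V belongs to A₀, but A = A₀ between a and x, so V (Y - Y₀) is constant there; U serves to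
  -- cancel V at x.
  have h1 : V a * (Y a - Y₀ a) = V x * (Y x - Y₀ x) := by
    refine (hV.mul (hY.sub hY₀)).eq_of_zero fun t ht => ?_
    rw [h t (Set.uIoc_subset_uIcc ht), Matrix.neg_mul, Matrix.mul_assoc, ← Matrix.mul_sub,
      neg_add_cancel]
  rw [ha, sub_self, Matrix.mul_zero] at h1
  have h2 : U x * V x = 1 := by
    rw [mul_eq_one_comm, left_inverse_solution hV hU x a, hVa, hUa, Matrix.one_mul]
  have h3 : U x * (V x * (Y x - Y₀ x)) = 0 := by rw [← h1, Matrix.mul_zero]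
  rw [← Matrix.mul_assoc, h2, Matrix.one_mul, sub_eq_zero] at h3
  exact h3


/-! ### Dependence on a parameter -/

section Parameter

variable {n p : Type*} [Fintype n] [Fintype p] [DecidableEq n] {A : ℝ → Matrix n n ℂ}
  {E : Matrix n n ℂ} {z : ℂ} {Y : ℂ → ℝ → Matrix n p ℂ}

theorem entrySum_add_smul_le (A E : Matrix n n ℂ) {s : ℂ} (hs : ‖s‖ ≤ 1) :
    entrySum (A + s • E) ≤ entrySum A + entrySum E := by
  unfold entrySum
  rw [← Finset.sum_add_distrib]
  refine Finset.sum_le_sum fun i _ => ?_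
  rw [← Finset.sum_add_distrib]
  refine Finset.sum_le_sum fun j _ => (norm_add_le _ _).trans ?_
  have : ‖(s • E) i j‖ ≤ ‖E i j‖ := by
    rw [Matrix.smul_apply, smul_eq_mul, norm_mul]
    exact mul_le_of_le_one_left (norm_nonneg _) hs
  gcongr

/-- Solutions are bounded on compact intervals, locally uniformly in the parameter. -/
theorem eventually_norm_le_of_family (hA : LocallyIntegrableEntries A)
    (hY : ∀ᶠ w in 𝓝 z, IsMatrixPrimitive (Y w) fun x => (A x + (w - z) • E) * Y w x)
    {a : ℝ} (ha : ∀ i j, ContinuousAt (fun w => Y w a i j) z) (x₁ x₂ : ℝ) :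
    ∃ C : ℝ, ∀ᶠ w in 𝓝 z, ∀ t ∈ Set.uIcc x₁ x₂, ∀ j, ‖fun i => Y w t i j‖ ≤ C := by
  -- This ρ dominates the entries of A + (w - z)E for all |w - z| ≤ 1, so the Grönwall constant does
  -- not depend on w.
  set ρ : ℝ → ℝ := fun x => entrySum (A x) + entrySum E with hρd
  have hρ : LocallyIntegrable ρ :=
    (locallyIntegrable_entrySum hA).add (continuous_const.locallyIntegrable)
  have hαc := continuous_integral_of_locallyIntegrable hρ a
  obtain ⟨M, hM⟩ := (isCompact_uIcc (a := x₁) (b := x₂)).exists_bound_of_continuousOn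
    (f := fun x => Real.exp (2 * |∫ s in a..x, ρ s|)) (by fun_prop)
  have hS : ContinuousAt (fun w => ∑ j, ‖fun i => Y w a i j‖) z :=
    tendsto_finsetSum _ fun j _ => (continuousAt_pi.2 fun i => ha i j).norm
  set B := (∑ j, ‖fun i => Y z a i j‖) + 1 with hB
  have hb : ∀ᶠ w in 𝓝 z, ∑ j, ‖fun i => Y w a i j‖ < B :=
    hS.eventually (gt_mem_nhds (by rw [hB]; linarith))
  have hw : ∀ᶠ w in 𝓝 z, ‖w - z‖ < 1 := by
    filter_upwards [Metric.ball_mem_nhds z one_pos] with w hw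
    rwa [← dist_eq_norm]
  refine ⟨2 * B * M, ?_⟩
  filter_upwards [hY, hb, hw] with w h1 h2 h3 t ht j
  have h4 := norm_solution_le (A := fun x => A x + (w - z) • E) (Y := fun x i => Y w x i j)
    (fun i => by simpa only [Matrix.mul_apply] using h1 i j) hρ
    (fun x => entrySum_add_smul_le _ _ h3.le) a t
  have h5 : ‖fun i => Y w a i j‖ ≤ B :=
    (Finset.single_le_sum (f := fun j => ‖fun i => Y w a i j‖) (fun _ _ => norm_nonneg _)
      (Finset.mem_univ j)).trans h2.le
  have h6 := hM t ht
  rw [Real.norm_of_nonneg (Real.exp_pos _).le] at h6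
  have : 0 ≤ B := (norm_nonneg _).trans h5
  calc _ ≤ _ := h4
    _ ≤ 2 * B * M := by gcongr

/-- The difference of solutions of a system and of its perturbation. -/
theorem isMatrixPrimitive_adjoint_mul {P : ℝ → Matrix n n ℂ} {Y : ℝ → Matrix n p ℂ} {s : ℂ}
    (hP : IsMatrixPrimitive P fun x => -(P x * A x))
    (hY : IsMatrixPrimitive Y fun x => (A x + s • E) * Y x) :
    IsMatrixPrimitive (fun x => P x * Y x) fun x => s • (P x * E * Y x) := by
  convert! hP.mul hY using 2 with x
  rw [Matrix.add_mul, Matrix.mul_add, Matrix.neg_mul, ← Matrix.mul_assoc, neg_add_cancel_left,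
    Matrix.smul_mul, Matrix.mul_smul, Matrix.mul_assoc]

/-- Since P solves the unperturbed adjoint system, the terms with A cancel and only s P E Y remains.
The explicit factor s is what is divided out in difference quotients with respect to the parameter.
-/
theorem adjoint_mul_sub {P : ℝ → Matrix n n ℂ} {Y : ℝ → Matrix n p ℂ} {s : ℂ}
    (hP : IsMatrixPrimitive P fun x => -(P x * A x))
    (hY : IsMatrixPrimitive Y fun x => (A x + s • E) * Y x) (x y : ℝ) (i : n) (j : p) :
    (P y * Y y) i j - (P x * Y x) i j = s * ∫ t in x..y, (P t * E * Y t) i j := by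
  rw [(isMatrixPrimitive_adjoint_mul hP hY i j).2 x y]
  simp only [Matrix.smul_apply, smul_eq_mul, intervalIntegral.integral_const_mul]

theorem eventually_norm_entry_le {P : ℝ → Matrix n n ℂ} (hP : Continuous P)
    (hA : LocallyIntegrableEntries A)
    (hY : ∀ᶠ w in 𝓝 z, IsMatrixPrimitive (Y w) fun x => (A x + (w - z) • E) * Y w x)
    {a : ℝ} (ha : ∀ i j, ContinuousAt (fun w => Y w a i j) z) (x₁ x₂ : ℝ) :
    ∃ C : ℝ, ∀ᶠ w in 𝓝 z, ∀ t ∈ Set.uIcc x₁ x₂, ∀ i j, ‖(P t * E * Y w t) i j‖ ≤ C := by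
  obtain ⟨C, hC⟩ := eventually_norm_le_of_family hA hY ha x₁ x₂
  have hPE : Continuous fun t => entrySum (P t * E) := by
    unfold entrySum
    refine continuous_finsetSum _ fun i _ => continuous_finsetSum _ fun j _ => ?_
    exact ((hP.matrix_mul continuous_const).matrix_elem i j).norm
  obtain ⟨M, hM⟩ := (isCompact_uIcc (a := x₁) (b := x₂)).exists_bound_of_continuousOn
    hPE.continuousOn
  refine ⟨M * C, hC.mono fun w hw t ht i j => ?_⟩
  have h1 := hM t ht
  rw [Real.norm_of_nonneg (entrySum_nonneg _)] at h1
  have h0 : 0 ≤ M := (entrySum_nonneg _).trans h1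
  rw [Matrix.mul_apply]
  exact (norm_mulVec_le (P t * E) (fun k => Y w t k j) i).trans (by gcongr; exact hw t ht j)

theorem tendsto_sub_mul_of_bounded {g : ℂ → ℂ} {C : ℝ} (hg : ∀ᶠ w in 𝓝 z, ‖g w‖ ≤ C) :
    Tendsto (fun w => (w - z) * g w) (𝓝 z) (𝓝 0) := by
  have h1 : Tendsto (fun w => w - z) (𝓝 z) (𝓝 0) := by
    have : ContinuousAt (fun w => w - z) z := by fun_prop
    simpa [ContinuousAt] using this
  exact h1.zero_mul_isBoundedUnder_le ⟨C, by simpa using hg⟩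

/-- Solutions depend continuously on the parameter. -/
theorem continuousAt_parameter (hA : LocallyIntegrableEntries A)
    (hY : ∀ᶠ w in 𝓝 z, IsMatrixPrimitive (Y w) fun x => (A x + (w - z) • E) * Y w x)
    {a : ℝ} (ha : ∀ i j, ContinuousAt (fun w => Y w a i j) z) (x : ℝ) (i : n) (j : p) :
    ContinuousAt (fun w => Y w x i j) z := by
  obtain ⟨V, hVa, hV⟩ := exists_inverse_fundamentalMatrix hA a
  obtain ⟨U, hUa, hU⟩ := exists_fundamentalMatrix hA a
  have h2 : U x * V x = 1 := by
    rw [mul_eq_one_comm, left_inverse_solution hV hU x a, hVa, hUa, Matrix.one_mul]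
  obtain ⟨C, hC⟩ := eventually_norm_entry_le hV.continuous hA hY ha a x
  have h3 : ∀ k, ContinuousAt (fun w => (V x * Y w x) k j) z := by
    intro k
    have hb : ∀ᶠ w in 𝓝 z, ‖∫ t in a..x, (V t * E * Y w t) k j‖ ≤ C * |x - a| :=
      hC.mono fun w hw => intervalIntegral.norm_integral_le_of_norm_le_const fun t ht =>
        hw t (Set.uIoc_subset_uIcc ht) k j
    have h4 := (tendsto_sub_mul_of_bounded hb).add (ha k j)
    have h5 : ∀ᶠ w in 𝓝 z, (w - z) * (∫ t in a..x, (V t * E * Y w t) k j) + Y w a k j =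
        (V x * Y w x) k j := hY.mono fun w hw => by
      rw [← adjoint_mul_sub hV hw a x k j, hVa, Matrix.one_mul, sub_add_cancel]
    rw [ContinuousAt, ← h5.self_of_nhds]
    simpa using h4.congr' h5
  have h6 : (fun w => Y w x i j) = fun w => ∑ k, U x i k * (V x * Y w x) k j := by
    funext w
    rw [← Matrix.mul_apply, ← Matrix.mul_assoc, h2, Matrix.one_mul]
  rw [h6]
  exact tendsto_finsetSum _ fun k _ => (h3 k).const_mul _

/-- Dominated convergence: the constant bound is the locally uniform one, the pointwise limit is
`continuousAt_parameter`. The lemma supplies the limits of difference quotients below. -/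
theorem continuousAt_integral_parameter {P : ℝ → Matrix n n ℂ} (hP : Continuous P)
    (hA : LocallyIntegrableEntries A)
    (hY : ∀ᶠ w in 𝓝 z, IsMatrixPrimitive (Y w) fun x => (A x + (w - z) • E) * Y w x)
    {a : ℝ} (ha : ∀ i j, ContinuousAt (fun w => Y w a i j) z) (x₁ x₂ : ℝ) (i : n) (j : p) :
    ContinuousAt (fun w => ∫ t in x₁..x₂, (P t * E * Y w t) i j) z := by
  obtain ⟨C, hC⟩ := eventually_norm_entry_le hP hA hY ha x₁ x₂
  refine intervalIntegral.continuousAt_of_dominated_interval (bound := fun _ => C) ?_ ?_ ?_ ?_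
  · filter_upwards [hY] with w hw
    exact (((hP.matrix_mul continuous_const).matrix_mul hw.continuous).matrix_elem i j
      ).aestronglyMeasurable
  · filter_upwards [hC] with w hw
    exact ae_of_all _ fun t ht => hw t (Set.uIoc_subset_uIcc ht) i j
  · exact intervalIntegrable_const
  · refine ae_of_all _ fun t _ => ?_
    simp only [Matrix.mul_apply (M := P t * E)]
    exact tendsto_finsetSum _ fun k _ => (continuousAt_parameter hA hY ha t k j).const_mul _

/-- Solutions are complex differentiable in the parameter. -/
theorem differentiableAt_parameter (hA : LocallyIntegrableEntries A)
    (hY : ∀ᶠ w in 𝓝 z, IsMatrixPrimitive (Y w) fun x => (A x + (w - z) • E) * Y w x)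
    {a : ℝ} (ha : ∀ i j, DifferentiableAt ℂ (fun w => Y w a i j) z) (x : ℝ) (i : n) (j : p) :
    DifferentiableAt ℂ (fun w => Y w x i j) z := by
  obtain ⟨V, hVa, hV⟩ := exists_inverse_fundamentalMatrix hA a
  obtain ⟨U, hUa, hU⟩ := exists_fundamentalMatrix hA a
  have hac := fun i j => (ha i j).continuousAt
  have h2 : U x * V x = 1 := by
    rw [mul_eq_one_comm, left_inverse_solution hV hU x a, hVa, hUa, Matrix.one_mul]
  have h3 : ∀ k, DifferentiableAt ℂ (fun w => (V x * Y w x) k j) z := by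
    intro k
    have h5 : (fun w => (V x * Y w x) k j) =ᶠ[𝓝 z]
        fun w => (w - z) * (∫ t in a..x, (V t * E * Y w t) k j) + Y w a k j :=
      hY.mono fun w hw => by
        simp only
        rw [← adjoint_mul_sub hV hw a x k j, hVa, Matrix.one_mul, sub_add_cancel]
    refine DifferentiableAt.congr_of_eventuallyEq (DifferentiableAt.add ?_ (ha k j)) h5
    -- A function (w - z) g(w) has slope g(w) at z, so continuity of g at z is enough and the
    -- derivative is g(z).
    refine HasDerivAt.differentiableAt (f' := ∫ t in a..x, (V t * E * Y z t) k j)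
      (hasDerivAt_iff_tendsto_slope.2 ?_)
    refine ((continuousAt_integral_parameter hV.continuous hA hY hac a x k j).tendsto.mono_left
      nhdsWithin_le_nhds).congr' ?_
    filter_upwards [self_mem_nhdsWithin] with w hw
    rw [slope_def_field, sub_self, zero_mul, sub_zero, mul_div_cancel_left₀]
    exact sub_ne_zero.2 hw
  have h6 : (fun w => Y w x i j) = fun w => ∑ k, U x i k * (V x * Y w x) k j := by
    funext w
    rw [← Matrix.mul_apply, ← Matrix.mul_assoc, h2, Matrix.one_mul]
  rw [h6]
  exact DifferentiableAt.fun_sum fun k _ => (h3 k).const_mul _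

/-- The increment of `P Y'` for the derivative `Y'` of a family of solutions in the parameter and
for a solution `P` of the adjoint system. -/
theorem adjoint_mul_deriv_sub {P : ℝ → Matrix n n ℂ}
    (hP : IsMatrixPrimitive P fun x => -(P x * A x)) (hA : LocallyIntegrableEntries A)
    (hY : ∀ᶠ w in 𝓝 z, IsMatrixPrimitive (Y w) fun x => (A x + (w - z) • E) * Y w x)
    {Y' : ℝ → Matrix n p ℂ} (h : ∀ x i j, HasDerivAt (fun w => Y w x i j) (Y' x i j) z)
    (x y : ℝ) (i : n) (j : p) :
    (P y * Y' y) i j - (P x * Y' x) i j = ∫ t in x..y, (P t * E * Y z t) i j := by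
  have hd : ∀ x, HasDerivAt (fun w => (P x * Y w x) i j) ((P x * Y' x) i j) z := fun x => by
    simp only [Matrix.mul_apply]
    exact HasDerivAt.fun_sum fun k _ => (h x k j).const_mul _
  have h1 := hasDerivAt_iff_tendsto_slope.1 ((hd y).sub (hd x))
  -- The difference quotient of the increment of P Y_w tends to the left side by hypothesis. By
  -- `adjoint_mul_sub` it equals the integral with Y_w, which tends to the right side. No
  -- differential equation in x for Y' is needed.
  refine tendsto_nhds_unique h1 ?_
  refine ((continuousAt_integral_parameter hP.continuous hA hY
    (fun i j => (h x i j).continuousAt) x y i j).tendsto.mono_left nhdsWithin_le_nhds).congr' ?_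
  filter_upwards [self_mem_nhdsWithin, hY.filter_mono nhdsWithin_le_nhds] with w hw hYw
  have hz := adjoint_mul_sub hP hY.self_of_nhds x y i j
  rw [sub_self, zero_mul] at hz
  rw [slope_def_field]
  simp only [Pi.sub_apply]
  rw [hz, adjoint_mul_sub hP hYw x y i j, sub_zero, mul_div_cancel_left₀]
  exact sub_ne_zero.2 hw

end Parameter

/-- The derivative of a determinant (Jacobi's formula). -/
theorem hasDerivAt_det {n : Type*} [Fintype n] [DecidableEq n] {M : ℂ → Matrix n n ℂ}
    {M' : Matrix n n ℂ} {z : ℂ} (h : ∀ i j, HasDerivAt (fun w => M w i j) (M' i j) z)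
    (hz : (M z).det ≠ 0) :
    HasDerivAt (fun w => (M w).det) ((M z).det * ((M z)⁻¹ * M').trace) z := by
  -- The Leibniz expansion is differentiated one column at a time; Cramer's rule then identifies
  -- each determinant with a diagonal entry of adj(M) M'.
  have h1 : HasDerivAt (fun w => (M w).det)
      (∑ i, ((M z).updateCol i fun k => M' k i).det) z := by
    simp only [Matrix.det_apply]
    rw [Finset.sum_comm]
    refine HasDerivAt.fun_sum fun σ _ => ?_
    rw [← Finset.smul_sum]
    refine HasDerivAt.fun_const_smul _ ?_
    convert! HasDerivAt.fun_finsetProd (u := Finset.univ) fun i _ => h (σ i) i using 1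
    refine Finset.sum_congr rfl fun i _ => ?_
    rw [← Finset.mul_prod_erase _ _ (Finset.mem_univ i), mul_comm, smul_eq_mul]
    congr 1
    · refine Finset.prod_congr rfl fun k hk => ?_
      rw [Matrix.updateCol_ne (Finset.ne_of_mem_erase hk)]
    · simp
  convert! h1 using 1
  have h2 : ∀ i, ((M z).updateCol i fun k => M' k i).det = ((M z).adjugate * M') i i := fun i => by
    rw [← Matrix.cramer_apply, Matrix.cramer_eq_adjugate_mulVec]
    rfl
  simp only [h2]
  rw [Matrix.inv_def, Ring.inverse_eq_inv', Matrix.smul_mul, Matrix.trace_smul, smul_eq_mul,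
    mul_inv_cancel_left₀ hz]
  rfl


/-! ### The first order system of the differential equation -/

/-- The coefficient matrix of the first order system for `u, u', …, u^(N-1)`. -/
noncomputable def companion {N : ℕ} (v : Fin N → ℝ → ℂ) (z : ℂ) (x : ℝ) :
    Matrix (Fin N) (Fin N) ℂ :=
  Matrix.of fun k j => if (k : ℕ) + 1 = N then
    Complex.I ^ N * ((if (j : ℕ) = 0 then z else 0) - v j x)
    else if (j : ℕ) = k + 1 then 1 else 0

/-- The derivative of the coefficient matrix in the spectral parameter. -/
noncomputable def companionSlope (N : ℕ) : Matrix (Fin N) (Fin N) ℂ :=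
  Matrix.of fun k j => if (k : ℕ) + 1 = N then
    Complex.I ^ N * (if (j : ℕ) = 0 then 1 else 0) else 0

/-- The matrix of the derivatives `u_j^(k)(x)`, `k < N`. -/
noncomputable def jetMatrix (N : ℕ) {m : Type*} (u : m → ℝ → ℂ) (x : ℝ) : Matrix (Fin N) m ℂ :=
  Matrix.of fun k j => iteratedDeriv (k : ℕ) (u j) x

variable {N : ℕ} {v : Fin N → ℝ → ℂ}

/-- The spectral parameter occurs in a single entry, linearly, so the equation has the form A + (w -
z)E to which the results on parameters apply. -/
theorem companion_eq_add (z w : ℂ) (x : ℝ) :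
    companion v w x = companion v z x + (w - z) • companionSlope N := by
  ext k j
  simp only [companion, companionSlope, Matrix.add_apply, Matrix.smul_apply, Matrix.of_apply,
    smul_eq_mul]
  split_ifs <;> ring

theorem locallyIntegrable_of_memLp {f : ℝ → ℂ} (hf : MemLp f 2 volume) : LocallyIntegrable f :=
  hf.locallyIntegrable (by norm_num)

theorem locallyIntegrableEntries_companion (hv : ∀ j, LocallyIntegrable (v j)) (z : ℂ) :
    LocallyIntegrableEntries (companion v z) := fun k j => by
  simp only [companion, Matrix.of_apply]
  split_ifs
  · exact locallyIntegrable_continuous_mul continuous_const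
      (continuous_const.locallyIntegrable.sub (hv j))
  · exact locallyIntegrable_continuous_mul continuous_const
      (continuous_const.locallyIntegrable.sub (hv j))
  all_goals exact continuous_const.locallyIntegrable

theorem sum_companion_of_lt {k : Fin N} (hk : (k : ℕ) + 1 < N) (z : ℂ) (x : ℝ) (y : Fin N → ℂ) :
    ∑ j, companion v z x k j * y j = y ⟨k + 1, hk⟩ := by
  rw [Finset.sum_eq_single ⟨(k : ℕ) + 1, hk⟩]
  · simp [companion, hk.ne]
  · intro j _ hj
    have : (j : ℕ) ≠ k + 1 := fun h => hj (Fin.ext h)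
    simp [companion, hk.ne, this]
  · simp

theorem sum_companion_last {k : Fin N} (hk : (k : ℕ) + 1 = N) (hN : 0 < N) (z : ℂ) (x : ℝ)
    (y : Fin N → ℂ) :
    ∑ j, companion v z x k j * y j = Complex.I ^ N * (z * y ⟨0, hN⟩ - ∑ j, v j x * y j) := by
  have h1 : ∀ j : Fin N, companion v z x k j * y j =
      Complex.I ^ N * ((if j = ⟨0, hN⟩ then z * y j else 0) - v j x * y j) := fun j => by
    simp only [companion, hk, Matrix.of_apply, if_true, Fin.ext_iff]
    split_ifs <;> ring
  simp only [h1]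
  rw [← Finset.mul_sum, Finset.sum_sub_distrib]
  simp

theorem I_pow_ne_zero (N : ℕ) : Complex.I ^ N ≠ 0 := pow_ne_zero _ Complex.I_ne_zero

/-- The derivatives of a solution of the inhomogeneous equation solve the first order system. -/
theorem isPrimitive_iteratedDeriv {z : ℂ} {u f : ℝ → ℂ} (hN : 0 < N)
    (hu : IsLocallyRegular N u) (h : ∀ᵐ x : ℝ, diffExpr v u x = z * u x + f x) (k : Fin N) :
    IsPrimitive (fun x => iteratedDeriv k u x) fun x =>
      ∑ j, companion v z x k j * iteratedDeriv j u x +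
        if (k : ℕ) + 1 = N then Complex.I ^ N * f x else 0 := by
  by_cases hk : (k : ℕ) + 1 = N
  · have hk' : (k : ℕ) = N - 1 := by omega
    have h1 := IsPrimitive.of_absolutelyContinuous hu.2
    rw [← iteratedDeriv_succ, Nat.sub_add_cancel hN] at h1
    rw [hk']
    refine h1.congr_ae ?_
    filter_upwards [h] with x hx
    rw [sum_companion_last hk hN, if_pos (Nat.sub_add_cancel hN)]
    unfold diffExpr at hx
    have h2 : (Complex.I ^ N)⁻¹ * iteratedDeriv N u x =
        z * u x + f x - ∑ j : Fin N, v j x * iteratedDeriv (j : ℕ) u x := by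
      rw [← hx]; ring
    rw [inv_mul_eq_iff_eq_mul₀ (I_pow_ne_zero N)] at h2
    rw [h2]
    simp only [iteratedDeriv_zero]
    ring
  · have hlt : (k : ℕ) + 1 < N := by omega
    simp only [if_neg hk, add_zero, sum_companion_of_lt hlt]
    refine IsPrimitive.of_hasDerivAt (fun x => ?_) ?_
    · have hd := hu.1.differentiable_iteratedDeriv (k : ℕ) (by
        have : (k : ℕ) < N - 1 := by omega
        exact_mod_cast this)
      rw [iteratedDeriv_succ]
      exact (hd x).hasDerivAt
    · exact hu.1.continuous_iteratedDeriv _ (by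
        have : (k : ℕ) + 1 ≤ N - 1 := by omega
        exact_mod_cast this)

theorem isMatrixPrimitive_jetMatrix {m : Type*} {z : ℂ} {u : m → ℝ → ℂ} (hN : 0 < N)
    (hu : ∀ j, IsSolution v z (u j)) :
    IsMatrixPrimitive (jetMatrix N u) fun x => companion v z x * jetMatrix N u x := fun k j => by
  have := isPrimitive_iteratedDeriv (f := 0) hN (hu j).1
    (by simpa using (hu j).2) k
  simpa [Matrix.mul_apply, jetMatrix] using this

/-- Solutions of the first order system yield solutions of the inhomogeneous equation. -/
theorem iteratedDeriv_of_isPrimitive {z : ℂ} {Y : ℝ → Fin N → ℂ} {f : ℝ → ℂ} (hN : 0 < N)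
    (hY : ∀ k : Fin N, IsPrimitive (fun x => Y x k) fun x =>
      ∑ j, companion v z x k j * Y x j + if (k : ℕ) + 1 = N then Complex.I ^ N * f x else 0) :
    (∀ (k : Fin N) x, iteratedDeriv k (fun x => Y x ⟨0, hN⟩) x = Y x k) ∧
      IsLocallyRegular N (fun x => Y x ⟨0, hN⟩) ∧
      ∀ᵐ x : ℝ, diffExpr v (fun x => Y x ⟨0, hN⟩) x = z * Y x ⟨0, hN⟩ + f x := by
  have hd : ∀ (k : Fin N) (hk : (k : ℕ) + 1 < N) x,
      HasDerivAt (fun x => Y x k) (Y x ⟨k + 1, hk⟩) x := fun k hk x => by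
    have h1 := hY k
    simp only [if_neg hk.ne, add_zero, sum_companion_of_lt hk] at h1
    exact h1.hasDerivAt (hY ⟨k + 1, hk⟩).continuous x
  have h1 : ∀ (k : ℕ) (hk : k < N), iteratedDeriv k (fun x => Y x ⟨0, hN⟩) =
      fun x => Y x ⟨k, hk⟩ := by
    intro k
    induction k with
    | zero => intro hk; simp
    | succ k ih =>
      intro hk
      rw [iteratedDeriv_succ, ih (by omega)]
      funext x
      exact (hd ⟨k, by omega⟩ hk x).deriv
  have hlast : N - 1 < N := by omega
  refine ⟨fun k x => by rw [h1 k k.2], ⟨?_, ?_⟩, ?_⟩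
  · refine contDiff_iff_iteratedDeriv.2 ⟨fun m hm => ?_, fun m hm => ?_⟩
    · have hm' : m ≤ N - 1 := by exact_mod_cast hm
      rw [h1 m (by omega)]
      exact (hY _).continuous
    · have hm' : m < N - 1 := by exact_mod_cast hm
      rw [h1 m (by omega)]
      exact fun x => (hd ⟨m, by omega⟩ (by simp only; omega) x).differentiableAt
  · intro a b
    rw [h1 _ hlast]
    exact (hY _).absolutelyContinuous a b
  · have hk : ((⟨N - 1, hlast⟩ : Fin N) : ℕ) + 1 = N := by simp only; omega
    filter_upwards [(hY ⟨N - 1, hlast⟩).ae_hasDerivAt] with x hx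
    rw [if_pos hk, sum_companion_last hk hN] at hx
    have h2 : iteratedDeriv N (fun x => Y x ⟨0, hN⟩) x =
        deriv (fun x => Y x ⟨N - 1, hlast⟩) x := by
      have h4 : ∀ g : ℝ → ℂ, iteratedDeriv N g = deriv (iteratedDeriv (N - 1) g) := fun g => by
        rw [← iteratedDeriv_succ, Nat.sub_add_cancel hN]
      rw [h4, h1 _ hlast]
    rw [hx.deriv] at h2
    rw [diffExpr, h2]
    have h3 : ∀ j : Fin N, iteratedDeriv (j : ℕ) (fun x => Y x ⟨0, hN⟩) x = Y x j := fun j => by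
      rw [h1 j j.2]
    simp only [h3]
    field_simp [I_pow_ne_zero N]
    ring


/-! ### Distinguished systems of solutions -/

/-- The exponentials `exp (ζ_j x)`. -/
noncomputable def expSystem {m : Type*} (ζ : m → ℂ) : m → ℝ → ℂ :=
  fun j y => Complex.exp (ζ j * (y : ℂ))

theorem hasDerivAt_exp_mul (ζ : ℂ) (x : ℝ) :
    HasDerivAt (fun y : ℝ => Complex.exp (ζ * y)) (ζ * Complex.exp (ζ * x)) x := by
  have h : HasDerivAt (fun y : ℂ => Complex.exp (ζ * y)) (Complex.exp (ζ * x) * (ζ * 1)) x :=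
    ((hasDerivAt_id (x : ℂ)).const_mul ζ).cexp
  convert! h.comp_ofReal using 1
  ring

theorem iteratedDeriv_exp_mul (ζ : ℂ) (k : ℕ) :
    iteratedDeriv k (fun y : ℝ => Complex.exp (ζ * y)) =
      fun x : ℝ => ζ ^ k * Complex.exp (ζ * x) := by
  induction k with
  | zero => simp
  | succ k ih =>
    rw [iteratedDeriv_succ, ih]
    funext x
    rw [((hasDerivAt_exp_mul ζ x).const_mul (ζ ^ k)).deriv]
    ring

theorem contDiff_exp_mul (ζ : ℂ) (n : WithTop ℕ∞) :
    ContDiff ℝ n fun y : ℝ => Complex.exp (ζ * y) :=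
  Complex.contDiff_exp.comp (contDiff_const.mul Complex.ofRealCLM.contDiff)

variable {N : ℕ} {v : Fin N → ℝ → ℂ} {z : ℂ} {ζ : Fin N → ℂ} {u : Fin N → ℝ → ℂ}

theorem isSolution_exp_mul {ζ : ℂ} (h : ζ ^ N = Complex.I ^ N * z) :
    IsSolution (0 : Fin N → ℝ → ℂ) z fun y : ℝ => Complex.exp (ζ * y) := by
  refine ⟨⟨contDiff_exp_mul ζ _, fun a b => ?_⟩, ae_of_all _ fun x => ?_⟩
  · rw [iteratedDeriv_exp_mul]
    exact (contDiff_const.mul (contDiff_exp_mul ζ 1)).contDiffOn.absolutelyContinuousOnInterval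
  · simp only [diffExpr, iteratedDeriv_exp_mul, h, Pi.zero_apply, zero_mul, Finset.sum_const_zero,
      add_zero, mul_assoc]
    rw [inv_mul_cancel_left₀ (I_pow_ne_zero N)]

theorem isDistinguishedSystem_expSystem (hinj : Function.Injective ζ)
    (hroot : ∀ j, ζ j ^ N = Complex.I ^ N * z) (hre : ∀ j, (ζ j).re ≠ 0) :
    IsDistinguishedSystem (0 : Fin N → ℝ → ℂ) z ζ (expSystem ζ) :=
  ⟨hinj, hroot, hre, fun j => isSolution_exp_mul (hroot j), fun _ _ _ _ => rfl,
    fun _ _ _ _ => rfl⟩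

theorem jetMatrix_expSystem {m : Type*} (ζ : m → ℂ) (x : ℝ) (k : Fin N) (j : m) :
    jetMatrix N (expSystem ζ) x k j = ζ j ^ (k : ℕ) * Complex.exp (ζ j * x) := by
  exact congrFun (iteratedDeriv_exp_mul (ζ j) k) x

theorem jetMatrix_expSystem_eq_mul (ζ : Fin N → ℂ) (x : ℝ) :
    jetMatrix N (expSystem ζ) x =
      (Matrix.vandermonde ζ).transpose * Matrix.diagonal fun j => Complex.exp (ζ j * x) := by
  ext k j
  rw [jetMatrix_expSystem, Matrix.mul_diagonal, Matrix.transpose_apply, Matrix.vandermonde_apply]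

theorem det_vandermonde_transpose_ne_zero (hinj : Function.Injective ζ) :
    ((Matrix.vandermonde ζ).transpose).det ≠ 0 := by
  rw [Matrix.det_transpose]
  exact Matrix.det_vandermonde_ne_zero_iff.2 hinj

theorem inv_jetMatrix_expSystem (hinj : Function.Injective ζ) (x : ℝ) (i j : Fin N) :
    ((jetMatrix N (expSystem ζ) x)⁻¹ : Matrix (Fin N) (Fin N) ℂ) i j =
      Complex.exp (-(ζ i * x)) * ((Matrix.vandermonde ζ).transpose)⁻¹ i j := by
  have h : (jetMatrix N (expSystem ζ) x)⁻¹ =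
      (Matrix.diagonal fun j => Complex.exp (-(ζ j * x))) * ((Matrix.vandermonde ζ).transpose)⁻¹ := by
    refine Matrix.inv_eq_left_inv ?_
    rw [jetMatrix_expSystem_eq_mul, Matrix.mul_assoc, ← Matrix.mul_assoc _ (Matrix.transpose _),
      Matrix.nonsing_inv_mul _ (isUnit_iff_ne_zero.2 (det_vandermonde_transpose_ne_zero hinj)),
      Matrix.one_mul, Matrix.diagonal_mul_diagonal]
    simp [← Complex.exp_add]
  rw [h, Matrix.diagonal_mul]

theorem det_jetMatrix_expSystem_ne_zero (hinj : Function.Injective ζ) (x : ℝ) :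
    (jetMatrix N (expSystem ζ) x).det ≠ 0 := by
  rw [jetMatrix_expSystem_eq_mul, Matrix.det_mul, Matrix.det_diagonal]
  exact mul_ne_zero (det_vandermonde_transpose_ne_zero hinj)
    (Finset.prod_ne_zero_iff.2 fun _ _ => Complex.exp_ne_zero _)

/-- The supports of the coefficients lie in the interval `[a, b]`. -/
structure SupportedIn (v : Fin N → ℝ → ℂ) (a b : ℝ) : Prop where
  le : a ≤ b
  left : ∀ x < a, ∀ k, ∀ y ∈ tsupport (v k), x < y
  right : ∀ x, b < x → ∀ k, ∀ y ∈ tsupport (v k), y < x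

theorem exists_supportedIn (hsupp : ∀ j, HasCompactSupport (v j)) : ∃ a b, SupportedIn v a b := by
  have hc : IsCompact (⋃ j, tsupport (v j)) := isCompact_iUnion fun j => hsupp j
  obtain ⟨r, hr⟩ := hc.isBounded.subset_closedBall 0
  have h : ∀ k, ∀ y ∈ tsupport (v k), |y| ≤ |r| := fun k y hy => by
    have := hr (Set.mem_iUnion.2 ⟨k, hy⟩)
    rw [Metric.mem_closedBall, dist_zero_right, Real.norm_eq_abs] at this
    exact this.trans (le_abs_self r)
  refine ⟨-|r|, |r|, by linarith [abs_nonneg r], fun x hx k y hy => ?_, fun x hx k y hy => ?_⟩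
  · linarith [(abs_le.1 (h k y hy)).1]
  · linarith [(abs_le.1 (h k y hy)).2]

theorem companion_eq_zero_of_left {x : ℝ} (h : ∀ k, ∀ y ∈ tsupport (v k), x < y) (z : ℂ) :
    companion v z x = companion (0 : Fin N → ℝ → ℂ) z x := by
  ext k j
  simp [companion, image_eq_zero_of_notMem_tsupport fun hx => lt_irrefl x (h j x hx)]

theorem companion_eq_zero_of_right {x : ℝ} (h : ∀ k, ∀ y ∈ tsupport (v k), y < x) (z : ℂ) :
    companion v z x = companion (0 : Fin N → ℝ → ℂ) z x := by
  ext k j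
  simp [companion, image_eq_zero_of_notMem_tsupport fun hx => lt_irrefl x (h j x hx)]

theorem locallyIntegrable_zero_coefficients (j : Fin N) :
    LocallyIntegrable ((0 : Fin N → ℝ → ℂ) j) :=
  (locallyIntegrable_zero : LocallyIntegrable (fun _ : ℝ => (0 : ℂ)) volume)

namespace IsDistinguishedSystem

theorem jetMatrix_left (h : IsDistinguishedSystem v z ζ u) {a b : ℝ} (hab : SupportedIn v a b)
    {j : Fin N} (hj : 0 < (ζ j).re) {x : ℝ} (hx : x < a) (k : Fin N) :
    jetMatrix N u x k j = jetMatrix N (expSystem ζ) x k j := by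
  have : u j =ᶠ[𝓝 x] expSystem ζ j := by
    filter_upwards [Iio_mem_nhds hx] with y hy using h.left j hj y (hab.left y hy)
  exact this.iteratedDeriv_eq k

theorem jetMatrix_right (h : IsDistinguishedSystem v z ζ u) {a b : ℝ} (hab : SupportedIn v a b)
    {j : Fin N} (hj : (ζ j).re < 0) {x : ℝ} (hx : b < x) (k : Fin N) :
    jetMatrix N u x k j = jetMatrix N (expSystem ζ) x k j := by
  have : u j =ᶠ[𝓝 x] expSystem ζ j := by
    filter_upwards [Ioi_mem_nhds hx] with y hy using h.right j hj y (hab.right y hy)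
  exact this.iteratedDeriv_eq k

theorem isMatrixPrimitive (h : IsDistinguishedSystem v z ζ u) (hN : 0 < N) :
    IsMatrixPrimitive (jetMatrix N u) fun x => companion v z x * jetMatrix N u x :=
  isMatrixPrimitive_jetMatrix hN h.solution

/-- A distinguished system is determined by its numbering. -/
theorem jetMatrix_unique {u' : Fin N → ℝ → ℂ} (h : IsDistinguishedSystem v z ζ u)
    (h' : IsDistinguishedSystem v z ζ u') (hN : 0 < N) (hv : ∀ j, LocallyIntegrable (v j))
    (hsupp : ∀ j, HasCompactSupport (v j)) (x : ℝ) : jetMatrix N u x = jetMatrix N u' x := by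
  obtain ⟨a, b, hab⟩ := exists_supportedIn hsupp
  ext k j
  -- Each column is treated as a system of its own, because the point c where its jet is known
  -- depends on the sign of Re ζ_j.
  have key : ∀ c, (∀ k, jetMatrix N u c k j = jetMatrix N u' c k j) →
      jetMatrix N u x k j = jetMatrix N u' x k j := fun c hc => by
    have := solution_eq_on (locallyIntegrableEntries_companion hv z)
      (isMatrixPrimitive_jetMatrix (u := fun _ : Unit => u j) hN fun _ => h.solution j)
      (isMatrixPrimitive_jetMatrix (u := fun _ : Unit => u' j) hN fun _ => h'.solution j)
      (a := c) (x := x) (fun _ _ => rfl) (by ext i _; exact hc i)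
    exact congrFun (congrFun this k) ()
  rcases lt_or_gt_of_ne (h.re_ne_zero j) with hj | hj
  · exact key (b + 1) fun k => by
      rw [h.jetMatrix_right hab hj (by linarith), h'.jetMatrix_right hab hj (by linarith)]
  · exact key (a - 1) fun k => by
      rw [h.jetMatrix_left hab hj (by linarith), h'.jetMatrix_left hab hj (by linarith)]

theorem comp_perm (h : IsDistinguishedSystem v z ζ u) (σ : Equiv.Perm (Fin N)) :
    IsDistinguishedSystem v z (ζ ∘ σ) (u ∘ σ) :=
  ⟨h.injective.comp σ.injective, fun j => h.root (σ j), fun j => h.re_ne_zero (σ j),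
    fun j => h.solution (σ j), fun j => h.left (σ j), fun j => h.right (σ j)⟩

end IsDistinguishedSystem

/-- Give u_j the jet of exp(ζ_j x) at a point beyond the supports, on the side where the
normalization is imposed. Uniqueness for the free system keeps u_j equal to the exponential on that
whole side. -/
theorem exists_isDistinguishedSystem (hN : 0 < N) (hv : ∀ j, LocallyIntegrable (v j))
    (hsupp : ∀ j, HasCompactSupport (v j)) (hinj : Function.Injective ζ)
    (hroot : ∀ j, ζ j ^ N = Complex.I ^ N * z) (hre : ∀ j, (ζ j).re ≠ 0) :
    ∃ u, IsDistinguishedSystem v z ζ u := by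
  obtain ⟨a, b, hab⟩ := exists_supportedIn hsupp
  have hA := locallyIntegrableEntries_companion hv z
  set c : Fin N → ℝ := fun j => if 0 < (ζ j).re then a - 1 else b + 1 with hc
  choose Y hYc hY using fun j => exists_solution hA (c j)
    (fun k => jetMatrix N (expSystem ζ) (c j) k j)
  have hY' : ∀ j (k : Fin N), IsPrimitive (fun x => Y j x k) fun x =>
      ∑ i, companion v z x k i * Y j x i +
        if (k : ℕ) + 1 = N then Complex.I ^ N * (0 : ℝ → ℂ) x else 0 := fun j k => by
    simpa using hY j k
  have hfree : ∀ j x, (∀ t ∈ Set.uIcc (c j) x,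
      companion v z t = companion (0 : Fin N → ℝ → ℂ) z t) →
      Y j x ⟨0, hN⟩ = Complex.exp (ζ j * x) := fun j x hx => by
    have := solution_eq_on
      (locallyIntegrableEntries_companion locallyIntegrable_zero_coefficients z)
      (Y := fun x => Matrix.of fun (k : Fin N) (_ : Unit) => Y j x k)
      (fun k _ => by simpa [Matrix.mul_apply] using hY j k)
      (isMatrixPrimitive_jetMatrix (u := fun _ : Unit => expSystem ζ j) hN
        fun _ => isSolution_exp_mul (hroot j))
      hx (by ext k _; simpa [jetMatrix] using congrFun (hYc j) k)
    have := congrFun (congrFun this ⟨0, hN⟩) ()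
    simpa [jetMatrix, expSystem] using this
  refine ⟨fun j x => Y j x ⟨0, hN⟩, hinj, hroot, hre, fun j => ?_, fun j hj x hx => ?_,
    fun j hj x hx => ?_⟩
  · obtain ⟨_, h2, h3⟩ := iteratedDeriv_of_isPrimitive hN (hY' j)
    exact ⟨h2, by simpa using h3⟩
  -- The point x lies to the left of every support but not necessarily of a; with empty supports it
  -- is arbitrary. Both x and a - 1 lie to the left of each support point, hence so does the
  -- interval between them.
  · refine hfree j x fun t ht => companion_eq_zero_of_left (fun k y hy => ?_) z
    simp only [hc, if_pos hj] at ht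
    rw [Set.mem_uIcc] at ht
    have h1 := hx k y hy
    have h2 := hab.left (a - 1) (by linarith) k y hy
    rcases ht with ht | ht <;> linarith
  · refine hfree j x fun t ht => companion_eq_zero_of_right (fun k y hy => ?_) z
    simp only [hc, if_neg hj.not_gt] at ht
    rw [Set.mem_uIcc] at ht
    have h1 := hx k y hy
    have h2 := hab.right (b + 1) (by linarith) k y hy
    rcases ht with ht | ht <;> linarith

/-- Two numberings of the roots differ by a permutation. -/
theorem exists_perm_of_roots {ζ' : Fin N → ℂ} {c : ℂ} (hN : 0 < N)
    (h : Function.Injective ζ) (h' : Function.Injective ζ')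
    (hr : ∀ j, ζ j ^ N = c) (hr' : ∀ j, ζ' j ^ N = c) :
    ∃ σ : Equiv.Perm (Fin N), ζ' = ζ ∘ σ := by
  classical
  have hcard : (Polynomial.nthRoots N c).toFinset.card ≤ N :=
    (Multiset.toFinset_card_le _).trans (Polynomial.card_nthRoots N c)
  have himg : Finset.univ.image ζ = (Polynomial.nthRoots N c).toFinset := by
    refine Finset.eq_of_subset_of_card_le (fun w hw => ?_) ?_
    · obtain ⟨j, _, rfl⟩ := Finset.mem_image.1 hw
      rw [Multiset.mem_toFinset, Polynomial.mem_nthRoots hN]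
      exact hr j
    · rw [Finset.card_image_of_injective _ h]
      simpa using hcard
  have hex : ∀ j, ∃ i, ζ i = ζ' j := fun j => by
    have : ζ' j ∈ Finset.univ.image ζ := by
      rw [himg, Multiset.mem_toFinset, Polynomial.mem_nthRoots hN]
      exact hr' j
    obtain ⟨i, _, hi⟩ := Finset.mem_image.1 this
    exact ⟨i, hi⟩
  choose s hs using hex
  have hsi : Function.Injective s := fun i j hij => h' (by rw [← hs, ← hs, hij])
  exact ⟨Equiv.ofBijective s (Finite.injective_iff_bijective.1 hsi), funext fun j => (hs j).symm⟩

/-- A numbering of the roots off the real powers. -/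
theorem exists_numbering (hN : 0 < N) (hz : ∀ ξ : ℝ, z ≠ (ξ : ℂ) ^ N) :
    ∃ ζ : Fin N → ℂ, Function.Injective ζ ∧ (∀ j, ζ j ^ N = Complex.I ^ N * z) ∧
      ∀ j, (ζ j).re ≠ 0 := by
  obtain ⟨ζ₀, h0⟩ := IsAlgClosed.exists_pow_nat_eq (Complex.I ^ N * z) hN
  have hz0 : z ≠ 0 := by simpa [hN.ne'] using hz 0
  have hζ0 : ζ₀ ≠ 0 := by
    rintro rfl
    rw [zero_pow hN.ne'] at h0
    exact mul_ne_zero (I_pow_ne_zero N) hz0 h0.symm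
  have hω := Complex.isPrimitiveRoot_exp N hN.ne'
  set ω := Complex.exp (2 * Real.pi * Complex.I / N)
  have hroot : ∀ j : Fin N, (ζ₀ * ω ^ (j : ℕ)) ^ N = Complex.I ^ N * z := fun j => by
    rw [mul_pow, h0, ← pow_mul, mul_comm (j : ℕ), pow_mul, hω.pow_eq_one, one_pow, mul_one]
  refine ⟨fun j => ζ₀ * ω ^ (j : ℕ), fun i j hij => ?_, hroot, fun j hj => ?_⟩
  · exact Fin.ext (hω.pow_inj i.2 j.2 (mul_left_cancel₀ hζ0 hij))
  · have h1 := hroot j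
    change (ζ₀ * ω ^ (j : ℕ)).re = 0 at hj
    set w := ζ₀ * ω ^ (j : ℕ)
    -- A purely imaginary root would give z = (Im w)^N, a real N-th power.
    have h2 : w = Complex.I * (w.im : ℂ) := by
      apply Complex.ext <;> simp [hj]
    rw [h2, mul_pow] at h1
    exact hz w.im (mul_left_cancel₀ (I_pow_ne_zero N) h1).symm

theorem wronskian_comp_perm (u : Fin N → ℝ → ℂ) (σ : Equiv.Perm (Fin N)) (x : ℝ) :
    wronskian (u ∘ σ) x = (Equiv.Perm.sign σ : ℂ) * wronskian u x :=
  Matrix.det_permute' σ (jetMatrix N u x)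

/-- For a fixed numbering the solutions are unique. Renumbering multiplies both Wronskians by the
sign of the permutation, which cancels in the quotient. -/
theorem isNormalizedWronskian_unique (hN : 0 < N) (hv : ∀ j, LocallyIntegrable (v j))
    (hsupp : ∀ j, HasCompactSupport (v j)) {x : ℝ} {d d' : ℂ}
    (h : IsNormalizedWronskian v x z d) (h' : IsNormalizedWronskian v x z d') : d = d' := by
  obtain ⟨ζ, u, hu, rfl⟩ := h
  obtain ⟨ζ', u', hu', rfl⟩ := h'
  obtain ⟨σ, rfl⟩ := exists_perm_of_roots hN hu.injective hu'.injective hu.root hu'.root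
  have h1 : wronskian u' x = wronskian (u ∘ σ) x :=
    congrArg Matrix.det (hu'.jetMatrix_unique (hu.comp_perm σ) hN hv hsupp x)
  have h2 := wronskian_comp_perm (expSystem ζ) σ x
  have h3 : (Equiv.Perm.sign σ : ℂ) ≠ 0 := by
    rcases Int.units_eq_one_or (Equiv.Perm.sign σ) with h | h <;> simp [h]
  rw [h1, wronskian_comp_perm]
  change _ = _ / wronskian (expSystem ζ ∘ σ) x
  rw [h2, mul_div_mul_left _ _ h3]
  rfl

theorem existsUnique_isNormalizedWronskian (hN : 0 < N) (hv : ∀ j, LocallyIntegrable (v j))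
    (hsupp : ∀ j, HasCompactSupport (v j)) (hz : ∀ ξ : ℝ, z ≠ (ξ : ℂ) ^ N) (x : ℝ) :
    ∃! d, IsNormalizedWronskian v x z d := by
  obtain ⟨ζ, h1, h2, h3⟩ := exists_numbering hN hz
  obtain ⟨u, hu⟩ := exists_isDistinguishedSystem hN hv hsupp h1 h2 h3
  exact ⟨_, ⟨ζ, u, hu, rfl⟩, fun d hd => isNormalizedWronskian_unique hN hv hsupp hd ⟨ζ, u, hu, rfl⟩⟩

/-- Uniqueness removes the choice from `normalizedWronskian`: it may be computed from any
distinguished system, in particular from a family whose roots vary holomorphically with z. -/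
theorem normalizedWronskian_eq (hN : 0 < N) (hv : ∀ j, LocallyIntegrable (v j))
    (hsupp : ∀ j, HasCompactSupport (v j)) (hu : IsDistinguishedSystem v z ζ u) (x : ℝ) :
    normalizedWronskian v x z =
      (jetMatrix N u x).det / (jetMatrix N (expSystem ζ) x).det := by
  have h : ∃ d, IsNormalizedWronskian v x z d := ⟨_, ζ, u, hu, rfl⟩
  unfold normalizedWronskian
  rw [dif_pos h]
  exact isNormalizedWronskian_unique hN hv hsupp h.choose_spec ⟨ζ, u, hu, rfl⟩


/-! ### The spectrum contains the spectrum of the free operator -/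

variable {N : ℕ} {v : Fin N → ℝ → ℂ} {z : ℂ}

theorem IsResolvent.exists_solution
    {R : Lp ℂ 2 (volume : Measure ℝ) →L[ℂ] Lp ℂ 2 (volume : Measure ℝ)} (hR : IsResolvent v z R)
    (f : Lp ℂ 2 (volume : Measure ℝ)) :
    ∃ u, IsSobolev N u ∧ R f =ᵐ[volume] u ∧ ∀ᵐ x : ℝ, diffExpr v u x = z * u x + f x := by
  obtain ⟨g, ⟨u, hu, h1, h2⟩, hg⟩ := (hR f (R f)).1 rfl
  refine ⟨u, hu, h1, ?_⟩
  filter_upwards [h1, h2, Lp.coeFn_sub g (z • R f), Lp.coeFn_smul z (R f)] with x hx1 hx2 hx3 hx4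
  rw [hg, Pi.sub_apply, hx4, Pi.smul_apply, hx1, hx2, smul_eq_mul] at hx3
  rw [hx3]
  ring

theorem mem_operatorGraph_of_solution {u : ℝ → ℂ} (hu : IsSobolev N u)
    {f φ : Lp ℂ 2 (volume : Measure ℝ)} (hφ : φ =ᵐ[volume] u)
    (h : ∀ᵐ x : ℝ, diffExpr v u x = z * u x + f x) :
    ∃ g : Lp ℂ 2 (volume : Measure ℝ), (φ, g) ∈ operatorGraph v ∧ g - z • φ = f := by
  refine ⟨f + z • φ, ⟨u, hu, hφ, ?_⟩, by abel⟩
  filter_upwards [hφ, h, Lp.coeFn_add f (z • φ), Lp.coeFn_smul z φ] with x h1 h2 h3 h4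
  simp only [h3, h2, Pi.add_apply, h4, Pi.smul_apply, smul_eq_mul, h1]
  ring

/-- The left eigenvectors of the free system. -/
theorem sum_pow_mul_companion_zero {ζ : ℂ} (hζ : ζ ^ N = Complex.I ^ N * z) (x : ℝ) (j : Fin N) :
    ∑ k : Fin N, ζ ^ (N - 1 - (k : ℕ)) * companion (0 : Fin N → ℝ → ℂ) z x k j =
      ζ * ζ ^ (N - 1 - (j : ℕ)) := by
  have hN : 0 < N := j.pos
  by_cases hj : (j : ℕ) = 0
  · rw [Finset.sum_eq_single ⟨N - 1, by omega⟩]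
    · have h1 : N - 1 + 1 = N := by omega
      simp only [companion, Matrix.of_apply, h1, if_true, hj, Pi.zero_apply, sub_zero, ← hζ,
        Nat.sub_self, pow_zero, one_mul, Nat.sub_zero, ← pow_succ']
    · intro k _ hk
      have h1 : (k : ℕ) + 1 ≠ N := fun h => hk (Fin.ext (by simp only; omega))
      simp [companion, h1, hj]
    · simp
  · rw [Finset.sum_eq_single ⟨(j : ℕ) - 1, by omega⟩]
    · have h1 : (j : ℕ) - 1 + 1 ≠ N := by omega
      have h2 : companion (0 : Fin N → ℝ → ℂ) z x ⟨(j : ℕ) - 1, by omega⟩ j = 1 := by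
        simp only [companion, Matrix.of_apply, if_neg h1]
        rw [if_pos (by omega)]
      rw [h2, mul_one, ← pow_succ']
      congr 1
      simp only
      omega
    · intro k _ hk
      have h1 : (j : ℕ) ≠ k + 1 := fun h => hk (Fin.ext (by simp only; omega))
      simp [companion, h1, hj]
    · simp

/-- Factorization of the free equation: `y = ∑ ζ^(N-1-k) u^(k)` solves `y' = ζ y + i^N f`. -/
theorem isPrimitive_sum_pow_mul_iteratedDeriv {ζ : ℂ} (hN : 0 < N)
    (hζ : ζ ^ N = Complex.I ^ N * z) {u f : ℝ → ℂ} (hu : IsLocallyRegular N u)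
    (h : ∀ᵐ x : ℝ, diffExpr (0 : Fin N → ℝ → ℂ) u x = z * u x + f x) :
    IsPrimitive (fun x => ∑ k : Fin N, ζ ^ (N - 1 - (k : ℕ)) * iteratedDeriv k u x)
      fun x => ζ * (∑ k : Fin N, ζ ^ (N - 1 - (k : ℕ)) * iteratedDeriv k u x) +
        Complex.I ^ N * f x := by
  convert! IsPrimitive.sum Finset.univ fun (k : Fin N) _ =>
    (isPrimitive_iteratedDeriv hN hu h k).const_mul (ζ ^ (N - 1 - (k : ℕ))) using 2 with x
  simp only [mul_add, Finset.sum_add_distrib, Finset.mul_sum]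
  congr 1
  · rw [Finset.sum_comm]
    refine Finset.sum_congr rfl fun j _ => ?_
    rw [← mul_assoc, ← sum_pow_mul_companion_zero hζ x j, Finset.sum_mul]
    exact Finset.sum_congr rfl fun k _ => by ring
  · rw [Finset.sum_eq_single ⟨N - 1, by omega⟩]
    · rw [if_pos (by simp only; omega)]
      simp
    · intro k _ hk
      have h1 : (k : ℕ) + 1 ≠ N := fun h => hk (Fin.ext (by simp only; omega))
      simp [h1]
    · simp

/-- Variation of the constant. -/
theorem IsPrimitive.exp_neg_mul {ζ : ℂ} {y g : ℝ → ℂ} (h : IsPrimitive y fun x => ζ * y x + g x) :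
    IsPrimitive (fun x : ℝ => Complex.exp (-(ζ * x)) * y x)
      fun x : ℝ => Complex.exp (-(ζ * x)) * g x := by
  have h1 : IsPrimitive (fun x : ℝ => Complex.exp (-ζ * x))
      fun x : ℝ => -ζ * Complex.exp (-ζ * x) :=
    IsPrimitive.of_hasDerivAt (hasDerivAt_exp_mul (-ζ)) (by fun_prop)
  convert! h1.mul h using 2 with x
  · rw [neg_mul]
  · simp only [neg_mul]; ring

/-- The potential terms are moved into the source, so that the factorization of the free equation is
available for H; beyond the supports the source is just f. -/
theorem diffExpr_zero_eq {u f : ℝ → ℂ} {x : ℝ} (h : diffExpr v u x = z * u x + f x) :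
    diffExpr (0 : Fin N → ℝ → ℂ) u x =
      z * u x + (f x - ∑ j : Fin N, v j x * iteratedDeriv (j : ℕ) u x) := by
  simp only [diffExpr, Pi.zero_apply, zero_mul, Finset.sum_const_zero, add_zero] at h ⊢
  rw [← add_sub_assoc, ← h]
  ring

theorem memLp_sum_pow_mul_iteratedDeriv {u : ℝ → ℂ} (hu : IsSobolev N u) (ζ : ℂ) :
    MemLp (fun x => ∑ k : Fin N, ζ ^ (N - 1 - (k : ℕ)) * iteratedDeriv k u x) 2 volume :=
  memLp_finsetSum _ fun k _ => (hu.2 k k.2.le).const_mul _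

/-- A square integrable function does not stay away from zero at infinity. -/
theorem not_memLp_of_one_le_norm {y : ℝ → ℂ} {c : ℝ} (h : ∀ x, c ≤ x → 1 ≤ ‖y x‖) :
    ¬ MemLp y 2 volume := by
  intro hy
  have h1 : Integrable (fun x => ‖y x‖ ^ 2) := hy.integrable_norm_pow (by norm_num)
  have h2 : IntegrableOn (fun _ : ℝ => (1 : ℝ)) (Set.Ici c) := by
    refine Integrable.mono' h1.integrableOn aestronglyMeasurable_const ?_
    rw [ae_restrict_iff' measurableSet_Ici]
    exact ae_of_all _ fun x hx => by
      have := h x hx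
      rw [norm_one]
      nlinarith
  rw [integrableOn_const_iff] at h2
  simp at h2

/-- This is the resonant source: (1 + |x|)⁻¹ is square integrable but not integrable. -/
theorem memLp_exp_div (ξ : ℝ) :
    MemLp (fun x : ℝ => Complex.exp (Complex.I * ξ * x) * ((1 + |x|)⁻¹ : ℝ)) 2 volume := by
  have hpos : ∀ x : ℝ, 0 < 1 + |x| := fun x => by positivity
  have hc : Continuous fun x : ℝ => Complex.exp (Complex.I * ξ * x) * ((1 + |x|)⁻¹ : ℝ) := by
    have : Continuous fun x : ℝ => (1 + |x|)⁻¹ := by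
      refine Continuous.inv₀ (by fun_prop) fun x => (hpos x).ne'
    fun_prop
  rw [memLp_two_iff_integrable_sq_norm hc.aestronglyMeasurable]
  have h1 : Integrable (fun x : ℝ => (1 + ‖x‖) ^ (-2 : ℝ)) :=
    integrable_one_add_norm (by simp)
  refine h1.congr (ae_of_all _ fun x => ?_)
  simp only
  rw [norm_mul, mul_assoc, mul_comm Complex.I, ← Complex.ofReal_mul, Complex.norm_exp_ofReal_mul_I,
    one_mul, Complex.norm_real, Real.norm_eq_abs x, Real.rpow_neg (hpos x).le,
    Real.norm_of_nonneg (inv_pos.2 (hpos x)).le]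
  norm_num

/-- If z = ξ^N, then ζ = iξ is a purely imaginary root. For the solution u with source
exp(iξx)/(1+|x|), put y = Σ ζ^(N-1-k) u^(k). Beyond the supports y' = iξ y + i^N f₀, so exp(-iξx) y
grows like log x, while u in the Sobolev class forces y to be square integrable. -/
theorem ne_pow_of_isResolvent (hN : 0 < N) (hsupp : ∀ j, HasCompactSupport (v j))
    {R : Lp ℂ 2 (volume : Measure ℝ) →L[ℂ] Lp ℂ 2 (volume : Measure ℝ)} (hR : IsResolvent v z R)
    (ξ : ℝ) : z ≠ (ξ : ℂ) ^ N := by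
  rintro rfl
  obtain ⟨a, b, hab⟩ := exists_supportedIn hsupp
  set f₀ : ℝ → ℂ := fun x : ℝ => Complex.exp (Complex.I * ξ * x) * ((1 + |x|)⁻¹ : ℝ) with hf₀
  obtain ⟨u, hu, -, hue⟩ := hR.exists_solution (memLp_exp_div ξ).toLp
  have hue' : ∀ᵐ x : ℝ, diffExpr v u x = (ξ : ℂ) ^ N * u x + f₀ x := by
    filter_upwards [hue, (memLp_exp_div ξ).coeFn_toLp] with x h1 h2
    rw [h1, h2]
  have hζ : (Complex.I * ξ) ^ N = Complex.I ^ N * (ξ : ℂ) ^ N := mul_pow _ _ _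
  have hy := (isPrimitive_sum_pow_mul_iteratedDeriv hN hζ hu.1
    (hue'.mono fun x hx => diffExpr_zero_eq hx)).exp_neg_mul
  have hyL := memLp_sum_pow_mul_iteratedDeriv hu (Complex.I * ξ)
  set y : ℝ → ℂ := fun x => ∑ k : Fin N, (Complex.I * ξ) ^ (N - 1 - (k : ℕ)) * iteratedDeriv k u x
  -- For t ≥ c the coefficients vanish and |t| = t, so the equation for y can be integrated
  -- explicitly.
  set c : ℝ := max b 0 + 1 with hc
  have hcb : b < c := by rw [hc]; linarith [le_max_left b 0]
  have hc0 : 0 < c := by rw [hc]; linarith [le_max_right b 0]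
  have hform : ∀ x, c ≤ x → Complex.exp (-(Complex.I * ξ * x)) * y x -
      Complex.exp (-(Complex.I * ξ * c)) * y c =
        Complex.I ^ N * (Real.log (1 + x) - Real.log (1 + c) : ℝ) := by
    intro x hx
    rw [hy.2 c x]
    have h1 : ∀ t ∈ Set.uIcc c x, HasDerivAt (fun t : ℝ => Complex.I ^ N * (Real.log (1 + t) : ℂ))
        (Complex.I ^ N * ((1 + t)⁻¹ : ℝ)) t := fun t ht => by
      rw [Set.uIcc_of_le hx] at ht
      have : HasDerivAt (fun t : ℝ => Real.log (1 + t)) ((1 + t)⁻¹) t := by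
        simpa using ((hasDerivAt_id t).const_add 1).log (by simp only [id]; linarith [ht.1])
      exact this.ofReal_comp.const_mul _
    have h2 : ContinuousOn (fun t : ℝ => Complex.I ^ N * (((1 + t)⁻¹ : ℝ) : ℂ)) (Set.uIcc c x) := by
      rw [Set.uIcc_of_le hx]
      refine continuousOn_const.mul (Complex.continuous_ofReal.comp_continuousOn ?_)
      exact ContinuousOn.inv₀ (by fun_prop) fun t ht => by linarith [ht.1]
    have h3 := intervalIntegral.integral_eq_sub_of_hasDerivAt h1 h2.intervalIntegrable
    rw [Complex.ofReal_sub, mul_sub, ← h3]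
    refine intervalIntegral.integral_congr fun t ht => ?_
    rw [Set.uIcc_of_le hx] at ht
    have h4 : ∀ j, v j t = 0 := fun j => image_eq_zero_of_notMem_tsupport fun h =>
      lt_irrefl t (hab.right t (by linarith [ht.1]) j t h)
    simp only [h4, zero_mul, Finset.sum_const_zero, sub_zero, hf₀]
    rw [abs_of_pos (by linarith [ht.1]), mul_left_comm, ← mul_assoc (Complex.exp _),
      ← Complex.exp_add, neg_add_cancel, Complex.exp_zero, one_mul]
  have hnorm : ∀ (x : ℝ) (w : ℂ), ‖Complex.exp (-(Complex.I * ξ * x)) * w‖ = ‖w‖ := fun x w => by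
    rw [norm_mul, show -(Complex.I * ξ * x) = ((-(ξ * x) : ℝ) : ℂ) * Complex.I by push_cast; ring,
      Complex.norm_exp_ofReal_mul_I, one_mul]
  have hlim : Tendsto (fun x : ℝ => Real.log (1 + x)) atTop atTop :=
    Real.tendsto_log_atTop.comp (tendsto_atTop_add_const_left _ _ tendsto_id)
  obtain ⟨X, hX⟩ := eventually_atTop.1 (hlim.eventually_ge_atTop (Real.log (1 + c) + ‖y c‖ + 1))
  refine not_memLp_of_one_le_norm (c := max X c) (fun x hx => ?_) hyL
  have h1 := hX x ((le_max_left _ _).trans hx)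
  have h2 := congrArg norm (hform x ((le_max_right _ _).trans hx))
  rw [norm_mul, norm_pow, Complex.norm_I, one_pow, one_mul, Complex.norm_real] at h2
  have h3 := norm_sub_le (Complex.exp (-(Complex.I * ξ * x)) * y x)
    (Complex.exp (-(Complex.I * ξ * c)) * y c)
  rw [h2, hnorm, hnorm] at h3
  have h4 := Real.le_norm_self (Real.log (1 + x) - Real.log (1 + c))
  linarith


/-! ### Convolution with integrable kernels on `L²` -/

/-- Cauchy–Schwarz for the weight κ, after writing κ F as κ^(1/2) times κ^(1/2) F. -/
theorem lintegral_mul_rpow_two_le {α : Type*} [MeasurableSpace α] (μ : Measure α)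
    {κ F : α → ENNReal} (hκ : AEMeasurable κ μ) (hF : AEMeasurable F μ) :
    (∫⁻ a, κ a * F a ∂μ) ^ (2 : ℝ) ≤ (∫⁻ a, κ a ∂μ) * ∫⁻ a, κ a * F a ^ (2 : ℝ) ∂μ := by
  have hs : ∀ a, κ a ^ (1 / 2 : ℝ) * κ a ^ (1 / 2 : ℝ) = κ a := fun a => by
    rw [← ENNReal.rpow_add_of_nonneg _ _ (by norm_num) (by norm_num)]
    norm_num
  have h := ENNReal.lintegral_mul_le_Lp_mul_Lq μ Real.HolderConjugate.two_two
    (f := fun a => κ a ^ (1 / 2 : ℝ)) (g := fun a => κ a ^ (1 / 2 : ℝ) * F a)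
    (hκ.pow_const _) ((hκ.pow_const _).mul hF)
  have h1 : ∀ a, ((fun a => κ a ^ (1 / 2 : ℝ)) * fun a => κ a ^ (1 / 2 : ℝ) * F a) a = κ a * F a :=
    fun a => by rw [Pi.mul_apply, ← mul_assoc, hs]
  have h2 : ∀ a, (κ a ^ (1 / 2 : ℝ)) ^ (2 : ℝ) = κ a := fun a => by
    rw [← ENNReal.rpow_mul]; norm_num
  simp only [h1, h2, ENNReal.mul_rpow_of_nonneg _ _ (by norm_num : (0 : ℝ) ≤ 2)] at h
  calc _ ≤ ((∫⁻ a, κ a ∂μ) ^ (1 / 2 : ℝ) * (∫⁻ a, κ a * F a ^ (2 : ℝ) ∂μ) ^ (1 / 2 : ℝ)) ^ (2 : ℝ) :=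
        ENNReal.rpow_le_rpow h (by norm_num)
    _ = _ := by
        rw [ENNReal.mul_rpow_of_nonneg _ _ (by norm_num), ← ENNReal.rpow_mul, ← ENNReal.rpow_mul]
        norm_num

/-- Young's inequality for convolutions of integrable and square integrable functions. -/
theorem lintegral_enorm_convolution_le {k f : ℝ → ℂ} (hk : Measurable k)
    (hf : AEStronglyMeasurable f volume) :
    ∫⁻ x, ‖∫ y, k (x - y) * f y‖ₑ ^ (2 : ℝ) ≤
      (∫⁻ s, ‖k s‖ₑ) ^ (2 : ℝ) * ∫⁻ y, ‖f y‖ₑ ^ (2 : ℝ) := by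
  set C := ∫⁻ s, ‖k s‖ₑ with hC
  have hkm : Measurable fun s => ‖k s‖ₑ := hk.enorm
  have hF : AEMeasurable (fun y => ‖f y‖ₑ ^ (2 : ℝ)) := hf.enorm.pow_const _
  have h1 : ∀ x, ‖∫ y, k (x - y) * f y‖ₑ ^ (2 : ℝ) ≤
      C * ∫⁻ y, ‖k (x - y)‖ₑ * ‖f y‖ₑ ^ (2 : ℝ) := fun x => by
    have e : C = ∫⁻ y, ‖k (x - y)‖ₑ := (lintegral_sub_left_eq_self (fun s => ‖k s‖ₑ) x).symm
    rw [e]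
    refine le_trans ?_ (lintegral_mul_rpow_two_le volume
      (hkm.comp (measurable_const.sub measurable_id)).aemeasurable hf.enorm)
    refine ENNReal.rpow_le_rpow ((enorm_integral_le_lintegral_enorm _).trans_eq ?_) (by norm_num)
    simp only [enorm_mul]
  calc _ ≤ ∫⁻ x, C * ∫⁻ y, ‖k (x - y)‖ₑ * ‖f y‖ₑ ^ (2 : ℝ) := lintegral_mono h1
    _ ≤ C * ∫⁻ x, ∫⁻ y, ‖k (x - y)‖ₑ * ‖f y‖ₑ ^ (2 : ℝ) := by
        rw [lintegral_const_mul'']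
        have : AEMeasurable (Function.uncurry fun x y : ℝ => ‖k (x - y)‖ₑ * ‖f y‖ₑ ^ (2 : ℝ))
            (volume.prod volume) :=
          ((hkm.comp (measurable_fst.sub measurable_snd)).aemeasurable).mul
            (hF.comp_quasiMeasurePreserving Measure.quasiMeasurePreserving_snd)
        exact this.lintegral_prod_right'
    _ = C * ∫⁻ y, ∫⁻ x, ‖k (x - y)‖ₑ * ‖f y‖ₑ ^ (2 : ℝ) := by
        rw [lintegral_lintegral_swap]
        exact ((hkm.comp (measurable_fst.sub measurable_snd)).aemeasurable).mul
            (hF.comp_quasiMeasurePreserving Measure.quasiMeasurePreserving_snd)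
    _ = C * ∫⁻ y, C * ‖f y‖ₑ ^ (2 : ℝ) := by
        congr 1
        refine lintegral_congr fun y => ?_
        rw [lintegral_mul_const (f := fun x : ℝ => ‖k (x - y)‖ₑ) _
          (hkm.comp (measurable_id.sub measurable_const))]
        congr 1
        exact lintegral_sub_right_eq_self (fun s => ‖k s‖ₑ) y
    _ = _ := by
        rw [lintegral_const_mul'' _ hF, ← mul_assoc]
        congr 1
        rw [ENNReal.rpow_two, sq]

theorem eLpNorm_two_le_of_lintegral {g f : ℝ → ℂ} {C : ENNReal}
    (h : ∫⁻ x, ‖g x‖ₑ ^ (2 : ℝ) ≤ C ^ (2 : ℝ) * ∫⁻ y, ‖f y‖ₑ ^ (2 : ℝ)) :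
    eLpNorm g 2 volume ≤ C * eLpNorm f 2 volume := by
  rw [eLpNorm_eq_lintegral_rpow_enorm_toReal (by norm_num) (by norm_num),
    eLpNorm_eq_lintegral_rpow_enorm_toReal (by norm_num) (by norm_num)]
  simp only [ENNReal.toReal_ofNat]
  calc _ ≤ (C ^ (2 : ℝ) * ∫⁻ y, ‖f y‖ₑ ^ (2 : ℝ)) ^ (1 / 2 : ℝ) :=
        ENNReal.rpow_le_rpow h (by norm_num)
    _ = _ := by
        rw [ENNReal.mul_rpow_of_nonneg _ _ (by norm_num), ← ENNReal.rpow_mul]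
        norm_num

/-- Convolution with an integrable and square integrable kernel, as a bounded operator. -/
theorem exists_convolution_operator {k : ℝ → ℂ} (hk : Measurable k) (h1 : Integrable k)
    (h2 : MemLp k 2 volume) :
    ∃ S : Lp ℂ 2 (volume : Measure ℝ) →L[ℂ] Lp ℂ 2 (volume : Measure ℝ),
      ∀ f : Lp ℂ 2 (volume : Measure ℝ), S f =ᵐ[volume] fun x => ∫ y, k (x - y) * f y := by
  -- Square integrability of k makes the integral converge for every x and not only almost every x,
  -- so linearity can be checked pointwise.
  have hint : ∀ (f : Lp ℂ 2 (volume : Measure ℝ)) x, Integrable fun y => k (x - y) * f y :=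
    fun f x => (h2.comp_measurePreserving
      (Measure.measurePreserving_sub_left volume x)).integrable_mul (Lp.memLp f)
  set C := ∫⁻ s, ‖k s‖ₑ with hC
  have hCtop : C ≠ ⊤ := h1.2.ne
  have hle : ∀ f : Lp ℂ 2 (volume : Measure ℝ),
      eLpNorm (fun x => ∫ y, k (x - y) * f y) 2 volume ≤ C * eLpNorm f 2 volume := fun f =>
    eLpNorm_two_le_of_lintegral (lintegral_enorm_convolution_le hk (Lp.aestronglyMeasurable f))
  have hmem : ∀ f : Lp ℂ 2 (volume : Measure ℝ),
      MemLp (fun x => ∫ y, k (x - y) * f y) 2 volume := fun f => by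
    refine ⟨?_, (hle f).trans_lt (ENNReal.mul_lt_top hCtop.lt_top (Lp.memLp f).2)⟩
    have : AEStronglyMeasurable (fun p : ℝ × ℝ => k (p.1 - p.2) * f p.2)
        (volume.prod volume) :=
      ((hk.comp (measurable_fst.sub measurable_snd)).aestronglyMeasurable).mul
        ((Lp.aestronglyMeasurable f).comp_quasiMeasurePreserving
          Measure.quasiMeasurePreserving_snd)
    exact this.integral_prod_right'
  let S : Lp ℂ 2 (volume : Measure ℝ) →ₗ[ℂ] Lp ℂ 2 (volume : Measure ℝ) :=
    { toFun := fun f => (hmem f).toLp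
      map_add' := fun f g => by
        rw [← MemLp.toLp_add]
        refine MemLp.toLp_congr _ _ (ae_of_all _ fun x => ?_)
        rw [Pi.add_apply, ← integral_add (hint f x) (hint g x)]
        refine integral_congr_ae ?_
        filter_upwards [Lp.coeFn_add f g] with y hy
        rw [hy, Pi.add_apply, mul_add]
      map_smul' := fun c f => by
        rw [RingHom.id_apply, ← MemLp.toLp_const_smul]
        refine MemLp.toLp_congr _ _ (ae_of_all _ fun x => ?_)
        rw [Pi.smul_apply, smul_eq_mul, ← integral_const_mul]
        refine integral_congr_ae ?_
        filter_upwards [Lp.coeFn_smul c f] with y hy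
        rw [hy, Pi.smul_apply, smul_eq_mul, mul_left_comm] }
  refine ⟨S.mkContinuous C.toReal fun f => ?_, fun f => (hmem f).coeFn_toLp⟩
  change ‖(hmem f).toLp‖ ≤ _
  rw [Lp.norm_toLp, Lp.norm_def, ← ENNReal.toReal_mul]
  exact ENNReal.toReal_mono (ENNReal.mul_ne_top hCtop (Lp.memLp f).2.ne) (hle f)

/-! ### The resolvent of the free operator -/

theorem memLp_two_exp_indicator {s : Set ℝ} (hs : MeasurableSet s) (ζ : ℂ)
    (h : IntegrableOn (fun x : ℝ => Complex.exp (2 * ζ * x)) s) :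
    MemLp (s.indicator fun x : ℝ => Complex.exp (ζ * x)) 2 volume := by
  rw [memLp_indicator_iff_restrict hs]
  have hc : Continuous fun x : ℝ => Complex.exp (ζ * x) := (contDiff_exp_mul ζ 0).continuous
  rw [memLp_two_iff_integrable_sq_norm hc.aestronglyMeasurable]
  refine h.norm.congr (ae_of_all _ fun x => ?_)
  simp only
  rw [← norm_pow, ← Complex.exp_nat_mul]
  congr 2
  push_cast
  ring

/-- The bounded inverse of `∂ - ζ`, for `ζ` off the imaginary axis. -/
theorem exists_firstOrder_resolvent {ζ : ℂ} (hζ : ζ.re ≠ 0) :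
    ∃ S : Lp ℂ 2 (volume : Measure ℝ) →L[ℂ] Lp ℂ 2 (volume : Measure ℝ),
      ∀ f : Lp ℂ 2 (volume : Measure ℝ), ∃ g : ℝ → ℂ, S f =ᵐ[volume] g ∧
        IsPrimitive g fun x => ζ * g x + f x := by
  have hexp : IsPrimitive (fun x : ℝ => Complex.exp (ζ * x)) fun x : ℝ => ζ * Complex.exp (ζ * x) :=
    IsPrimitive.of_hasDerivAt (hasDerivAt_exp_mul ζ) (by fun_prop)
  have hcont : ∀ ζ : ℂ, Continuous fun x : ℝ => Complex.exp (ζ * x) := fun ζ =>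
    (contDiff_exp_mul ζ 0).continuous
  have hfin : ∀ (f : Lp ℂ 2 (volume : Measure ℝ)) (H : ℝ → ℂ),
      (∀ x y, H y - H x = ∫ t in x..y, Complex.exp (-ζ * t) * f t) →
      IsPrimitive (fun x : ℝ => Complex.exp (ζ * x) * H x)
        fun x : ℝ => ζ * (Complex.exp (ζ * x) * H x) + f x := fun f H hH => by
    have h1 : IsPrimitive H fun t : ℝ => Complex.exp (-ζ * t) * f t :=
      ⟨locallyIntegrable_continuous_mul (hcont (-ζ)) (locallyIntegrable_of_memLp (Lp.memLp f)), hH⟩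
    convert! hexp.mul h1 using 2 with x
    rw [← mul_assoc (Complex.exp _) (Complex.exp _), ← Complex.exp_add, ← add_mul, add_neg_cancel,
      zero_mul, Complex.exp_zero]
    ring
  have hsplit : ∀ x y : ℝ, Complex.exp (ζ * (x - y : ℝ)) =
      Complex.exp (ζ * x) * Complex.exp (-ζ * y) := fun x y => by
    rw [← Complex.exp_add]; congr 1; push_cast; ring
  -- The integral is taken from -∞ if Re ζ < 0 and from +∞, with a minus sign, if Re ζ > 0; in both
  -- cases the convolution kernel decays exponentially.
  rcases lt_or_gt_of_ne hζ with hneg | hpos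
  · set k : ℝ → ℂ := (Set.Ici 0).indicator fun x : ℝ => Complex.exp (ζ * x) with hk
    have hi : ∀ ζ : ℂ, ζ.re < 0 → IntegrableOn (fun x : ℝ => Complex.exp (ζ * x)) (Set.Ici 0) :=
      fun ζ h => (integrableOn_Ici_iff_integrableOn_Ioi (by simp)).2 (integrableOn_exp_mul_complex_Ioi h 0)
    have hi' : ∀ (ζ : ℂ) (x : ℝ), 0 < ζ.re →
        IntegrableOn (fun x : ℝ => Complex.exp (ζ * x)) (Set.Iic x) :=
      fun ζ x h => integrableOn_exp_mul_complex_Iic h x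
    obtain ⟨S, hS⟩ := exists_convolution_operator (k := k)
      ((hcont ζ).measurable.indicator measurableSet_Ici)
      ((integrable_indicator_iff measurableSet_Ici).2 (hi ζ hneg))
      (memLp_two_exp_indicator measurableSet_Ici ζ (hi (2 * ζ) (by simp; linarith)))
    refine ⟨S, fun f => ⟨fun x => Complex.exp (ζ * x) *
      ∫ y in Set.Iic x, Complex.exp (-ζ * y) * f y, ?_, hfin f _ fun x y => ?_⟩⟩
    · refine (hS f).trans (ae_of_all _ fun x => ?_)
      simp only
      rw [← integral_const_mul, ← integral_indicator measurableSet_Iic]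
      refine integral_congr_ae (ae_of_all _ fun y => ?_)
      by_cases hy : y ≤ x
      · simp only [hk]
        rw [Set.indicator_of_mem (by simpa using hy), Set.indicator_of_mem (by simpa using hy),
          hsplit, mul_assoc]
      · simp only [hk]
        rw [Set.indicator_of_notMem (by simpa using hy), Set.indicator_of_notMem (by simpa using hy),
          zero_mul]
    · have hI : ∀ x : ℝ, IntegrableOn (fun y : ℝ => Complex.exp (-ζ * y) * f y) (Set.Iic x) :=
        fun x => by
          have := (memLp_two_exp_indicator measurableSet_Iic (-ζ)
            (hi' (2 * -ζ) x (by simp; linarith))).integrable_mul (Lp.memLp f)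
          rw [← integrable_indicator_iff measurableSet_Iic]
          refine this.congr (ae_of_all _ fun y => ?_)
          by_cases hy : y ≤ x <;> simp [Set.indicator, hy]
      exact intervalIntegral.integral_Iic_sub_Iic (hI x) (hI y)
  · set k : ℝ → ℂ := fun s => -(Set.Iio 0).indicator (fun x : ℝ => Complex.exp (ζ * x)) s with hk
    have hi : ∀ ζ : ℂ, 0 < ζ.re → IntegrableOn (fun x : ℝ => Complex.exp (ζ * x)) (Set.Iio 0) :=
      fun ζ h => (integrableOn_Iic_iff_integrableOn_Iio (by simp)).1 (integrableOn_exp_mul_complex_Iic h 0)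
    have hi' : ∀ (ζ : ℂ) (x : ℝ), ζ.re < 0 →
        IntegrableOn (fun x : ℝ => Complex.exp (ζ * x)) (Set.Ioi x) :=
      fun ζ x h => integrableOn_exp_mul_complex_Ioi h x
    obtain ⟨S, hS⟩ := exists_convolution_operator (k := k)
      ((hcont ζ).measurable.indicator measurableSet_Iio).neg
      ((integrable_indicator_iff measurableSet_Iio).2 (hi ζ hpos)).neg
      (memLp_two_exp_indicator measurableSet_Iio ζ (hi (2 * ζ) (by simp; linarith))).neg
    refine ⟨S, fun f => ⟨fun x => Complex.exp (ζ * x) *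
      -∫ y in Set.Ioi x, Complex.exp (-ζ * y) * f y, ?_, hfin f _ fun x y => ?_⟩⟩
    · refine (hS f).trans (ae_of_all _ fun x => ?_)
      simp only
      rw [← integral_neg, ← integral_const_mul, ← integral_indicator measurableSet_Ioi]
      refine integral_congr_ae (ae_of_all _ fun y => ?_)
      by_cases hy : x < y
      · simp only [hk]
        rw [Set.indicator_of_mem (by simpa using hy), Set.indicator_of_mem (by simpa using hy),
          hsplit]
        ring
      · simp only [hk]
        rw [Set.indicator_of_notMem (by simpa using hy), Set.indicator_of_notMem (by simpa using hy),
          neg_zero, zero_mul]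
    · have hI : ∀ x : ℝ, IntegrableOn (fun y : ℝ => Complex.exp (-ζ * y) * f y) (Set.Ioi x) :=
        fun x => by
          have := (memLp_two_exp_indicator measurableSet_Ioi (-ζ)
            (hi' (2 * -ζ) x (by simp; linarith))).integrable_mul (Lp.memLp f)
          rw [← integrable_indicator_iff measurableSet_Ioi]
          refine this.congr (ae_of_all _ fun y => ?_)
          by_cases hy : x < y <;> simp [Set.indicator, hy]
      rw [← intervalIntegral.integral_Ioi_sub_Ioi' (hI x) (hI y)]
      ring

/-- Exponentials are not square integrable. -/
theorem eq_zero_of_isPrimitive_mul {ζ : ℂ} (hζ : ζ.re ≠ 0) {y : ℝ → ℂ}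
    (hy : IsPrimitive y fun x => ζ * y x) (hL : MemLp y 2 volume) (x : ℝ) : y x = 0 := by
  have h0 : IsPrimitive y fun x => ζ * y x + 0 := by simpa using hy
  have h1 := h0.exp_neg_mul
  have h2 : ∀ x : ℝ, y x = y 0 * Complex.exp (ζ * x) := fun x => by
    have := h1.eq_of_ae_zero (ae_of_all _ fun t => by simp) x 0
    simp only [Complex.ofReal_zero, mul_zero, neg_zero, Complex.exp_zero, one_mul] at this
    rw [← this, mul_right_comm, ← Complex.exp_add, neg_add_cancel, Complex.exp_zero, one_mul]
  by_contra hne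
  have hC : 0 < ‖y 0‖ := norm_pos_iff.2 fun h => hne (by rw [h2, h, zero_mul])
  have h3 : ∀ x : ℝ, ‖y x‖ = ‖y 0‖ * Real.exp (ζ.re * x) := fun x => by
    rw [h2, norm_mul, Complex.norm_exp]
    simp
  have h4 : ∀ x : ℝ, -Real.log ‖y 0‖ ≤ ζ.re * x → 1 ≤ ‖y x‖ := fun x hx => by
    rw [h3, ← Real.exp_log hC, ← Real.exp_add]
    exact Real.one_le_exp (by linarith)
  rcases lt_or_gt_of_ne hζ with hneg | hpos
  · refine not_memLp_of_one_le_norm (y := fun x => y (-x)) (c := -Real.log ‖y 0‖ / -ζ.re)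
      (fun x hx => h4 (-x) ?_) (hL.comp_measurePreserving (Measure.measurePreserving_neg volume))
    rw [div_le_iff₀ (by linarith)] at hx
    linarith
  · refine not_memLp_of_one_le_norm (c := -Real.log ‖y 0‖ / ζ.re) (fun x hx => h4 x ?_) hL
    rw [div_le_iff₀ hpos] at hx
    linarith

variable {N : ℕ} {z : ℂ} {ζ : Fin N → ℂ}

/-- For i = N - 1 the entries of the inverse are the coefficients in the partial fraction expansion
of 1/∏(ζ - ζ_j). -/
theorem sum_inv_vandermonde_mul_pow (hinj : Function.Injective ζ) (i k : Fin N) :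
    ∑ j, ζ j ^ (k : ℕ) * ((Matrix.vandermonde ζ).transpose)⁻¹ j i = if k = i then 1 else 0 := by
  have h := congrFun (congrFun (Matrix.mul_nonsing_inv _
    (isUnit_iff_ne_zero.2 (det_vandermonde_transpose_ne_zero hinj))) k) i
  rw [Matrix.mul_apply, Matrix.one_apply] at h
  simpa only [Matrix.transpose_apply, Matrix.vandermonde_apply] using h

/-- Partial fractions: H₀ - z = i^(-N) ∏(∂ - ζ_j) is inverted by i^N Σ c_j (∂ - ζ_j)⁻¹. The moments
Σ ζ_j^k c_j vanish for k < N - 1 and equal 1 for k = N - 1, so the source enters only the equation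
for the highest derivative. -/
theorem exists_isResolvent_zero (hN : 0 < N) (hz : ∀ ξ : ℝ, z ≠ (ξ : ℂ) ^ N) :
    ∃ R, IsResolvent (0 : Fin N → ℝ → ℂ) z R := by
  obtain ⟨ζ, hinj, hroot, hre⟩ := exists_numbering hN hz
  choose S hS using fun j => exists_firstOrder_resolvent (hre j)
  have hl : N - 1 < N := by omega
  set c : Fin N → ℂ := fun j => ((Matrix.vandermonde ζ).transpose)⁻¹ j ⟨N - 1, hl⟩ with hc
  have hsum : ∀ k : Fin N, ∑ j, ζ j ^ (k : ℕ) * c j = if (k : ℕ) + 1 = N then 1 else 0 := fun k => by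
    rw [sum_inv_vandermonde_mul_pow hinj]
    have : k = ⟨N - 1, hl⟩ ↔ (k : ℕ) + 1 = N := by
      rw [Fin.ext_iff]; simp only; omega
    simp only [this]
  set R : Lp ℂ 2 (volume : Measure ℝ) →L[ℂ] Lp ℂ 2 (volume : Measure ℝ) :=
    Complex.I ^ N • ∑ j, c j • S j with hR
  have key : ∀ f : Lp ℂ 2 (volume : Measure ℝ), ∃ u, IsSobolev N u ∧ R f =ᵐ[volume] u ∧
      ∀ᵐ x : ℝ, diffExpr (0 : Fin N → ℝ → ℂ) u x = z * u x + f x := by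
    intro f
    choose g hg hgp using fun j => hS j f
    have hgL : ∀ j, MemLp (g j) 2 volume := fun j => (memLp_congr_ae (hg j)).1 (Lp.memLp _)
    set Y : ℝ → Fin N → ℂ := fun x k => Complex.I ^ N * ∑ j, ζ j ^ (k : ℕ) * c j * g j x with hYd
    have hYL : ∀ k, MemLp (fun x => Y x k) 2 volume := fun k =>
      (memLp_finsetSum _ fun j _ => (hgL j).const_mul _).const_mul _
    have hY : ∀ k : Fin N, IsPrimitive (fun x => Y x k) fun x =>
        ∑ j, companion (0 : Fin N → ℝ → ℂ) z x k j * Y x j +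
          if (k : ℕ) + 1 = N then Complex.I ^ N * f x else 0 := by
      intro k
      convert! (IsPrimitive.sum Finset.univ fun j _ =>
        (hgp j).const_mul (ζ j ^ (k : ℕ) * c j)).const_mul (Complex.I ^ N) using 2 with x
      have e1 : ∑ j, ζ j ^ (k : ℕ) * c j * (ζ j * g j x + f x) =
          (∑ j, ζ j ^ ((k : ℕ) + 1) * c j * g j x) + (∑ j, ζ j ^ (k : ℕ) * c j) * f x := by
        rw [Finset.sum_mul, ← Finset.sum_add_distrib]
        exact Finset.sum_congr rfl fun j _ => by ring
      rw [e1, hsum k]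
      by_cases hk : (k : ℕ) + 1 = N
      · rw [sum_companion_last hk hN, if_pos hk, if_pos hk, hk, one_mul, mul_add]
        simp only [Pi.zero_apply, zero_mul, Finset.sum_const_zero, sub_zero, hYd, pow_zero, one_mul,
          hroot]
        congr 2
        rw [← mul_assoc, Finset.mul_sum]
        exact Finset.sum_congr rfl fun j _ => by ring
      · rw [sum_companion_of_lt (by omega), if_neg hk, if_neg hk, zero_mul, add_zero,
          add_zero]
    obtain ⟨h1, h2, h3⟩ := iteratedDeriv_of_isPrimitive hN hY
    refine ⟨fun x => Y x ⟨0, hN⟩, ⟨h2, fun k hk => ?_⟩, ?_, h3⟩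
    · rcases hk.lt_or_eq with hk | rfl
      · exact (memLp_congr_ae (ae_of_all _ fun x => h1 ⟨k, hk⟩ x)).2 (hYL ⟨k, hk⟩)
      · refine (memLp_congr_ae ?_).2
          ((((hYL ⟨0, hN⟩).const_mul z).add (Lp.memLp f)).const_mul (Complex.I ^ k))
        filter_upwards [h3] with x hx
        simp only [diffExpr, Pi.zero_apply, zero_mul, Finset.sum_const_zero, add_zero] at hx
        rw [inv_mul_eq_iff_eq_mul₀ (I_pow_ne_zero k)] at hx
        exact hx
    · have h4 : R f = Complex.I ^ N • ∑ j, c j • S j f := by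
        rw [hR]
        simp
      rw [h4]
      have h5 : ∀ᵐ x : ℝ, ∀ j, (c j • S j f : Lp ℂ 2 (volume : Measure ℝ)) x = c j * g j x :=
        ae_all_iff.2 fun j => by
          filter_upwards [Lp.coeFn_smul (c j) (S j f), hg j] with x hx1 hx2
          rw [hx1, Pi.smul_apply, hx2, smul_eq_mul]
      filter_upwards [Lp.coeFn_smul (Complex.I ^ N) (∑ j, c j • S j f),
        Lp.coeFn_finsetSum Finset.univ (fun j => c j • S j f), h5] with x hx1 hx2 hx3
      rw [hx1, Pi.smul_apply, hx2, smul_eq_mul]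
      simp [hYd, hx3]
  refine ⟨R, fun f φ => ⟨?_, ?_⟩⟩
  · rintro rfl
    obtain ⟨u, h1, h2, h3⟩ := key f
    exact mem_operatorGraph_of_solution h1 h2 h3
  · rintro ⟨g, ⟨u, hu, h1, h2⟩, rfl⟩
    obtain ⟨u', hu', h1', h2'⟩ := key (g - z • φ)
    have h3 : ∀ᵐ x : ℝ, diffExpr (0 : Fin N → ℝ → ℂ) u x =
        z * u x + (g - z • φ : Lp ℂ 2 (volume : Measure ℝ)) x := by
      filter_upwards [h1, h2, Lp.coeFn_sub g (z • φ), Lp.coeFn_smul z φ] with x hx1 hx2 hx3 hx4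
      rw [hx3, Pi.sub_apply, hx4, Pi.smul_apply, smul_eq_mul]
      rw [← hx1, ← hx2]
      ring
    -- Injectivity of H₀ - z: applied to the difference of two solutions, the product of the other
    -- factors gives a square integrable solution of y' = ζ_j y, which is zero.
    have h4 : ∀ x j, ∑ k : Fin N, ζ j ^ (N - 1 - (k : ℕ)) * iteratedDeriv k u x =
        ∑ k : Fin N, ζ j ^ (N - 1 - (k : ℕ)) * iteratedDeriv k u' x := fun x j => by
      have h5 := (isPrimitive_sum_pow_mul_iteratedDeriv hN (hroot j) hu.1 h3).sub
        (isPrimitive_sum_pow_mul_iteratedDeriv hN (hroot j) hu'.1 h2')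
      have h6 := eq_zero_of_isPrimitive_mul (hre j)
        (h5.congr_ae (g := fun x => ζ j *
          ((∑ k : Fin N, ζ j ^ (N - 1 - (k : ℕ)) * iteratedDeriv k u x) -
          ∑ k : Fin N, ζ j ^ (N - 1 - (k : ℕ)) * iteratedDeriv k u' x))
          (ae_of_all _ fun x => by simp only; ring))
        ((memLp_sum_pow_mul_iteratedDeriv hu (ζ j)).sub
          (memLp_sum_pow_mul_iteratedDeriv hu' (ζ j))) x
      exact sub_eq_zero.1 h6
    have h7 : ∀ x, u x = u' x := fun x => by
      -- Reversing the index turns the exponents N - 1 - k into k, the Vandermonde form; the last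
      -- entry of the reversed vector is the derivative of order zero.
      have h8 := Matrix.eq_zero_of_forall_index_sum_pow_mul_eq_zero hinj
        (v := fun k : Fin N => iteratedDeriv (Fin.rev k : ℕ) u x -
          iteratedDeriv (Fin.rev k : ℕ) u' x) fun j => by
        have h9 := sub_eq_zero.2 (h4 x j)
        rw [← Finset.sum_sub_distrib] at h9
        rw [← h9, ← Equiv.sum_comp Fin.revPerm]
        refine Finset.sum_congr rfl fun k _ => ?_
        simp only [Fin.revPerm_apply, Fin.rev_rev, Fin.val_rev]
        rw [← mul_sub]
        congr 2
        omega
      have h10 := congrFun h8 ⟨N - 1, hl⟩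
      simp only [Fin.val_rev, Pi.zero_apply, Nat.sub_add_cancel hN, Nat.sub_self,
        iteratedDeriv_zero] at h10
      exact sub_eq_zero.1 h10
    refine Lp.ext ?_
    filter_upwards [h1, h1'] with x hx1 hx2
    rw [hx2, ← h7]
    exact hx1.symm


/-! ### Connection matrices and the nonvanishing of the Wronskian -/

theorem memLp_indicator_of_continuous {F : ℝ → ℂ} (hF : Continuous F) (a b : ℝ) :
    MemLp ((Set.Icc a b).indicator F) 2 volume := by
  rw [memLp_indicator_iff_restrict measurableSet_Icc]
  obtain ⟨C, hC⟩ := (isCompact_Icc (a := a) (b := b)).exists_bound_of_continuousOn hF.continuousOn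
  refine MemLp.of_bound hF.aestronglyMeasurable C ?_
  rw [ae_restrict_iff' measurableSet_Icc]
  exact ae_of_all _ hC

theorem memLp_indicator_sum_exp {ι : Type*} [Fintype ι] {s : Set ℝ} (hs : MeasurableSet s)
    {d ζ : ι → ℂ} (h : ∀ j, d j ≠ 0 → IntegrableOn (fun x : ℝ => Complex.exp (2 * ζ j * x)) s) :
    MemLp (s.indicator fun x : ℝ => ∑ j, d j * Complex.exp (ζ j * x)) 2 volume := by
  have h1 : (s.indicator fun x : ℝ => ∑ j, d j * Complex.exp (ζ j * x)) =
      fun x : ℝ => ∑ j, d j * s.indicator (fun x : ℝ => Complex.exp (ζ j * x)) x := by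
    funext x
    by_cases hx : x ∈ s <;> simp [hx]
  rw [h1]
  refine memLp_finsetSum _ fun j _ => ?_
  by_cases hj : d j = 0
  · simp [hj]
  · exact (memLp_two_exp_indicator hs (ζ j) (h j hj)).const_mul _

/-- Far to the left F is a sum of decaying exponentials, and the remaining piece up to x is compact.
The sign condition concerns nonzero coefficients only, so all the ζ_j may be listed. -/
theorem memLp_indicator_Iic {ι : Type*} [Fintype ι] {F : ℝ → ℂ} (hF : Continuous F) {a : ℝ}
    {d ζ : ι → ℂ} (h : ∀ x < a, F x = ∑ j, d j * Complex.exp (ζ j * x))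
    (hd : ∀ j, d j ≠ 0 → 0 < (ζ j).re) (x : ℝ) : MemLp ((Set.Iic x).indicator F) 2 volume := by
  have h1 := (memLp_indicator_sum_exp measurableSet_Iio (d := d) (ζ := ζ) (s := Set.Iio a)
    fun j hj => integrableOn_Iic_iff_integrableOn_Iio (by simp) |>.1
      (integrableOn_exp_mul_complex_Iic (by simp; linarith [hd j hj]) a)).indicator
        (measurableSet_Iic (a := x))
  refine (memLp_congr_ae (ae_of_all _ fun y => ?_)).1 (h1.add (memLp_indicator_of_continuous hF a x))
  simp only [Pi.add_apply, Set.indicator, Set.mem_Iic, Set.mem_Iio, Set.mem_Icc]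
  by_cases hy : y ≤ x
  · by_cases hya : y < a
    · simp [hy, hya, h y hya]
    · simp [hy, hya, not_lt.1 hya]
  · simp [hy]

theorem memLp_indicator_Ioi {ι : Type*} [Fintype ι] {F : ℝ → ℂ} (hF : Continuous F) {b : ℝ}
    {d ζ : ι → ℂ} (h : ∀ x, b < x → F x = ∑ j, d j * Complex.exp (ζ j * x))
    (hd : ∀ j, d j ≠ 0 → (ζ j).re < 0) (x : ℝ) : MemLp ((Set.Ioi x).indicator F) 2 volume := by
  have h1 := (memLp_indicator_sum_exp measurableSet_Ioi (d := d) (ζ := ζ) (s := Set.Ioi b)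
    fun j hj => integrableOn_exp_mul_complex_Ioi (by simp; linarith [hd j hj]) b).indicator
        (measurableSet_Ioi (a := x))
  refine (memLp_congr_ae (ae_of_all _ fun y => ?_)).1
    (h1.add ((memLp_indicator_of_continuous hF x b).indicator (measurableSet_Ioi (a := x))))
  simp only [Pi.add_apply, Set.indicator, Set.mem_Ioi, Set.mem_Icc]
  by_cases hy : x < y
  · by_cases hya : b < y
    · simp [hy, hya, h y hya, hy.le, hya.not_ge]
    · simp [hy, hya, not_lt.1 hya, hy.le]
  · simp [hy]

theorem memLp_of_exponential_tails {ι : Type*} [Fintype ι] {F : ℝ → ℂ} (hF : Continuous F)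
    {a b : ℝ} {d d' ζ : ι → ℂ} (hl : ∀ x < a, F x = ∑ j, d j * Complex.exp (ζ j * x))
    (hd : ∀ j, d j ≠ 0 → 0 < (ζ j).re) (hr : ∀ x, b < x → F x = ∑ j, d' j * Complex.exp (ζ j * x))
    (hd' : ∀ j, d' j ≠ 0 → (ζ j).re < 0) : MemLp F 2 volume := by
  refine (memLp_congr_ae (ae_of_all _ fun y => ?_)).1
    ((memLp_indicator_Iic hF hl hd 0).add (memLp_indicator_Ioi hF hr hd' 0))
  by_cases hy : y ≤ 0 <;> simp [Set.indicator, hy]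

variable {N : ℕ} {v : Fin N → ℝ → ℂ} {z : ℂ} {ζ : Fin N → ℂ} {u : Fin N → ℝ → ℂ} {a b : ℝ}

theorem SupportedIn.companion_left (hab : SupportedIn v a b) {x : ℝ} (hx : x < a) (z : ℂ) :
    companion v z x = companion (0 : Fin N → ℝ → ℂ) z x :=
  companion_eq_zero_of_left (hab.left x hx) z

theorem SupportedIn.companion_right (hab : SupportedIn v a b) {x : ℝ} (hx : b < x) (z : ℂ) :
    companion v z x = companion (0 : Fin N → ℝ → ℂ) z x :=
  companion_eq_zero_of_right (hab.right x hx) z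

/-- Solutions of the system that are square integrable with square integrable right-hand side
belong to the Sobolev class. -/
theorem isSobolev_of_isPrimitive {Y : ℝ → Fin N → ℂ} {f : ℝ → ℂ} (hN : 0 < N)
    (hv : ∀ j, MemLp (v j) 2 volume) (hab : SupportedIn v a b) (hf : MemLp f 2 volume)
    (hY : ∀ k : Fin N, IsPrimitive (fun x => Y x k) fun x =>
      ∑ j, companion v z x k j * Y x j + if (k : ℕ) + 1 = N then Complex.I ^ N * f x else 0)
    (hYL : ∀ k, MemLp (fun x => Y x k) 2 volume) : IsSobolev N fun x => Y x ⟨0, hN⟩ := by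
  obtain ⟨h1, h2, h3⟩ := iteratedDeriv_of_isPrimitive hN hY
  refine ⟨h2, fun k hk => ?_⟩
  rcases hk.lt_or_eq with hk | rfl
  · exact (memLp_congr_ae (ae_of_all _ fun x => h1 ⟨k, hk⟩ x)).2 (hYL ⟨k, hk⟩)
  · have hvY : ∀ j, MemLp (fun x => v j x * Y x j) 2 volume := fun j => by
      obtain ⟨C, hC⟩ := (isCompact_Icc (a := a) (b := b)).exists_bound_of_continuousOn
        (hY j).continuous.continuousOn
      refine ((hv j).const_mul (C : ℂ)).mono
        ((hv j).1.mul (hY j).continuous.aestronglyMeasurable) (ae_of_all _ fun x => ?_)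
      by_cases hx : x ∈ Set.Icc a b
      · rw [norm_mul, norm_mul, mul_comm]
        gcongr
        exact (hC x hx).trans (by rw [Complex.norm_real]; exact Real.le_norm_self C)
      · have : v j x = 0 := image_eq_zero_of_notMem_tsupport fun h => by
          rw [Set.mem_Icc, not_and_or, not_le, not_le] at hx
          rcases hx with hx | hx
          · exact lt_irrefl x (hab.left x hx j x h)
          · exact lt_irrefl x (hab.right x hx j x h)
        simp [this]
    refine (memLp_congr_ae ?_).2 (((((hYL ⟨0, hN⟩).const_mul z).add hf).sub
      (memLp_finsetSum Finset.univ fun j _ => hvY j)).const_mul (Complex.I ^ k))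
    filter_upwards [h3] with x hx
    have h4 := diffExpr_zero_eq hx
    simp only [diffExpr, Pi.zero_apply, zero_mul, Finset.sum_const_zero, add_zero] at h4
    rw [inv_mul_eq_iff_eq_mul₀ (I_pow_ne_zero k)] at h4
    rw [h4]
    simp only [h1, Pi.sub_apply, Pi.add_apply, add_sub_assoc]

theorem expSystem_isMatrixPrimitive (hN : 0 < N) (hroot : ∀ j, ζ j ^ N = Complex.I ^ N * z) :
    IsMatrixPrimitive (jetMatrix N (expSystem ζ))
      fun x => companion (0 : Fin N → ℝ → ℂ) z x * jetMatrix N (expSystem ζ) x :=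
  isMatrixPrimitive_jetMatrix hN fun j => isSolution_exp_mul (hroot j)

/-- Where the coefficients vanish, every solution is a constant combination of the exponentials,
with the constants read off at c. This yields the connection matrices on both sides of the supports.
-/
theorem eq_expSystem_mul {m : Type*} [Fintype m] (hN : 0 < N) (hinj : Function.Injective ζ)
    (hroot : ∀ j, ζ j ^ N = Complex.I ^ N * z) {Ψ : ℝ → Matrix (Fin N) m ℂ}
    (hΨ : IsMatrixPrimitive Ψ fun x => companion v z x * Ψ x) {c x : ℝ}
    (h : ∀ t ∈ Set.uIcc c x, companion v z t = companion (0 : Fin N → ℝ → ℂ) z t) :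
    Ψ x = jetMatrix N (expSystem ζ) x * ((jetMatrix N (expSystem ζ) c)⁻¹ * Ψ c) := by
  refine solution_eq_on (locallyIntegrableEntries_companion locallyIntegrable_zero_coefficients z)
    hΨ (Y₀ := fun x => jetMatrix N (expSystem ζ) x * ((jetMatrix N (expSystem ζ) c)⁻¹ * Ψ c))
    ?_ h ?_
  · have := (expSystem_isMatrixPrimitive hN hroot).mul_const
      ((jetMatrix N (expSystem ζ) c)⁻¹ * Ψ c)
    simpa only [Matrix.mul_assoc] using this
  · rw [← Matrix.mul_assoc, Matrix.mul_nonsing_inv _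
      (isUnit_iff_ne_zero.2 (det_jetMatrix_expSystem_ne_zero hinj c)), Matrix.one_mul]

namespace IsDistinguishedSystem

/-- The connection matrix to the right of the supports. -/
theorem exists_connection_right (h : IsDistinguishedSystem v z ζ u) (hN : 0 < N)
    (hab : SupportedIn v a b) : ∃ M : Matrix (Fin N) (Fin N) ℂ,
      (∀ x, b < x → jetMatrix N u x = jetMatrix N (expSystem ζ) x * M) ∧
      ∀ j, (ζ j).re < 0 → ∀ k, M k j = if k = j then 1 else 0 := by
  refine ⟨(jetMatrix N (expSystem ζ) (b + 1))⁻¹ * jetMatrix N u (b + 1), fun x hx => ?_,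
    fun j hj k => ?_⟩
  · refine eq_expSystem_mul hN h.injective h.root (h.isMatrixPrimitive hN) fun t ht =>
      hab.companion_right ?_ z
    rw [Set.mem_uIcc] at ht
    rcases ht with ht | ht <;> linarith
  · rw [← Matrix.one_apply, ← Matrix.nonsing_inv_mul (jetMatrix N (expSystem ζ) (b + 1))
      (isUnit_iff_ne_zero.2 (det_jetMatrix_expSystem_ne_zero h.injective _)), Matrix.mul_apply,
      Matrix.mul_apply]
    exact Finset.sum_congr rfl fun i _ => by
      rw [h.jetMatrix_right hab hj (by linarith) i]

/-- The connection matrix to the left of the supports. -/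
theorem exists_connection_left (h : IsDistinguishedSystem v z ζ u) (hN : 0 < N)
    (hab : SupportedIn v a b) : ∃ M : Matrix (Fin N) (Fin N) ℂ,
      (∀ x < a, jetMatrix N u x = jetMatrix N (expSystem ζ) x * M) ∧
      ∀ j, 0 < (ζ j).re → ∀ k, M k j = if k = j then 1 else 0 := by
  refine ⟨(jetMatrix N (expSystem ζ) (a - 1))⁻¹ * jetMatrix N u (a - 1), fun x hx => ?_,
    fun j hj k => ?_⟩
  · refine eq_expSystem_mul hN h.injective h.root (h.isMatrixPrimitive hN) fun t ht =>
      hab.companion_left ?_ z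
    rw [Set.mem_uIcc] at ht
    rcases ht with ht | ht <;> linarith
  · rw [← Matrix.one_apply, ← Matrix.nonsing_inv_mul (jetMatrix N (expSystem ζ) (a - 1))
      (isUnit_iff_ne_zero.2 (det_jetMatrix_expSystem_ne_zero h.injective _)), Matrix.mul_apply,
      Matrix.mul_apply]
    exact Finset.sum_congr rfl fun i _ => by
      rw [h.jetMatrix_left hab hj (by linarith) i]

/-- The Wronskian does not vanish off the spectrum. -/
theorem det_jetMatrix_ne_zero (h : IsDistinguishedSystem v z ζ u) (hN : 0 < N)
    (hv : ∀ j, MemLp (v j) 2 volume) (hab : SupportedIn v a b)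
    {R : Lp ℂ 2 (volume : Measure ℝ) →L[ℂ] Lp ℂ 2 (volume : Measure ℝ)} (hR : IsResolvent v z R)
    (x : ℝ) : (jetMatrix N u x).det ≠ 0 := by
  intro hdet
  have hA := locallyIntegrableEntries_companion (fun j => locallyIntegrable_of_memLp (hv j)) z
  obtain ⟨c, hc, hcx⟩ := Matrix.exists_mulVec_eq_zero_iff.2 hdet
  have hΨ := h.isMatrixPrimitive hN
  have hzero : ∀ y k, ∑ j, jetMatrix N u y k j * c j = 0 := fun y k => by
    have h1 : IsMatrixPrimitive (fun y => jetMatrix N u y * Matrix.of fun j (_ : Unit) => c j)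
        fun y => companion v z y * (jetMatrix N u y * Matrix.of fun j (_ : Unit) => c j) := by
      simpa only [Matrix.mul_assoc] using hΨ.mul_const (Matrix.of fun j (_ : Unit) => c j)
    have h2 := solution_eq_on hA h1 (Y₀ := fun _ => 0)
      (by simpa using IsMatrixPrimitive.const (0 : Matrix (Fin N) Unit ℂ))
      (a := x) (x := y) (fun _ _ => rfl) (by
        ext i _
        exact congrFun hcx i)
    exact congrFun (congrFun h2 k) ()
  -- In a relation Σ c_j u_j = 0 the half with Re ζ_j < 0 is the negative of the half with Re ζ_j >
  -- 0. The first form decays at +∞ and the second at -∞, so Y is the jet of a square integrable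
  -- solution of (H - z)u = 0.
  set Y : ℝ → Fin N → ℂ := fun y k =>
    ∑ j, jetMatrix N u y k j * (if (ζ j).re < 0 then c j else 0) with hYd
  have hYneg : ∀ y k, Y y k = ∑ j, jetMatrix N u y k j * (if 0 < (ζ j).re then -c j else 0) := by
    intro y k
    have e : Y y k = Y y k - ∑ j, jetMatrix N u y k j * c j := by rw [hzero, sub_zero]
    rw [e, hYd, ← Finset.sum_sub_distrib]
    refine Finset.sum_congr rfl fun j _ => ?_
    rcases lt_or_gt_of_ne (h.re_ne_zero j) with hj | hj
    · simp [hj, hj.not_gt]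
    · simp [hj, hj.not_gt]
  have hYr : ∀ y, b < y → ∀ k, Y y k =
      ∑ j, (ζ j ^ (k : ℕ) * if (ζ j).re < 0 then c j else 0) * Complex.exp (ζ j * y) := by
    intro y hy k
    refine Finset.sum_congr rfl fun j _ => ?_
    by_cases hj : (ζ j).re < 0
    · rw [h.jetMatrix_right hab hj hy, jetMatrix_expSystem]; ring
    · simp [hj]
  have hYl : ∀ y < a, ∀ k, Y y k =
      ∑ j, (ζ j ^ (k : ℕ) * if 0 < (ζ j).re then -c j else 0) * Complex.exp (ζ j * y) := by
    intro y hy k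
    rw [hYneg]
    refine Finset.sum_congr rfl fun j _ => ?_
    by_cases hj : 0 < (ζ j).re
    · rw [h.jetMatrix_left hab hj hy, jetMatrix_expSystem]; ring
    · simp [hj]
  have hY : ∀ k : Fin N, IsPrimitive (fun x => Y x k) fun x =>
      ∑ j, companion v z x k j * Y x j +
        if (k : ℕ) + 1 = N then Complex.I ^ N * (0 : ℝ → ℂ) x else 0 := fun k => by
    have h1 := hΨ.mul_const (Matrix.of fun j (_ : Unit) => if (ζ j).re < 0 then c j else 0) k ()
    simp only [Matrix.mul_assoc] at h1
    simpa [Matrix.mul_apply, hYd] using h1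
  have hYL : ∀ k, MemLp (fun x => Y x k) 2 volume := fun k => by
    refine memLp_of_exponential_tails (hY k).continuous (fun y hy => hYl y hy k) (fun j hj => ?_)
      (fun y hy => hYr y hy k) (fun j hj => ?_)
    · by_contra hj'
      simp [hj'] at hj
    · by_contra hj'
      simp [hj'] at hj
  have hS := isSobolev_of_isPrimitive hN hv hab (f := 0) MemLp.zero hY hYL
  obtain ⟨h1, h2, h3⟩ := iteratedDeriv_of_isPrimitive hN hY
  -- The candidate eigenfunction is the image of the source 0 under the resolvent, hence zero.
  have hRu : R 0 = (hYL ⟨0, hN⟩).toLp := by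
    refine (hR _ _).2 (mem_operatorGraph_of_solution hS (MemLp.coeFn_toLp _) ?_)
    filter_upwards [h3, Lp.coeFn_zero ℂ 2 (volume : Measure ℝ)] with y hy hy0
    rw [hy, hy0, Pi.zero_apply]
  rw [map_zero] at hRu
  have hae : (fun y => Y y ⟨0, hN⟩) =ᵐ[volume] fun _ => 0 := by
    have h4 := (hYL ⟨0, hN⟩).coeFn_toLp
    rw [← hRu] at h4
    filter_upwards [h4, Lp.coeFn_zero ℂ 2 (volume : Measure ℝ)] with y hy hy0
    rw [← hy, hy0]
    rfl
  have h0 : (fun y => Y y ⟨0, hN⟩) = fun _ => 0 :=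
    (hY _).continuous.ae_eq_iff_eq volume continuous_const |>.1 hae
  have hall : ∀ y k, Y y k = 0 := fun y k => by
    rw [← h1 k y, h0]
    simp
  have hlin : ∀ (y : ℝ) (d : Fin N → ℂ),
      (∀ k : Fin N, ∑ j, (ζ j ^ (k : ℕ) * d j) * Complex.exp (ζ j * y) = 0) → d = 0 := by
    intro y d hd
    have h5 : (jetMatrix N (expSystem ζ) y).mulVec d = 0 := by
      funext k
      rw [Pi.zero_apply, ← hd k, Matrix.mulVec, dotProduct]
      refine Finset.sum_congr rfl fun j _ => ?_
      rw [jetMatrix_expSystem]; ring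
    exact Matrix.eq_zero_of_mulVec_eq_zero (det_jetMatrix_expSystem_ne_zero h.injective y) h5
  -- Independence of the exponentials to the right of the supports kills the c_j with Re ζ_j < 0, to
  -- the left those with Re ζ_j > 0.
  have h6 := hlin (b + 1) _ fun k => by rw [← hYr (b + 1) (by linarith) k, hall]
  have h7 := hlin (a - 1) _ fun k => by rw [← hYl (a - 1) (by linarith) k, hall]
  refine hc (funext fun j => ?_)
  rcases lt_or_gt_of_ne (h.re_ne_zero j) with hj | hj
  · simpa [hj] using congrFun h6 j
  · simpa [hj] using congrFun h7 j

end IsDistinguishedSystem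

/-- Rows of the inverse of a matrix with some columns from the identity. -/
theorem inv_apply_eq_zero_of_columns {n : Type*} [Fintype n] [DecidableEq n] {M : Matrix n n ℂ}
    (hM : M.det ≠ 0) {k : n} (hk : ∀ i, M i k = if i = k then 1 else 0) (j : n) :
    M⁻¹ j k = if j = k then 1 else 0 := by
  have h := congrFun (congrFun (Matrix.nonsing_inv_mul M (isUnit_iff_ne_zero.2 hM)) j) k
  rw [Matrix.mul_apply, Matrix.one_apply] at h
  simpa [hk] using h

theorem inv_mul_expSystem_apply (hinj : Function.Injective ζ) (M : Matrix (Fin N) (Fin N) ℂ)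
    (x : ℝ) (j l : Fin N) :
    (jetMatrix N (expSystem ζ) x * M)⁻¹ j l =
      ∑ k, (M⁻¹ j k * ((Matrix.vandermonde ζ).transpose)⁻¹ k l) * Complex.exp (-ζ k * x) := by
  rw [Matrix.mul_inv_rev, Matrix.mul_apply]
  refine Finset.sum_congr rfl fun k _ => ?_
  rw [inv_jetMatrix_expSystem hinj, neg_mul]
  ring

namespace IsDistinguishedSystem

/-- The rows of the inverse that belong to solutions decaying to the right decay to the left. -/
theorem memLp_indicator_Iic_inv (h : IsDistinguishedSystem v z ζ u) (hN : 0 < N)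
    (hv : ∀ j, LocallyIntegrable (v j)) (hab : SupportedIn v a b)
    (hdet : ∀ x, (jetMatrix N u x).det ≠ 0) {j : Fin N}
    (hj : (ζ j).re < 0) (l : Fin N) (x : ℝ) :
    MemLp ((Set.Iic x).indicator fun y => (jetMatrix N u y)⁻¹ j l) 2 volume := by
  obtain ⟨M, hM, hMc⟩ := h.exists_connection_left hN hab
  have hMdet : M.det ≠ 0 := fun h0 => hdet (a - 1) (by
    rw [hM _ (by linarith), Matrix.det_mul, h0, mul_zero])
  refine memLp_indicator_Iic
    ((inverse_solution (locallyIntegrableEntries_companion hv z) (h.isMatrixPrimitive hN)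
      (hdet 0)).2 j l).continuous (a := a)
    (d := fun k => M⁻¹ j k * ((Matrix.vandermonde ζ).transpose)⁻¹ k l) (ζ := fun k => -ζ k)
    (fun y hy => ?_) (fun k hk => ?_) x
  · simp only [hM y hy]
    exact inv_mul_expSystem_apply h.injective M y j l
  · by_contra hk'
    have hpos : 0 < (ζ k).re := by
      rcases lt_or_gt_of_ne (h.re_ne_zero k) with h0 | h0
      · exact absurd (by simpa using h0) hk'
      · exact h0
    -- Column k of M is a unit vector, hence so is column k of M⁻¹. The signs of the real parts give
    -- j ≠ k, so the coefficient vanishes, and only exponentials exp(-ζ_k x) decaying at -∞ remain.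
    refine hk ?_
    rw [inv_apply_eq_zero_of_columns hMdet (hMc k hpos), if_neg, zero_mul]
    rintro rfl
    exact lt_asymm hj hpos

/-- The rows of the inverse that belong to solutions decaying to the left decay to the right. -/
theorem memLp_indicator_Ioi_inv (h : IsDistinguishedSystem v z ζ u) (hN : 0 < N)
    (hv : ∀ j, LocallyIntegrable (v j)) (hab : SupportedIn v a b)
    (hdet : ∀ x, (jetMatrix N u x).det ≠ 0) {j : Fin N}
    (hj : 0 < (ζ j).re) (l : Fin N) (x : ℝ) :
    MemLp ((Set.Ioi x).indicator fun y => (jetMatrix N u y)⁻¹ j l) 2 volume := by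
  obtain ⟨M, hM, hMc⟩ := h.exists_connection_right hN hab
  have hMdet : M.det ≠ 0 := fun h0 => hdet (b + 1) (by
    rw [hM _ (by linarith), Matrix.det_mul, h0, mul_zero])
  refine memLp_indicator_Ioi
    ((inverse_solution (locallyIntegrableEntries_companion hv z) (h.isMatrixPrimitive hN)
      (hdet 0)).2 j l).continuous (b := b)
    (d := fun k => M⁻¹ j k * ((Matrix.vandermonde ζ).transpose)⁻¹ k l) (ζ := fun k => -ζ k)
    (fun y hy => ?_) (fun k hk => ?_) x
  · simp only [hM y hy]
    exact inv_mul_expSystem_apply h.injective M y j l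
  · by_contra hk'
    have hneg : (ζ k).re < 0 := by
      rcases lt_or_gt_of_ne (h.re_ne_zero k) with h0 | h0
      · exact h0
      · exact absurd (by simpa using h0) hk'
    refine hk ?_
    rw [inv_apply_eq_zero_of_columns hMdet (hMc k hneg), if_neg, zero_mul]
    rintro rfl
    exact lt_asymm hj hneg

end IsDistinguishedSystem


/-! ### The resolvent kernel -/

variable {N : ℕ} {v : Fin N → ℝ → ℂ} {z : ℂ} {ζ : Fin N → ℂ} {u : Fin N → ℝ → ℂ} {a b : ℝ}

/-- The index of the last derivative. -/
def lastIndex (hN : 0 < N) : Fin N := ⟨N - 1, Nat.sub_lt hN Nat.one_pos⟩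

/-- The Green function for `y ≤ x`. -/
noncomputable def greenLower (hN : 0 < N) (ζ : Fin N → ℂ) (u : Fin N → ℝ → ℂ) (x y : ℝ) : ℂ :=
  Complex.I ^ N * ∑ j, if (ζ j).re < 0 then
    jetMatrix N u x ⟨0, hN⟩ j * (jetMatrix N u y)⁻¹ j (lastIndex hN) else 0

/-- The negative of the Green function for `x < y`. -/
noncomputable def greenUpper (hN : 0 < N) (ζ : Fin N → ℂ) (u : Fin N → ℝ → ℂ) (x y : ℝ) : ℂ :=
  Complex.I ^ N * ∑ j, if (ζ j).re < 0 then 0 else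
    jetMatrix N u x ⟨0, hN⟩ j * (jetMatrix N u y)⁻¹ j (lastIndex hN)

/-- The Green function. -/
noncomputable def greenKernel (hN : 0 < N) (ζ : Fin N → ℂ) (u : Fin N → ℝ → ℂ) (x y : ℝ) : ℂ :=
  if y ≤ x then greenLower hN ζ u x y else -greenUpper hN ζ u x y

/-- Up to i^N the sum is the entry of Y Y⁻¹ = 1 in the first row and last column. It is the jump of
the Green function across the diagonal: zero for N ≥ 2, and independent of the potential for N = 1.
-/
theorem greenLower_add_greenUpper (hN : 0 < N) (hdet : ∀ x, (jetMatrix N u x).det ≠ 0) (x : ℝ) :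
    greenLower hN ζ u x x + greenUpper hN ζ u x x = Complex.I ^ N * if N = 1 then 1 else 0 := by
  have h := congrFun (congrFun (Matrix.mul_nonsing_inv (jetMatrix N u x)
    (isUnit_iff_ne_zero.2 (hdet x))) ⟨0, hN⟩) (lastIndex hN)
  rw [Matrix.mul_apply, Matrix.one_apply] at h
  have h1 : (⟨0, hN⟩ : Fin N) = lastIndex hN ↔ N = 1 := by
    rw [Fin.ext_iff, lastIndex]; simp only; omega
  simp only [h1] at h
  rw [← h, greenLower, greenUpper, ← mul_add, ← Finset.sum_add_distrib]
  congr 1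
  refine Finset.sum_congr rfl fun j _ => ?_
  split_ifs <;> simp

/-- Together with `tendsto_toLp_indicator` this extends the kernel representation from sources of
bounded support to all of L². -/
theorem tendsto_integral_mul_indicator {K f : ℝ → ℂ} (hKf : Integrable fun y => K y * f y) :
    Tendsto (fun n : ℕ => ∫ y, K y * (Set.Icc (-(n : ℝ)) n).indicator f y) atTop
      (𝓝 (∫ y, K y * f y)) := by
  have e : ∀ (n : ℕ) y, K y * (Set.Icc (-(n : ℝ)) n).indicator f y =
      (Set.Icc (-(n : ℝ)) n).indicator (fun y => K y * f y) y := fun n y => by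
    by_cases hy : y ∈ Set.Icc (-(n : ℝ)) n <;> simp [hy]
  simp only [e]
  refine tendsto_integral_of_dominated_convergence (fun y => ‖K y * f y‖) (fun n => ?_) hKf.norm
    (fun n => ae_of_all _ fun y => norm_indicator_le_norm_self _ _) (ae_of_all _ fun y => ?_)
  · exact hKf.1.indicator measurableSet_Icc
  · refine tendsto_const_nhds.congr' ?_
    obtain ⟨m, hm⟩ := exists_nat_ge |y|
    filter_upwards [eventually_ge_atTop m] with n hn
    have : |y| ≤ n := hm.trans (by exact_mod_cast hn)
    rw [Set.indicator_of_mem (Set.mem_Icc.2 (abs_le.1 this))]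

theorem tendsto_toLp_indicator (f : Lp ℂ 2 (volume : Measure ℝ)) :
    Tendsto (fun n : ℕ => ((Lp.memLp f).indicator
      (measurableSet_Icc (a := -(n : ℝ)) (b := (n : ℝ)))).toLp) atTop (𝓝 f) := by
  have h := (Lp.tendsto_Lp_iff_tendsto_eLpNorm' (f := fun n : ℕ => ((Lp.memLp f).indicator
      (measurableSet_Icc (a := -(n : ℝ)) (b := (n : ℝ)))).toLp) (f_lim := f) (fi := atTop)).2
  refine h ?_
  have h1 : ∀ n : ℕ, eLpNorm (⇑(((Lp.memLp f).indicator
      (measurableSet_Icc (a := -(n : ℝ)) (b := (n : ℝ)))).toLp) - ⇑f) 2 volume =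
      (∫⁻ x, ((Set.Icc (-(n : ℝ)) n)ᶜ.indicator (fun x => ‖f x‖ₑ ^ (2 : ℝ)) x)) ^ (1 / 2 : ℝ) := by
    intro n
    rw [eLpNorm_eq_lintegral_rpow_enorm_toReal (by norm_num) (by norm_num)]
    simp only [ENNReal.toReal_ofNat]
    congr 1
    refine lintegral_congr_ae ?_
    filter_upwards [((Lp.memLp f).indicator
      (measurableSet_Icc (a := -(n : ℝ)) (b := (n : ℝ)))).coeFn_toLp] with x hx
    rw [Pi.sub_apply, hx]
    by_cases hy : x ∈ Set.Icc (-(n : ℝ)) n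
    · rw [Set.indicator_of_mem hy, Set.indicator_of_notMem (by simpa using hy)]
      simp
    · rw [Set.indicator_of_notMem hy, Set.indicator_of_mem (by simpa using hy)]
      simp
  simp only [h1]
  have h2 : Tendsto (fun n : ℕ => ∫⁻ x, ((Set.Icc (-(n : ℝ)) n)ᶜ.indicator
      (fun x => ‖f x‖ₑ ^ (2 : ℝ)) x)) atTop (𝓝 (∫⁻ _ : ℝ, 0)) := by
    refine tendsto_lintegral_of_dominated_convergence' (fun x => ‖f x‖ₑ ^ (2 : ℝ)) (fun n => ?_)
      (fun n => ae_of_all _ fun x => ?_) ?_ (ae_of_all _ fun x => ?_)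
    · exact ((Lp.aestronglyMeasurable f).enorm.pow_const _).indicator measurableSet_Icc.compl
    · exact Set.indicator_le_self _ _ _
    · have := eLpNorm_lt_top_iff_lintegral_rpow_enorm_lt_top (p := 2) (by norm_num) (by norm_num)
        |>.1 (Lp.memLp f).2
      simpa using this.ne
    · refine tendsto_const_nhds.congr' ?_
      obtain ⟨m, hm⟩ := exists_nat_ge |x|
      filter_upwards [eventually_ge_atTop m] with n hn
      have : |x| ≤ n := hm.trans (by exact_mod_cast hn)
      rw [Set.indicator_of_notMem]
      simpa using abs_le.1 this
  simpa [Function.comp_def] using (ENNReal.continuous_rpow_const (y := (1 / 2 : ℝ))).tendsto _ |>.comp h2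

namespace IsDistinguishedSystem

theorem integrableOn_Iic_inv_mul (h : IsDistinguishedSystem v z ζ u) (hN : 0 < N)
    (hv : ∀ j, MemLp (v j) 2 volume) (hab : SupportedIn v a b)
    (hdet : ∀ x, (jetMatrix N u x).det ≠ 0) {j : Fin N} (hj : (ζ j).re < 0)
    (f : Lp ℂ 2 (volume : Measure ℝ)) (x : ℝ) :
    IntegrableOn (fun y => (jetMatrix N u y)⁻¹ j (lastIndex hN) * f y) (Set.Iic x) := by
  have := (h.memLp_indicator_Iic_inv hN (fun j => locallyIntegrable_of_memLp (hv j)) hab hdet hj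
    (lastIndex hN) x).integrable_mul (Lp.memLp f)
  rw [← integrable_indicator_iff measurableSet_Iic]
  refine this.congr (ae_of_all _ fun y => ?_)
  by_cases hy : y ≤ x <;> simp [Set.indicator, hy]

theorem integrableOn_Ioi_inv_mul (h : IsDistinguishedSystem v z ζ u) (hN : 0 < N)
    (hv : ∀ j, MemLp (v j) 2 volume) (hab : SupportedIn v a b)
    (hdet : ∀ x, (jetMatrix N u x).det ≠ 0) {j : Fin N} (hj : ¬ (ζ j).re < 0)
    (f : Lp ℂ 2 (volume : Measure ℝ)) (x : ℝ) :
    IntegrableOn (fun y => (jetMatrix N u y)⁻¹ j (lastIndex hN) * f y) (Set.Ioi x) := by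
  have := (h.memLp_indicator_Ioi_inv hN (fun j => locallyIntegrable_of_memLp (hv j)) hab hdet
    (lt_of_le_of_ne (not_lt.1 hj) (h.re_ne_zero j).symm) (lastIndex hN) x).integrable_mul
    (Lp.memLp f)
  rw [← integrable_indicator_iff measurableSet_Ioi]
  refine this.congr (ae_of_all _ fun y => ?_)
  by_cases hy : x < y <;> simp [Set.indicator, hy]

end IsDistinguishedSystem

/-! ### Variation of constants and the representation of the resolvent -/

/-- The coefficients of the Green solution in the distinguished system. -/
noncomputable def greenCoefficient (hN : 0 < N) (ζ : Fin N → ℂ) (u : Fin N → ℝ → ℂ) (f : ℝ → ℂ)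
    (j : Fin N) (x : ℝ) : ℂ :=
  Complex.I ^ N * if (ζ j).re < 0 then
      ∫ y in Set.Iic x, (jetMatrix N u y)⁻¹ j (lastIndex hN) * f y
    else -∫ y in Set.Ioi x, (jetMatrix N u y)⁻¹ j (lastIndex hN) * f y

namespace IsDistinguishedSystem

theorem isPrimitive_inv (h : IsDistinguishedSystem v z ζ u) (hN : 0 < N)
    (hv : ∀ j, MemLp (v j) 2 volume) (hdet : ∀ x, (jetMatrix N u x).det ≠ 0) :
    IsMatrixPrimitive (fun x => (jetMatrix N u x)⁻¹)
      fun x => -((jetMatrix N u x)⁻¹ * companion v z x) :=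
  (inverse_solution (locallyIntegrableEntries_companion
    (fun j => locallyIntegrable_of_memLp (hv j)) z) (h.isMatrixPrimitive hN) (hdet 0)).2

theorem isPrimitive_greenCoefficient (h : IsDistinguishedSystem v z ζ u) (hN : 0 < N)
    (hv : ∀ j, MemLp (v j) 2 volume) (hab : SupportedIn v a b)
    (hdet : ∀ x, (jetMatrix N u x).det ≠ 0) (f : Lp ℂ 2 (volume : Measure ℝ)) (j : Fin N) :
    IsPrimitive (greenCoefficient hN ζ u f j)
      fun y => Complex.I ^ N * ((jetMatrix N u y)⁻¹ j (lastIndex hN) * f y) := by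
  refine IsPrimitive.const_mul ⟨locallyIntegrable_continuous_mul
    (h.isPrimitive_inv hN hv hdet j (lastIndex hN)).continuous
    (locallyIntegrable_of_memLp (Lp.memLp f)), fun x y => ?_⟩ _
  by_cases hj : (ζ j).re < 0
  · simp only [if_pos hj]
    exact intervalIntegral.integral_Iic_sub_Iic (h.integrableOn_Iic_inv_mul hN hv hab hdet hj f x)
      (h.integrableOn_Iic_inv_mul hN hv hab hdet hj f y)
  · simp only [if_neg hj]
    rw [← intervalIntegral.integral_Ioi_sub_Ioi' (h.integrableOn_Ioi_inv_mul hN hv hab hdet hj f x)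
      (h.integrableOn_Ioi_inv_mul hN hv hab hdet hj f y)]
    ring

/-- Variation of constants: the Green solution solves the inhomogeneous system. -/
theorem isPrimitive_greenSolution (h : IsDistinguishedSystem v z ζ u) (hN : 0 < N)
    (hv : ∀ j, MemLp (v j) 2 volume) (hab : SupportedIn v a b)
    (hdet : ∀ x, (jetMatrix N u x).det ≠ 0) (f : Lp ℂ 2 (volume : Measure ℝ)) (k : Fin N) :
    IsPrimitive (fun x => ∑ j, jetMatrix N u x k j * greenCoefficient hN ζ u f j x) fun x =>
      ∑ i, companion v z x k i * (∑ j, jetMatrix N u x i j * greenCoefficient hN ζ u f j x) +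
        if (k : ℕ) + 1 = N then Complex.I ^ N * f x else 0 := by
  convert! IsPrimitive.sum Finset.univ fun j _ => (h.isMatrixPrimitive hN k j).mul
    (h.isPrimitive_greenCoefficient hN hv hab hdet f j) using 2 with x
  rw [Finset.sum_add_distrib]
  congr 1
  · simp only [Matrix.mul_apply, Finset.sum_mul, Finset.mul_sum]
    rw [Finset.sum_comm]
    exact Finset.sum_congr rfl fun i _ => Finset.sum_congr rfl fun j _ => by ring
  -- The last column of Y Y⁻¹ = 1 shows that the source appears in the last equation only.
  · have h1 := congrFun (congrFun (Matrix.mul_nonsing_inv (jetMatrix N u x)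
      (isUnit_iff_ne_zero.2 (hdet x))) k) (lastIndex hN)
    rw [Matrix.mul_apply, Matrix.one_apply] at h1
    have h2 : k = lastIndex hN ↔ (k : ℕ) + 1 = N := by
      rw [Fin.ext_iff, lastIndex]; simp only; omega
    simp only [h2] at h1
    calc _ = (∑ j, jetMatrix N u x k j * (jetMatrix N u x)⁻¹ j (lastIndex hN)) *
          (Complex.I ^ N * f x) := by
          rw [h1]; split_ifs <;> ring
      _ = _ := by
          rw [Finset.sum_mul]
          exact Finset.sum_congr rfl fun j _ => by ring

/-- The Green solution as an integral. -/
theorem integral_greenKernel (h : IsDistinguishedSystem v z ζ u) (hN : 0 < N)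
    (hv : ∀ j, MemLp (v j) 2 volume) (hab : SupportedIn v a b)
    (hdet : ∀ x, (jetMatrix N u x).det ≠ 0) (f : Lp ℂ 2 (volume : Measure ℝ)) (x : ℝ) :
    Integrable (fun y => greenKernel hN ζ u x y * f y) ∧
      ∫ y, greenKernel hN ζ u x y * f y =
        ∑ j, jetMatrix N u x ⟨0, hN⟩ j * greenCoefficient hN ζ u f j x := by
  have hl : ∀ j, Integrable ((Set.Iic x).indicator fun y => if (ζ j).re < 0 then
      jetMatrix N u x ⟨0, hN⟩ j * ((jetMatrix N u y)⁻¹ j (lastIndex hN) * f y) else 0) := fun j => by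
    rw [integrable_indicator_iff measurableSet_Iic]
    by_cases hj : (ζ j).re < 0
    · simp only [if_pos hj]
      exact Integrable.const_mul (h.integrableOn_Iic_inv_mul hN hv hab hdet hj f x) _
    · simp only [if_neg hj]
      exact integrable_zero _ _ _
  have hr : ∀ j, Integrable ((Set.Ioi x).indicator fun y => if (ζ j).re < 0 then 0 else
      jetMatrix N u x ⟨0, hN⟩ j * ((jetMatrix N u y)⁻¹ j (lastIndex hN) * f y)) := fun j => by
    rw [integrable_indicator_iff measurableSet_Ioi]
    by_cases hj : (ζ j).re < 0
    · simp only [if_pos hj]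
      exact integrable_zero _ _ _
    · simp only [if_neg hj]
      exact Integrable.const_mul (h.integrableOn_Ioi_inv_mul hN hv hab hdet hj f x) _
  have e : (fun y => greenKernel hN ζ u x y * f y) = fun y => ∑ j, Complex.I ^ N *
      (((Set.Iic x).indicator (fun y => if (ζ j).re < 0 then
        jetMatrix N u x ⟨0, hN⟩ j * ((jetMatrix N u y)⁻¹ j (lastIndex hN) * f y) else 0) y) -
      ((Set.Ioi x).indicator (fun y => if (ζ j).re < 0 then 0 else
        jetMatrix N u x ⟨0, hN⟩ j * ((jetMatrix N u y)⁻¹ j (lastIndex hN) * f y)) y)) := by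
    funext y
    by_cases hy : y ≤ x
    · simp only [greenKernel, greenLower, if_pos hy, Set.indicator, Set.mem_Iic, Set.mem_Ioi,
        if_neg hy.not_gt, sub_zero]
      rw [← Finset.mul_sum, mul_assoc, Finset.sum_mul]
      congr 1
      exact Finset.sum_congr rfl fun j _ => by split_ifs <;> ring
    · simp only [greenKernel, greenUpper, if_neg hy, Set.indicator, Set.mem_Iic, Set.mem_Ioi,
        if_pos (not_le.1 hy), zero_sub]
      rw [← Finset.mul_sum, neg_mul, mul_assoc, Finset.sum_mul, ← mul_neg, ← Finset.sum_neg_distrib]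
      congr 1
      exact Finset.sum_congr rfl fun j _ => by split_ifs <;> ring
  refine ⟨?_, ?_⟩
  · rw [e]
    exact integrable_finsetSum _ fun j _ => ((hl j).sub (hr j)).const_mul _
  · rw [e]
    refine (integral_finsetSum _ fun j _ => ((hl j).sub (hr j)).const_mul _).trans ?_
    simp only [Pi.sub_apply]
    refine Finset.sum_congr rfl fun j _ => ?_
    rw [integral_const_mul, integral_sub (hl j) (hr j), integral_indicator measurableSet_Iic,
      integral_indicator measurableSet_Ioi, greenCoefficient]
    by_cases hj : (ζ j).re < 0
    · simp only [if_pos hj, integral_const_mul, integral_zero]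
      ring
    · simp only [if_neg hj, integral_const_mul, integral_zero]
      ring

/-- The Green function represents the resolvent on functions of bounded support. -/
theorem resolvent_eq_of_bounded_support (h : IsDistinguishedSystem v z ζ u) (hN : 0 < N)
    (hv : ∀ j, MemLp (v j) 2 volume) (hab : SupportedIn v a b)
    (hdet : ∀ x, (jetMatrix N u x).det ≠ 0)
    {R : Lp ℂ 2 (volume : Measure ℝ) →L[ℂ] Lp ℂ 2 (volume : Measure ℝ)} (hR : IsResolvent v z R)
    (f : Lp ℂ 2 (volume : Measure ℝ)) {r : ℝ} (hf : ∀ᵐ y : ℝ, y ∉ Set.Icc (-r) r → f y = 0) :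
    R f =ᵐ[volume] fun x => ∫ y, greenKernel hN ζ u x y * f y := by
  have hY := h.isPrimitive_greenSolution hN hv hab hdet f
  -- Outside the support of f the Green coefficients are constant, and on each side those belonging
  -- to the solutions not normalized there vanish. The Green solution therefore has decaying
  -- exponential tails and lies in the Sobolev class.
  have hcoef : ∀ j, (ζ j).re < 0 → ∀ x < -r, greenCoefficient hN ζ u f j x = 0 := by
    intro j hj x hx
    rw [greenCoefficient, if_pos hj, setIntegral_eq_zero_of_ae_eq_zero, mul_zero]
    filter_upwards [hf] with y hy hyx
    rw [hy fun hy' => by linarith [hy'.1, Set.mem_Iic.1 hyx], mul_zero]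
  have hcoef' : ∀ j, ¬ (ζ j).re < 0 → ∀ x, r < x → greenCoefficient hN ζ u f j x = 0 := by
    intro j hj x hx
    rw [greenCoefficient, if_neg hj, setIntegral_eq_zero_of_ae_eq_zero, neg_zero, mul_zero]
    filter_upwards [hf] with y hy hyx
    rw [hy fun hy' => by linarith [hy'.2, Set.mem_Ioi.1 hyx], mul_zero]
  have hconst : ∀ j x y, (∀ t ∈ Set.uIoc x y, t ∉ Set.Icc (-r) r) →
      greenCoefficient hN ζ u f j y = greenCoefficient hN ζ u f j x := by
    intro j x y hxy
    rw [← sub_eq_zero, (h.isPrimitive_greenCoefficient hN hv hab hdet f j).2 x y]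
    refine intervalIntegral.integral_zero_ae ?_
    filter_upwards [hf] with t ht htx
    rw [ht (hxy t htx), mul_zero, mul_zero]
  have hYL : ∀ k, MemLp (fun x => ∑ j, jetMatrix N u x k j * greenCoefficient hN ζ u f j x) 2
      volume := by
    intro k
    refine memLp_of_exponential_tails (hY k).continuous (a := min a (-r)) (b := max b r) (ζ := ζ)
      (d := fun j => if (ζ j).re < 0 then 0 else
        ζ j ^ (k : ℕ) * greenCoefficient hN ζ u f j (min a (-r) - 1))
      (d' := fun j => if (ζ j).re < 0 then
        ζ j ^ (k : ℕ) * greenCoefficient hN ζ u f j (max b r + 1) else 0)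
      (fun x hx => ?_) (fun j hj => ?_) (fun x hx => ?_) (fun j hj => ?_)
    · have hxa := hx.trans_le (min_le_left _ _)
      have hxr := hx.trans_le (min_le_right _ _)
      refine Finset.sum_congr rfl fun j _ => ?_
      by_cases hj : (ζ j).re < 0
      · rw [if_pos hj, hcoef j hj x hxr]; ring
      · rw [if_neg hj, h.jetMatrix_left hab (lt_of_le_of_ne (not_lt.1 hj) (h.re_ne_zero j).symm) hxa,
          jetMatrix_expSystem, hconst j (min a (-r) - 1) x]
        · ring
        · intro t ht ht'
          have := Set.uIoc_subset_uIcc ht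
          rw [Set.mem_uIcc] at this
          rcases this with h1 | h1 <;> linarith [ht'.1, min_le_right a (-r)]
    · by_contra hj'
      have : (ζ j).re < 0 := lt_of_le_of_ne (not_lt.1 hj') (h.re_ne_zero j)
      simp [this] at hj
    · have hxa := (le_max_left _ _).trans_lt hx
      have hxr := (le_max_right _ _).trans_lt hx
      refine Finset.sum_congr rfl fun j _ => ?_
      by_cases hj : (ζ j).re < 0
      · rw [if_pos hj, h.jetMatrix_right hab hj hxa, jetMatrix_expSystem,
          hconst j (max b r + 1) x]
        · ring
        · intro t ht ht'
          have := Set.uIoc_subset_uIcc ht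
          rw [Set.mem_uIcc] at this
          rcases this with h1 | h1 <;> linarith [ht'.2, le_max_right b r]
      · rw [if_neg hj, hcoef' j hj x hxr]; ring
    · by_contra hj'
      simp [hj'] at hj
  have hS := isSobolev_of_isPrimitive
    (Y := fun x k => ∑ j, jetMatrix N u x k j * greenCoefficient hN ζ u f j x)
    hN hv hab (Lp.memLp f) hY hYL
  obtain ⟨-, -, h3⟩ := iteratedDeriv_of_isPrimitive
    (Y := fun x k => ∑ j, jetMatrix N u x k j * greenCoefficient hN ζ u f j x) hN hY
  have hRu : R f = (hYL ⟨0, hN⟩).toLp :=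
    (hR _ _).2 (mem_operatorGraph_of_solution hS (MemLp.coeFn_toLp _) h3)
  rw [hRu]
  filter_upwards [(hYL ⟨0, hN⟩).coeFn_toLp] with x hx
  rw [hx, (h.integral_greenKernel hN hv hab hdet f x).2]

/-- The Green function is the integral kernel of the resolvent. -/
theorem resolvent_eq_integral_greenKernel (h : IsDistinguishedSystem v z ζ u) (hN : 0 < N)
    (hv : ∀ j, MemLp (v j) 2 volume) (hab : SupportedIn v a b)
    (hdet : ∀ x, (jetMatrix N u x).det ≠ 0)
    {R : Lp ℂ 2 (volume : Measure ℝ) →L[ℂ] Lp ℂ 2 (volume : Measure ℝ)} (hR : IsResolvent v z R)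
    (f : Lp ℂ 2 (volume : Measure ℝ)) :
    R f =ᵐ[volume] fun x => ∫ y, greenKernel hN ζ u x y * f y := by
  set g : ℕ → Lp ℂ 2 (volume : Measure ℝ) := fun n => ((Lp.memLp f).indicator
      (measurableSet_Icc (a := -(n : ℝ)) (b := (n : ℝ)))).toLp with hg
  have hgc : ∀ n, g n =ᵐ[volume] (Set.Icc (-(n : ℝ)) n).indicator f := fun n =>
    MemLp.coeFn_toLp _
  have h1 : Tendsto (fun n => R (g n)) atTop (𝓝 (R f)) :=
    (R.continuous.tendsto f).comp (tendsto_toLp_indicator f)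
  -- Boundedness of R gives convergence in L², hence almost everywhere along a subsequence; the
  -- truncated integrals converge at every x, and the two limits are compared.
  obtain ⟨ns, hns, hae⟩ := (tendstoInMeasure_of_tendsto_Lp h1).exists_seq_tendsto_ae
  have h2 : ∀ᵐ x : ℝ, ∀ n, R (g n) x = ∫ y, greenKernel hN ζ u x y * g n y :=
    ae_all_iff.2 fun n => h.resolvent_eq_of_bounded_support hN hv hab hdet hR (g n) (r := n) (by
      filter_upwards [hgc n] with y hy hyn
      rw [hy, Set.indicator_of_notMem hyn])
  filter_upwards [hae, h2] with x hx1 hx2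
  refine tendsto_nhds_unique hx1 ?_
  have h3 := (tendsto_integral_mul_indicator
    (h.integral_greenKernel hN hv hab hdet f x).1).comp hns.tendsto_atTop
  refine h3.congr fun i => ?_
  rw [hx2, Function.comp_apply]
  refine integral_congr_ae ?_
  filter_upwards [hgc (ns i)] with y hy
  rw [hy]

end IsDistinguishedSystem


/-! ### Continuity and uniqueness of the kernels -/

variable {N : ℕ} {v : Fin N → ℝ → ℂ} {z : ℂ} {ζ : Fin N → ℂ} {u : Fin N → ℝ → ℂ} {a b : ℝ}

theorem IsResolvent.unique {R R' : Lp ℂ 2 (volume : Measure ℝ) →L[ℂ] Lp ℂ 2 (volume : Measure ℝ)}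
    (h : IsResolvent v z R) (h' : IsResolvent v z R') : R = R' :=
  ContinuousLinearMap.ext fun f => ((h' f (R f)).2 ((h f (R f)).1 rfl)).symm

/-- An integral kernel is determined where it is continuous. -/
theorem kernel_eq_of_ne {K K' : ℝ → ℝ → ℂ}
    {T : Lp ℂ 2 (volume : Measure ℝ) → Lp ℂ 2 (volume : Measure ℝ)}
    (hc : ContinuousOn (fun p : ℝ × ℝ => K p.1 p.2) {p | p.1 ≠ p.2})
    (hc' : ContinuousOn (fun p : ℝ × ℝ => K' p.1 p.2) {p | p.1 ≠ p.2})
    (hK : ∀ f : Lp ℂ 2 (volume : Measure ℝ), ∀ᵐ x : ℝ,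
      Integrable (fun y => K x y * f y) ∧ T f x = ∫ y, K x y * f y)
    (hK' : ∀ f : Lp ℂ 2 (volume : Measure ℝ), ∀ᵐ x : ℝ,
      Integrable (fun y => K' x y * f y) ∧ T f x = ∫ y, K' x y * f y)
    {x y : ℝ} (hxy : x ≠ y) : K x y = K' x y := by
  by_contra hne
  set D : ℝ × ℝ → ℂ := fun p => K p.1 p.2 - K' p.1 p.2 with hD
  have hD0 : 0 < ‖D (x, y)‖ := norm_pos_iff.2 (sub_ne_zero.2 hne)
  have hopen : {p : ℝ × ℝ | p.1 ≠ p.2} ∈ 𝓝 (x, y) :=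
    (isOpen_ne_fun continuous_fst continuous_snd).mem_nhds hxy
  have hDc : ContinuousAt D (x, y) := (hc.continuousAt hopen).sub (hc'.continuousAt hopen)
  obtain ⟨ε, hε, hball⟩ := Metric.eventually_nhds_iff.1
    (hDc.eventually (Metric.ball_mem_nhds _ (half_pos hD0)))
  -- The kernels are tested on the indicator of a short interval around y, at a generic point x'
  -- near x; off the diagonal their difference D is continuous at (x, y).
  set s := Set.Ioc (y - ε / 2) (y + ε / 2) with hs
  set f : Lp ℂ 2 (volume : Measure ℝ) := indicatorConstLp 2 (measurableSet_Ioc :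
    MeasurableSet s) (by simp) (1 : ℂ) with hf
  have hfe : f =ᵐ[volume] s.indicator fun _ => 1 := indicatorConstLp_coeFn
  have key : ∀ L : ℝ → ℂ, (fun t => L t * f t) =ᵐ[volume] s.indicator L := fun L => by
    filter_upwards [hfe] with t ht
    rw [ht]
    by_cases hts : t ∈ s <;> simp [hts]
  have hle : y - ε / 2 ≤ y + ε / 2 := by linarith
  have key2 : ∀ L : ℝ → ℂ, Integrable (fun t => L t * f t) →
      IntervalIntegrable L volume (y - ε / 2) (y + ε / 2) := fun L hL => by
    rw [intervalIntegrable_iff_integrableOn_Ioc_of_le hle]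
    exact (integrable_indicator_iff measurableSet_Ioc).1 (hL.congr (key L))
  have key3 : ∀ L : ℝ → ℂ, ∫ t, L t * f t = ∫ t in (y - ε / 2)..(y + ε / 2), L t := fun L => by
    rw [integral_congr_ae (key L), integral_indicator measurableSet_Ioc,
      intervalIntegral.integral_of_le hle]
  have hae := (hK f).and (hK' f)
  obtain ⟨x', hx'ε, ⟨hi, he⟩, hi', he'⟩ : ∃ x', x' ∈ Metric.ball x ε ∧
      (Integrable (fun y => K x' y * f y) ∧ T f x' = ∫ y, K x' y * f y) ∧
      (Integrable (fun y => K' x' y * f y) ∧ T f x' = ∫ y, K' x' y * f y) := by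
    have hpos : (volume : Measure ℝ) (Metric.ball x ε) ≠ 0 :=
      (Metric.measure_ball_pos volume x hε).ne'
    exact ((frequently_ae_mem_iff.2 hpos).and_eventually hae).exists
  rw [key3] at he he'
  have hzero : ∫ t in (y - ε / 2)..(y + ε / 2), D (x', t) = 0 := by
    rw [hD, intervalIntegral.integral_sub (key2 _ hi) (key2 _ hi'), ← he, ← he', sub_self]
  -- D(x', ·) has integral zero over an interval of length ε but stays within |D(x,y)|/2 of D(x,y),
  -- which would give ε |D(x,y)| ≤ ε |D(x,y)|/2.
  have hconst : ∫ t in (y - ε / 2)..(y + ε / 2), (D (x', t) - D (x, y)) =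
      -((ε : ℂ) * D (x, y)) := by
    rw [intervalIntegral.integral_sub ((key2 _ hi).sub (key2 _ hi')) (by simp), hzero,
      intervalIntegral.integral_const]
    simp
  have hbound := intervalIntegral.norm_integral_le_of_norm_le_const (a := y - ε / 2)
    (b := y + ε / 2) (f := fun t => D (x', t) - D (x, y)) (C := ‖D (x, y)‖ / 2) fun t ht => by
      rw [Set.uIoc_of_le hle] at ht
      have : dist (x', t) (x, y) < ε := by
        rw [Prod.dist_eq, max_lt_iff]
        refine ⟨hx'ε, ?_⟩
        rw [Real.dist_eq, abs_lt]
        constructor <;> linarith [ht.1, ht.2]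
      have h2 := hball this
      rw [dist_eq_norm] at h2
      exact h2.le
  rw [hconst, norm_neg, norm_mul, Complex.norm_real, Real.norm_of_nonneg hε.le,
    show y + ε / 2 - (y - ε / 2) = ε by ring, abs_of_pos hε] at hbound
  nlinarith [mul_pos hε hD0]

theorem IsResolventKernel.eq_of_ne {K K' : ℝ → ℝ → ℂ} (h : IsResolventKernel v z K)
    (h' : IsResolventKernel v z K') {x y : ℝ} (hxy : x ≠ y) : K x y = K' x y := by
  obtain ⟨hc, R, hR, hK⟩ := h
  obtain ⟨hc', R', hR', hK'⟩ := h'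
  obtain rfl := hR.unique hR'
  exact kernel_eq_of_ne hc hc' hK hK' hxy

/-- The diagonal values of the difference of the kernels are well defined. -/
theorem IsResolventKernelPair.sub_eq {K K₀ K' K₀' : ℝ → ℝ → ℂ}
    (h : IsResolventKernelPair v z K K₀) (h' : IsResolventKernelPair v z K' K₀') (y : ℝ) :
    K y y - K₀ y y = K' y y - K₀' y y := by
  have hd := Continuous.ext_on (dense_compl_singleton y)
    (h.2.2.2.comp (Continuous.prodMk_left y)) (h'.2.2.2.comp (Continuous.prodMk_left y))
    fun x hx => by
      change K x y - K₀ x y = K' x y - K₀' x y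
      rw [h.1.eq_of_ne h'.1 hx, h.2.1.eq_of_ne h'.2.1 hx]
  exact congrFun hd y

theorem continuous_greenLower (hN : 0 < N) (ζ : Fin N → ℂ) (h : Continuous (jetMatrix N u))
    (hi : Continuous fun x => (jetMatrix N u x)⁻¹) :
    Continuous fun p : ℝ × ℝ => greenLower hN ζ u p.1 p.2 := by
  refine continuous_const.mul (continuous_finsetSum _ fun j _ => ?_)
  split_ifs
  · exact ((h.comp continuous_fst).matrix_elem _ _).mul ((hi.comp continuous_snd).matrix_elem _ _)
  · exact continuous_const

theorem continuous_greenUpper (hN : 0 < N) (ζ : Fin N → ℂ) (h : Continuous (jetMatrix N u))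
    (hi : Continuous fun x => (jetMatrix N u x)⁻¹) :
    Continuous fun p : ℝ × ℝ => greenUpper hN ζ u p.1 p.2 := by
  refine continuous_const.mul (continuous_finsetSum _ fun j _ => ?_)
  split_ifs
  · exact continuous_const
  · exact ((h.comp continuous_fst).matrix_elem _ _).mul ((hi.comp continuous_snd).matrix_elem _ _)

theorem continuousOn_greenKernel (hN : 0 < N) (ζ : Fin N → ℂ) (h : Continuous (jetMatrix N u))
    (hi : Continuous fun x => (jetMatrix N u x)⁻¹) :
    ContinuousOn (fun p : ℝ × ℝ => greenKernel hN ζ u p.1 p.2) {p | p.1 ≠ p.2} := by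
  intro p hp
  refine ContinuousAt.continuousWithinAt ?_
  rcases lt_or_gt_of_ne (show p.1 ≠ p.2 from hp) with hlt | hlt
  · refine (continuous_greenUpper hN ζ h hi).neg.continuousAt.congr ?_
    filter_upwards [(isOpen_lt continuous_fst continuous_snd).mem_nhds hlt] with q hq
    rw [greenKernel, if_neg (not_le.2 hq)]
    rfl
  · refine (continuous_greenLower hN ζ h hi).continuousAt.congr ?_
    filter_upwards [(isOpen_lt continuous_snd continuous_fst).mem_nhds hlt] with q hq
    rw [greenKernel, if_pos (le_of_lt hq)]

theorem continuous_greenKernel (hN : 2 ≤ N) (ζ : Fin N → ℂ) (h : Continuous (jetMatrix N u))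
    (hi : Continuous fun x => (jetMatrix N u x)⁻¹) (hdet : ∀ x, (jetMatrix N u x).det ≠ 0) :
    Continuous fun p : ℝ × ℝ => greenKernel (two_pos.trans_le hN) ζ u p.1 p.2 := by
  refine Continuous.if_le (continuous_greenLower _ ζ h hi) (continuous_greenUpper _ ζ h hi).neg
    continuous_snd continuous_fst fun p hp => ?_
  have := greenLower_add_greenUpper (ζ := ζ) (two_pos.trans_le hN) hdet p.1
  rw [if_neg (by omega), mul_zero] at this
  rw [hp]
  exact eq_neg_of_add_eq_zero_left this

/-- Both Green functions have the same jump by `greenLower_add_greenUpper`, so it cancels in the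
difference even when N = 1. -/
theorem continuous_greenKernel_sub {u' : Fin N → ℝ → ℂ} (hN : 0 < N) (ζ : Fin N → ℂ)
    (h : Continuous (jetMatrix N u)) (hi : Continuous fun x => (jetMatrix N u x)⁻¹)
    (hdet : ∀ x, (jetMatrix N u x).det ≠ 0)
    (h' : Continuous (jetMatrix N u')) (hi' : Continuous fun x => (jetMatrix N u' x)⁻¹)
    (hdet' : ∀ x, (jetMatrix N u' x).det ≠ 0) :
    Continuous fun p : ℝ × ℝ => greenKernel hN ζ u p.1 p.2 - greenKernel hN ζ u' p.1 p.2 := by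
  have e : (fun p : ℝ × ℝ => greenKernel hN ζ u p.1 p.2 - greenKernel hN ζ u' p.1 p.2) =
      fun p : ℝ × ℝ => if p.2 ≤ p.1 then greenLower hN ζ u p.1 p.2 - greenLower hN ζ u' p.1 p.2
        else greenUpper hN ζ u' p.1 p.2 - greenUpper hN ζ u p.1 p.2 := by
    funext p
    unfold greenKernel
    split_ifs
    · rfl
    · ring
  rw [e]
  refine Continuous.if_le ((continuous_greenLower _ ζ h hi).sub (continuous_greenLower _ ζ h' hi'))
    ((continuous_greenUpper _ ζ h' hi').sub (continuous_greenUpper _ ζ h hi))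
    continuous_snd continuous_fst fun p hp => ?_
  have h1 := greenLower_add_greenUpper (ζ := ζ) hN hdet p.1
  rw [← greenLower_add_greenUpper (ζ := ζ) hN hdet' p.1] at h1
  rw [hp]
  linear_combination h1

namespace IsDistinguishedSystem

theorem isResolventKernel (h : IsDistinguishedSystem v z ζ u) (hN : 0 < N)
    (hv : ∀ j, MemLp (v j) 2 volume) (hab : SupportedIn v a b)
    {R : Lp ℂ 2 (volume : Measure ℝ) →L[ℂ] Lp ℂ 2 (volume : Measure ℝ)} (hR : IsResolvent v z R) :
    IsResolventKernel v z (greenKernel hN ζ u) := by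
  have hdet := h.det_jetMatrix_ne_zero hN hv hab hR
  refine ⟨continuousOn_greenKernel hN ζ (h.isMatrixPrimitive hN).continuous
    (h.isPrimitive_inv hN hv hdet).continuous, R, hR, fun f => ?_⟩
  filter_upwards [h.resolvent_eq_integral_greenKernel hN hv hab hdet hR f] with x hx
  exact ⟨(h.integral_greenKernel hN hv hab hdet f x).1, hx⟩

end IsDistinguishedSystem

theorem memLp_zero_coefficients (j : Fin N) : MemLp ((0 : Fin N → ℝ → ℂ) j) 2 volume :=
  MemLp.zero

theorem supportedIn_zero : SupportedIn (0 : Fin N → ℝ → ℂ) 0 0 :=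
  ⟨le_rfl, fun x _ k y hy => by simp [tsupport] at hy, fun x _ k y hy => by simp [tsupport] at hy⟩

/-- The Green functions are the normalized pair of resolvent kernels. -/
theorem IsDistinguishedSystem.isResolventKernelPair (h : IsDistinguishedSystem v z ζ u) (hN : 0 < N)
    (hv : ∀ j, MemLp (v j) 2 volume) (hsupp : ∀ j, HasCompactSupport (v j))
    {R : Lp ℂ 2 (volume : Measure ℝ) →L[ℂ] Lp ℂ 2 (volume : Measure ℝ)} (hR : IsResolvent v z R) :
    IsResolventKernelPair v z (greenKernel hN ζ u) (greenKernel hN ζ (expSystem ζ)) := by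
  obtain ⟨a, b, hab⟩ := exists_supportedIn hsupp
  obtain ⟨R₀, hR₀⟩ := exists_isResolvent_zero hN (ne_pow_of_isResolvent hN hsupp hR)
  have h₀ := isDistinguishedSystem_expSystem h.injective h.root h.re_ne_zero
  have hdet := h.det_jetMatrix_ne_zero hN hv hab hR
  have hdet₀ : ∀ x, (jetMatrix N (expSystem ζ) x).det ≠ 0 :=
    det_jetMatrix_expSystem_ne_zero h.injective
  have hc := (h.isMatrixPrimitive hN).continuous
  have hi := (h.isPrimitive_inv hN hv hdet).continuous
  have hc₀ := (h₀.isMatrixPrimitive hN).continuous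
  have hi₀ := (h₀.isPrimitive_inv hN memLp_zero_coefficients hdet₀).continuous
  exact ⟨h.isResolventKernel hN hv hab hR,
    h₀.isResolventKernel hN memLp_zero_coefficients supportedIn_zero hR₀,
    fun hN2 => ⟨continuous_greenKernel hN2 ζ hc hi hdet, continuous_greenKernel hN2 ζ hc₀ hi₀ hdet₀⟩,
    continuous_greenKernel_sub hN ζ hc hi hdet hc₀ hi₀ hdet₀⟩


/-! ### Dependence on the spectral parameter -/

variable {N : ℕ} {v : Fin N → ℝ → ℂ} {z : ℂ} {ζ : ℂ → Fin N → ℂ} {u : ℂ → Fin N → ℝ → ℂ}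
  {a b : ℝ}

/-- The derivative of the matrix of jets in the spectral parameter. -/
noncomputable def jetDeriv (N : ℕ) (u : ℂ → Fin N → ℝ → ℂ) (z : ℂ) (x : ℝ) :
    Matrix (Fin N) (Fin N) ℂ :=
  Matrix.of fun k j => deriv (fun w => jetMatrix N (u w) x k j) z

/-- The logarithmic derivative of the matrix of jets in the spectral parameter. -/
noncomputable def jetLogDeriv (N : ℕ) (u : ℂ → Fin N → ℝ → ℂ) (z : ℂ) (x : ℝ) :
    Matrix (Fin N) (Fin N) ℂ :=
  (jetMatrix N (u z) x)⁻¹ * jetDeriv N u z x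

/-- The roots can be numbered holomorphically near a point. -/
theorem exists_numbering_family (hN : 0 < N) (hz : ∀ ξ : ℝ, z ≠ (ξ : ℂ) ^ N) :
    ∃ ζ : ℂ → Fin N → ℂ, (∀ j, DifferentiableAt ℂ (fun w => ζ w j) z) ∧
      ∀ᶠ w in 𝓝 z, Function.Injective (ζ w) ∧ (∀ j, ζ w j ^ N = Complex.I ^ N * w) ∧
        ∀ j, (ζ w j).re ≠ 0 := by
  obtain ⟨η, hinj, hroot, hre⟩ := exists_numbering hN hz
  have hz0 : z ≠ 0 := by simpa [hN.ne'] using hz 0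
  have hN0 : (N : ℂ) ≠ 0 := Nat.cast_ne_zero.2 hN.ne'
  have hd : ∀ j, DifferentiableAt ℂ (fun w => η j * Complex.exp (Complex.log (w / z) / N)) z :=
    fun j => by
      have : z / z ∈ Complex.slitPlane := by rw [div_self hz0]; exact Complex.one_mem_slitPlane
      exact (((differentiableAt_id.div_const z).clog this).div_const _).cexp.const_mul _
  -- Each root at z is multiplied by the principal branch of (w/z)^(1/N), which is holomorphic near
  -- w = z.
  refine ⟨fun w j => η j * Complex.exp (Complex.log (w / z) / N), hd, ?_⟩
  have hre' : ∀ᶠ w in 𝓝 z, ∀ j, (η j * Complex.exp (Complex.log (w / z) / N)).re ≠ 0 := by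
    refine eventually_all.2 fun j => ?_
    have hc : ContinuousAt (fun w => (η j * Complex.exp (Complex.log (w / z) / N)).re) z :=
      Complex.continuous_re.continuousAt.comp (hd j).continuousAt
    refine hc.eventually_ne ?_
    simpa [hz0] using hre j
  filter_upwards [hre', eventually_ne_nhds hz0] with w hw hw0
  refine ⟨fun i j hij => hinj (mul_right_cancel₀ (Complex.exp_ne_zero _) hij), fun j => ?_, hw⟩
  rw [mul_pow, hroot, ← Complex.exp_nat_mul, mul_div_cancel₀ _ hN0,
    Complex.exp_log (div_ne_zero hw0 hz0)]
  field_simp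

/-- The solutions are chosen separately for each w. No continuity is arranged here; it follows later
from the normalization beyond the supports. -/
theorem exists_distinguished_family (hN : 0 < N) (hv : ∀ j, LocallyIntegrable (v j))
    (hsupp : ∀ j, HasCompactSupport (v j))
    (hζ : ∀ᶠ w in 𝓝 z, Function.Injective (ζ w) ∧ (∀ j, ζ w j ^ N = Complex.I ^ N * w) ∧
        ∀ j, (ζ w j).re ≠ 0) :
    ∃ u : ℂ → Fin N → ℝ → ℂ, ∀ᶠ w in 𝓝 z, IsDistinguishedSystem v w (ζ w) (u w) := by
  classical
  refine ⟨fun w => if h : ∃ u, IsDistinguishedSystem v w (ζ w) u then h.choose else 0, ?_⟩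
  filter_upwards [hζ] with w hw
  have h := exists_isDistinguishedSystem hN hv hsupp hw.1 hw.2.1 hw.2.2
  rw [dif_pos h]
  exact h.choose_spec

theorem free_family (h : ∀ᶠ w in 𝓝 z, IsDistinguishedSystem v w (ζ w) (u w)) :
    ∀ᶠ w in 𝓝 z, IsDistinguishedSystem (0 : Fin N → ℝ → ℂ) w (ζ w) (expSystem (ζ w)) :=
  h.mono fun _ hw => isDistinguishedSystem_expSystem hw.injective hw.root hw.re_ne_zero

theorem hasDerivAt_jetMatrix_expSystem (hζ : ∀ j, DifferentiableAt ℂ (fun w => ζ w j) z) (x : ℝ)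
    (k j : Fin N) :
    HasDerivAt (fun w => jetMatrix N (expSystem (ζ w)) x k j)
      ((k * ζ z j ^ ((k : ℕ) - 1) * deriv (fun w => ζ w j) z +
        x * (ζ z j ^ (k : ℕ) * deriv (fun w => ζ w j) z)) * Complex.exp (ζ z j * x)) z := by
  simp only [jetMatrix_expSystem]
  have h := (hζ j).hasDerivAt
  convert! (h.pow (k : ℕ)).mul ((h.mul_const (x : ℂ)).cexp) using 1
  simp only [Pi.pow_apply]
  ring

/-- The sign of Re ζ_j is stable near z, so u_j stays an exponential on the same side for all nearby
w and may be differentiated in w there explicitly. -/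
theorem eventually_jetMatrix_eq_right
    (h : ∀ᶠ w in 𝓝 z, IsDistinguishedSystem v w (ζ w) (u w)) (hab : SupportedIn v a b)
    (hζ : ∀ j, DifferentiableAt ℂ (fun w => ζ w j) z) {j : Fin N} (hj : (ζ z j).re < 0) {x : ℝ}
    (hx : b < x) (k : Fin N) : (fun w => jetMatrix N (u w) x k j) =ᶠ[𝓝 z]
      fun w => jetMatrix N (expSystem (ζ w)) x k j := by
  have hc : ContinuousAt (fun w => (ζ w j).re) z :=
    Complex.continuous_re.continuousAt.comp (hζ j).continuousAt
  filter_upwards [h, hc.eventually (gt_mem_nhds hj)] with w hw hwj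
  exact hw.jetMatrix_right hab hwj hx k

theorem eventually_jetMatrix_eq_left
    (h : ∀ᶠ w in 𝓝 z, IsDistinguishedSystem v w (ζ w) (u w)) (hab : SupportedIn v a b)
    (hζ : ∀ j, DifferentiableAt ℂ (fun w => ζ w j) z) {j : Fin N} (hj : 0 < (ζ z j).re) {x : ℝ}
    (hx : x < a) (k : Fin N) : (fun w => jetMatrix N (u w) x k j) =ᶠ[𝓝 z]
      fun w => jetMatrix N (expSystem (ζ w)) x k j := by
  have hc : ContinuousAt (fun w => (ζ w j).re) z :=
    Complex.continuous_re.continuousAt.comp (hζ j).continuousAt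
  filter_upwards [h, hc.eventually (lt_mem_nhds hj)] with w hw hwj
  exact hw.jetMatrix_left hab hwj hx k

/-- The distinguished solutions depend holomorphically on the spectral parameter. -/
theorem hasDerivAt_jetMatrix (h : ∀ᶠ w in 𝓝 z, IsDistinguishedSystem v w (ζ w) (u w))
    (hN : 0 < N) (hv : ∀ j, LocallyIntegrable (v j)) (hab : SupportedIn v a b)
    (hζ : ∀ j, DifferentiableAt ℂ (fun w => ζ w j) z) (x : ℝ) (k j : Fin N) :
    HasDerivAt (fun w => jetMatrix N (u w) x k j) (jetDeriv N u z x k j) z := by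
  refine DifferentiableAt.hasDerivAt ?_
  have hY : ∀ᶠ w in 𝓝 z, IsMatrixPrimitive (jetMatrix N fun _ : Unit => u w j)
      fun x => (companion v z x + (w - z) • companionSlope N) *
        jetMatrix N (fun _ : Unit => u w j) x := by
    filter_upwards [h] with w hw
    simp only [← companion_eq_add]
    exact isMatrixPrimitive_jetMatrix hN fun _ => hw.solution j
  have hA := locallyIntegrableEntries_companion hv z
  -- Differentiability is transported from a point c where column j is explicit. The columns are
  -- handled one by one, since c depends on j.
  have key : ∀ c, (∀ i, (fun w => jetMatrix N (u w) c i j) =ᶠ[𝓝 z]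
      fun w => jetMatrix N (expSystem (ζ w)) c i j) →
      DifferentiableAt ℂ (fun w => jetMatrix N (u w) x k j) z := fun c hc =>
    differentiableAt_parameter hA hY (a := c) (fun i _ =>
      ((hasDerivAt_jetMatrix_expSystem hζ c i j).congr_of_eventuallyEq (hc i)).differentiableAt)
      x k ()
  rcases lt_or_gt_of_ne (h.self_of_nhds.re_ne_zero j) with hj | hj
  · exact key (b + 1) fun i => eventually_jetMatrix_eq_right h hab hζ hj (by linarith) i
  · exact key (a - 1) fun i => eventually_jetMatrix_eq_left h hab hζ hj (by linarith) i

/-- The slope matrix has rank one, so the diagonal entries of Y⁻¹ E Y are exactly the terms of the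
Green function on the diagonal. This links the resolvent with the derivative in z. -/
theorem inv_mul_companionSlope_mul (hN : 0 < N) (P Y : Matrix (Fin N) (Fin N) ℂ) (j : Fin N) :
    (P * companionSlope N * Y) j j = Complex.I ^ N * (Y ⟨0, hN⟩ j * P j (lastIndex hN)) := by
  have h1 : ∀ i : Fin N, (P * companionSlope N) j i =
      if i = ⟨0, hN⟩ then Complex.I ^ N * P j (lastIndex hN) else 0 := fun i => by
    rw [Matrix.mul_apply, Finset.sum_eq_single (lastIndex hN)]
    · have : ((lastIndex hN : Fin N) : ℕ) + 1 = N := by rw [lastIndex]; simp only; omega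
      simp only [companionSlope, Matrix.of_apply, if_pos this, Fin.ext_iff]
      split_ifs <;> ring
    · intro k _ hk
      have : (k : ℕ) + 1 ≠ N := fun h => hk (by rw [Fin.ext_iff, lastIndex]; simp only; omega)
      simp [companionSlope, this]
    · simp
  rw [Matrix.mul_apply, Finset.sum_eq_single ⟨0, hN⟩]
  · rw [h1, if_pos rfl]; ring
  · intro i _ hi
    rw [h1, if_neg hi, zero_mul]
  · simp

/-- The weighted diagonal of the logarithmic derivative as an integral. -/
theorem sum_jetLogDeriv_sub (h : ∀ᶠ w in 𝓝 z, IsDistinguishedSystem v w (ζ w) (u w))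
    (hN : 0 < N) (hv : ∀ j, MemLp (v j) 2 volume) (hab : SupportedIn v a b)
    (hζ : ∀ j, DifferentiableAt ℂ (fun w => ζ w j) z)
    (hdet : ∀ x, (jetMatrix N (u z) x).det ≠ 0) (s : Fin N → ℂ) (x y : ℝ) :
    (∑ j, s j * jetLogDeriv N u z y j j) - ∑ j, s j * jetLogDeriv N u z x j j =
      ∫ t in x..y, Complex.I ^ N * ∑ j, s j * (jetMatrix N (u z) t ⟨0, hN⟩ j *
        (jetMatrix N (u z) t)⁻¹ j (lastIndex hN)) := by
  have hv' := fun j => locallyIntegrable_of_memLp (hv j)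
  have hY : ∀ᶠ w in 𝓝 z, IsMatrixPrimitive (jetMatrix N (u w))
      fun x => (companion v z x + (w - z) • companionSlope N) * jetMatrix N (u w) x := by
    filter_upwards [h] with w hw
    simp only [← companion_eq_add]
    exact hw.isMatrixPrimitive hN
  have hz := h.self_of_nhds
  have hc := (hz.isMatrixPrimitive hN).continuous
  have hi := (hz.isPrimitive_inv hN hv hdet).continuous
  have e : ∀ t, Complex.I ^ N * ∑ j, s j * (jetMatrix N (u z) t ⟨0, hN⟩ j *
        (jetMatrix N (u z) t)⁻¹ j (lastIndex hN)) =
      ∑ j, s j * ((jetMatrix N (u z) t)⁻¹ * companionSlope N * jetMatrix N (u z) t) j j :=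
    fun t => by
      rw [Finset.mul_sum]
      refine Finset.sum_congr rfl fun j _ => ?_
      rw [inv_mul_companionSlope_mul hN]
      ring
  simp only [e]
  rw [intervalIntegral.integral_finsetSum, ← Finset.sum_sub_distrib]
  · refine Finset.sum_congr rfl fun j _ => ?_
    rw [intervalIntegral.integral_const_mul, ← mul_sub]
    congr 1
    exact adjoint_mul_deriv_sub (hz.isPrimitive_inv hN hv hdet)
      (locallyIntegrableEntries_companion hv' z) hY
      (fun x i j => hasDerivAt_jetMatrix h hN hv' hab hζ x i j) x y j j
  · intro j _
    refine (continuous_const.mul ?_).intervalIntegrable _ _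
    exact ((hi.matrix_mul continuous_const).matrix_mul hc).matrix_elem j j


/-! ### The trace formula -/

variable {N : ℕ} {v : Fin N → ℝ → ℂ} {z : ℂ} {ζ : ℂ → Fin N → ℂ} {u : ℂ → Fin N → ℝ → ℂ}
  {a b : ℝ}

theorem tendsto_affine_mul_exp_atTop (c d : ℂ) {α : ℂ} (hα : α.re < 0) :
    Tendsto (fun x : ℝ => (c + x * d) * Complex.exp (α * x)) atTop (𝓝 0) := by
  have h0 := tendsto_rpow_mul_exp_neg_mul_atTop_nhds_zero 0 (-α.re) (neg_pos.2 hα)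
  have h1 := tendsto_rpow_mul_exp_neg_mul_atTop_nhds_zero 1 (-α.re) (neg_pos.2 hα)
  have h2 := (h0.const_mul ‖c‖).add (h1.const_mul ‖d‖)
  simp only [mul_zero, add_zero, neg_neg, Real.rpow_zero, Real.rpow_one, one_mul] at h2
  refine squeeze_zero_norm' ?_ h2
  filter_upwards [eventually_ge_atTop 0] with x hx
  rw [norm_mul, Complex.norm_exp, Complex.re_mul_ofReal]
  calc _ ≤ (‖c‖ + ‖(x : ℂ) * d‖) * Real.exp (α.re * x) := by gcongr; exact norm_add_le _ _
    _ = _ := by rw [norm_mul, Complex.norm_real, Real.norm_of_nonneg hx]; ring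

theorem tendsto_affine_mul_exp_atBot (c d : ℂ) {α : ℂ} (hα : 0 < α.re) :
    Tendsto (fun x : ℝ => (c + x * d) * Complex.exp (α * x)) atBot (𝓝 0) := by
  have h := (tendsto_affine_mul_exp_atTop c (-d) (α := -α) (by simpa using hα)).comp
    tendsto_neg_atBot_atTop
  refine h.congr fun x => ?_
  simp

/-- Row k of the inverse contributes exp(-ζ_k x). The z-derivative of column j contributes exp(ζ_j
x) times an affine function of x, whose linear term comes from differentiating the exponent. -/
theorem exists_jetLogDeriv_expSystem_eq (hinj : Function.Injective (ζ z))
    (hζ : ∀ j, DifferentiableAt ℂ (fun w => ζ w j) z) (k j : Fin N) :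
    ∃ c d : ℂ, ∀ x : ℝ, jetLogDeriv N (fun w => expSystem (ζ w)) z x k j =
      (c + x * d) * Complex.exp ((ζ z j - ζ z k) * x) := by
  refine ⟨∑ i : Fin N, ((Matrix.vandermonde (ζ z)).transpose)⁻¹ k i *
    ((i : ℕ) * ζ z j ^ ((i : ℕ) - 1) * deriv (fun w => ζ w j) z),
    ∑ i : Fin N, ((Matrix.vandermonde (ζ z)).transpose)⁻¹ k i *
      (ζ z j ^ (i : ℕ) * deriv (fun w => ζ w j) z), fun x => ?_⟩
  rw [jetLogDeriv, Matrix.mul_apply, Finset.mul_sum, ← Finset.sum_add_distrib, Finset.sum_mul]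
  refine Finset.sum_congr rfl fun i _ => ?_
  rw [inv_jetMatrix_expSystem hinj, jetDeriv, Matrix.of_apply,
    (hasDerivAt_jetMatrix_expSystem hζ x i j).deriv, sub_mul, sub_eq_neg_add, Complex.exp_add]
  ring

/-- M depends on z but is never differentiated: by hypothesis column j of the z-derivative is that
of the exponentials, so M enters only through the inverse of Y = Y₀ M. -/
theorem jetLogDeriv_sub_eq {x : ℝ} {M : Matrix (Fin N) (Fin N) ℂ}
    (hM : jetMatrix N (u z) x = jetMatrix N (expSystem (ζ z)) x * M) {j : Fin N}
    (hj : ∀ k, jetDeriv N u z x k j = jetDeriv N (fun w => expSystem (ζ w)) z x k j) :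
    jetLogDeriv N u z x j j - jetLogDeriv N (fun w => expSystem (ζ w)) z x j j =
      ∑ k, (M⁻¹ j k - if j = k then 1 else 0) *
        jetLogDeriv N (fun w => expSystem (ζ w)) z x k j := by
  simp only [sub_mul, ite_mul, one_mul, zero_mul, Finset.sum_sub_distrib, Finset.sum_ite_eq,
    Finset.mem_univ, if_true, sub_left_inj]
  rw [← Matrix.mul_apply, jetLogDeriv, jetLogDeriv, ← Matrix.mul_assoc, hM, Matrix.mul_inv_rev,
    Matrix.mul_apply, Matrix.mul_apply]
  exact Finset.sum_congr rfl fun k _ => by rw [hj k]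

/-- Terms with Re ζ_k < 0 drop out because column k of M⁻¹ is a unit vector; the others carry
exp((ζ_j - ζ_k)x) with Re(ζ_j - ζ_k) < 0, which beats the affine factor. -/
theorem tendsto_jetLogDeriv_sub_atTop
    (h : ∀ᶠ w in 𝓝 z, IsDistinguishedSystem v w (ζ w) (u w)) (hN : 0 < N)
    (hab : SupportedIn v a b) (hζ : ∀ j, DifferentiableAt ℂ (fun w => ζ w j) z)
    (hdet : ∀ x, (jetMatrix N (u z) x).det ≠ 0) {j : Fin N} (hj : (ζ z j).re < 0) :
    Tendsto (fun x => jetLogDeriv N u z x j j -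
      jetLogDeriv N (fun w => expSystem (ζ w)) z x j j) atTop (𝓝 0) := by
  have hz := h.self_of_nhds
  obtain ⟨M, hM, hMc⟩ := hz.exists_connection_right hN hab
  have hMdet : M.det ≠ 0 := fun h0 => hdet (b + 1) (by
    rw [hM _ (by linarith), Matrix.det_mul, h0, mul_zero])
  have hsum : Tendsto (fun x => ∑ k, (M⁻¹ j k - if j = k then 1 else 0) *
      jetLogDeriv N (fun w => expSystem (ζ w)) z x k j) atTop (𝓝 (∑ _k : Fin N, 0)) := by
    refine tendsto_finsetSum _ fun k _ => ?_
    rcases lt_or_gt_of_ne (hz.re_ne_zero k) with hk | hk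
    · simp [inv_apply_eq_zero_of_columns hMdet (hMc k hk)]
    · obtain ⟨c, d, hcd⟩ := exists_jetLogDeriv_expSystem_eq hz.injective hζ k j
      simp only [hcd]
      have hre : (ζ z j - ζ z k).re < 0 := by rw [Complex.sub_re]; linarith
      simpa using (tendsto_affine_mul_exp_atTop c d hre).const_mul
        (M⁻¹ j k - if j = k then 1 else 0)
  rw [Finset.sum_const_zero] at hsum
  refine hsum.congr' ?_
  filter_upwards [eventually_gt_atTop b] with x hx
  exact (jetLogDeriv_sub_eq (hM x hx) fun k =>
    (eventually_jetMatrix_eq_right h hab hζ hj hx k).deriv_eq).symm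

theorem tendsto_jetLogDeriv_sub_atBot
    (h : ∀ᶠ w in 𝓝 z, IsDistinguishedSystem v w (ζ w) (u w)) (hN : 0 < N)
    (hab : SupportedIn v a b) (hζ : ∀ j, DifferentiableAt ℂ (fun w => ζ w j) z)
    (hdet : ∀ x, (jetMatrix N (u z) x).det ≠ 0) {j : Fin N} (hj : 0 < (ζ z j).re) :
    Tendsto (fun x => jetLogDeriv N u z x j j -
      jetLogDeriv N (fun w => expSystem (ζ w)) z x j j) atBot (𝓝 0) := by
  have hz := h.self_of_nhds
  obtain ⟨M, hM, hMc⟩ := hz.exists_connection_left hN hab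
  have hMdet : M.det ≠ 0 := fun h0 => hdet (a - 1) (by
    rw [hM _ (by linarith), Matrix.det_mul, h0, mul_zero])
  have hsum : Tendsto (fun x => ∑ k, (M⁻¹ j k - if j = k then 1 else 0) *
      jetLogDeriv N (fun w => expSystem (ζ w)) z x k j) atBot (𝓝 (∑ _k : Fin N, 0)) := by
    refine tendsto_finsetSum _ fun k _ => ?_
    rcases lt_or_gt_of_ne (hz.re_ne_zero k) with hk | hk
    · obtain ⟨c, d, hcd⟩ := exists_jetLogDeriv_expSystem_eq hz.injective hζ k j
      simp only [hcd]
      have hre : 0 < (ζ z j - ζ z k).re := by rw [Complex.sub_re]; linarith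
      simpa using (tendsto_affine_mul_exp_atBot c d hre).const_mul
        (M⁻¹ j k - if j = k then 1 else 0)
    · simp [inv_apply_eq_zero_of_columns hMdet (hMc k hk)]
  rw [Finset.sum_const_zero] at hsum
  refine hsum.congr' ?_
  filter_upwards [eventually_lt_atBot a] with x hx
  exact (jetLogDeriv_sub_eq (hM x hx) fun k =>
    (eventually_jetMatrix_eq_left h hab hζ hj hx k).deriv_eq).symm

/-- The logarithmic derivative of the normalized Wronskian. -/
theorem hasDerivAt_normalizedWronskian
    (h : ∀ᶠ w in 𝓝 z, IsDistinguishedSystem v w (ζ w) (u w)) (hN : 0 < N)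
    (hv : ∀ j, LocallyIntegrable (v j)) (hsupp : ∀ j, HasCompactSupport (v j))
    (hζ : ∀ j, DifferentiableAt ℂ (fun w => ζ w j) z)
    (hdet : ∀ x, (jetMatrix N (u z) x).det ≠ 0) (x : ℝ) :
    HasDerivAt (fun w => normalizedWronskian v x w) (normalizedWronskian v x z *
      ((jetLogDeriv N u z x).trace - (jetLogDeriv N (fun w => expSystem (ζ w)) z x).trace)) z := by
  obtain ⟨a, b, hab⟩ := exists_supportedIn hsupp
  have hz := h.self_of_nhds
  have hdet₀ := det_jetMatrix_expSystem_ne_zero hz.injective x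
  have h1 := hasDerivAt_det (fun i j => hasDerivAt_jetMatrix h hN hv hab hζ x i j) (hdet x)
  have h2 := hasDerivAt_det (fun i j => hasDerivAt_jetMatrix (free_family h) hN
    locallyIntegrable_zero_coefficients supportedIn_zero hζ x i j) hdet₀
  have h3 : (fun w => normalizedWronskian v x w) =ᶠ[𝓝 z] fun w =>
      (jetMatrix N (u w) x).det / (jetMatrix N (expSystem (ζ w)) x).det :=
    h.mono fun w hw => normalizedWronskian_eq hN hv hsupp hw x
  refine HasDerivAt.congr_of_eventuallyEq ?_ h3
  convert! h1.div h2 hdet₀ using 1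
  rw [normalizedWronskian_eq hN hv hsupp hz x, jetLogDeriv, jetLogDeriv]
  field_simp

/-- The trace formula for the Green functions. -/
theorem tendsto_integral_greenKernel_sub
    (h : ∀ᶠ w in 𝓝 z, IsDistinguishedSystem v w (ζ w) (u w)) (hN : 0 < N)
    (hv : ∀ j, MemLp (v j) 2 volume) (hab : SupportedIn v a b)
    (hζ : ∀ j, DifferentiableAt ℂ (fun w => ζ w j) z)
    (hdet : ∀ x, (jetMatrix N (u z) x).det ≠ 0) (x : ℝ) :
    Tendsto (fun p : ℝ × ℝ => ∫ y in p.1..p.2,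
      (greenKernel hN (ζ z) (u z) y y - greenKernel hN (ζ z) (expSystem (ζ z)) y y))
      (atBot ×ˢ atTop) (𝓝 (-((jetLogDeriv N u z x).trace -
        (jetLogDeriv N (fun w => expSystem (ζ w)) z x).trace))) := by
  have hz := h.self_of_nhds
  have h₀ := free_family h
  have hz₀ := h₀.self_of_nhds
  have hdet₀ : ∀ x, (jetMatrix N (expSystem (ζ z)) x).det ≠ 0 :=
    det_jetMatrix_expSystem_ne_zero hz.injective
  set D : ℝ → Fin N → ℂ := fun x j => jetLogDeriv N u z x j j -
    jetLogDeriv N (fun w => expSystem (ζ w)) z x j j with hD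
  have hc := (hz.isMatrixPrimitive hN).continuous
  have hi := (hz.isPrimitive_inv hN hv hdet).continuous
  have hc₀ := (hz₀.isMatrixPrimitive hN).continuous
  have hi₀ := (hz₀.isPrimitive_inv hN memLp_zero_coefficients hdet₀).continuous
  have hcont : ∀ {w : Fin N → ℝ → ℂ} (s : Fin N → ℂ), Continuous (jetMatrix N w) →
      (Continuous fun t => (jetMatrix N w t)⁻¹) →
      Continuous fun t => Complex.I ^ N * ∑ j, s j * (jetMatrix N w t ⟨0, hN⟩ j *
        (jetMatrix N w t)⁻¹ j (lastIndex hN)) := fun s h1 h2 =>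
    continuous_const.mul (continuous_finsetSum _ fun j _ => continuous_const.mul
      ((h1.matrix_elem _ _).mul (h2.matrix_elem _ _)))
  have hint : ∀ (s : Fin N → ℂ) x y, ∑ j, s j * D y j - ∑ j, s j * D x j =
      ∫ t in x..y, ((Complex.I ^ N * ∑ j, s j * (jetMatrix N (u z) t ⟨0, hN⟩ j *
        (jetMatrix N (u z) t)⁻¹ j (lastIndex hN))) -
        Complex.I ^ N * ∑ j, s j * (jetMatrix N (expSystem (ζ z)) t ⟨0, hN⟩ j *
          (jetMatrix N (expSystem (ζ z)) t)⁻¹ j (lastIndex hN))) := fun s x y => by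
    rw [intervalIntegral.integral_sub ((hcont s hc hi).intervalIntegrable _ _)
      ((hcont s hc₀ hi₀).intervalIntegrable _ _),
      ← sum_jetLogDeriv_sub h hN hv hab hζ hdet s x y,
      ← sum_jetLogDeriv_sub h₀ hN memLp_zero_coefficients supportedIn_zero hζ hdet₀ s x y]
    simp only [hD, mul_sub, Finset.sum_sub_distrib]
    ring
  have htrace : ∀ x, (jetLogDeriv N u z x).trace -
      (jetLogDeriv N (fun w => expSystem (ζ w)) z x).trace = ∑ j, D x j := fun x => by
    simp only [Matrix.trace, Matrix.diag, hD, Finset.sum_sub_distrib]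
  have hone : ∀ {w : Fin N → ℝ → ℂ}, (∀ t, (jetMatrix N w t).det ≠ 0) → ∀ t,
      Complex.I ^ N * ∑ j, (1 : ℂ) * (jetMatrix N w t ⟨0, hN⟩ j *
        (jetMatrix N w t)⁻¹ j (lastIndex hN)) = Complex.I ^ N * if N = 1 then 1 else 0 :=
    fun {w} hw t => by
      rw [← greenLower_add_greenUpper (ζ := ζ z) hN hw t, greenLower, greenUpper, ← mul_add,
        ← Finset.sum_add_distrib]
      congr 1
      refine Finset.sum_congr rfl fun j _ => ?_
      split_ifs <;> simp
  -- With all weights 1 the integrands for H and H₀ are the same constant, so the total of the D_j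
  -- is independent of x.
  have hconst : ∀ x y, ∑ j, D y j = ∑ j, D x j := fun x y => by
    have := hint (fun _ => 1) x y
    simp only [hone hdet, hone hdet₀, sub_self, intervalIntegral.integral_zero] at this
    simpa [sub_eq_zero] using this
  -- These weights select the terms that form the Green function on the diagonal.
  set s : Fin N → ℂ := fun j => if (ζ z j).re < 0 then 1 else 0 with hs
  have hgreen : ∀ {w : Fin N → ℝ → ℂ} t, greenKernel hN (ζ z) w t t =
      Complex.I ^ N * ∑ j, s j * (jetMatrix N w t ⟨0, hN⟩ j *
        (jetMatrix N w t)⁻¹ j (lastIndex hN)) := fun {w} t => by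
    rw [greenKernel, if_pos le_rfl, greenLower]
    congr 1
    refine Finset.sum_congr rfl fun j _ => ?_
    simp only [hs]
    split_ifs <;> simp
  simp only [hgreen, ← hint]
  have hright : Tendsto (fun y => ∑ j, s j * D y j) atTop (𝓝 (∑ _j : Fin N, 0)) := by
    refine tendsto_finsetSum _ fun j _ => ?_
    by_cases hj : (ζ z j).re < 0
    · simp only [hs, if_pos hj, one_mul]
      exact tendsto_jetLogDeriv_sub_atTop h hN hab hζ hdet hj
    · simp [hs, hj]
  have hleft : Tendsto (fun y => ∑ j, (1 - s j) * D y j) atBot (𝓝 (∑ _j : Fin N, 0)) := by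
    refine tendsto_finsetSum _ fun j _ => ?_
    by_cases hj : (ζ z j).re < 0
    · simp [hs, hj]
    · simp only [hs, if_neg hj, sub_zero, one_mul]
      exact tendsto_jetLogDeriv_sub_atBot h hN hab hζ hdet
        (lt_of_le_of_ne (not_lt.1 hj) (hz.re_ne_zero j).symm)
  -- At the left end the weighted sum is rewritten as the full sum minus the terms with Re ζ_j > 0,
  -- which tend to zero there.
  have hlim := (hright.comp tendsto_snd).sub
    ((tendsto_const_nhds (x := ∑ j, D x j)).sub (hleft.comp (tendsto_fst (f := atBot) (g := atTop))))
  simp only [Finset.sum_const_zero, sub_zero, zero_sub] at hlim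
  rw [htrace]
  refine hlim.congr fun p => ?_
  simp only [Function.comp_apply, sub_mul, one_mul, Finset.sum_sub_distrib]
  rw [hconst x p.1]
  ring

end ArbitraryOrder

/-! ### The trace formula for arbitrary resolvent kernels -/

open ArbitraryOrder in
theorem mainTheorem3 (N : ℕ) (hN : 1 ≤ N) (v : Fin N → ℝ → ℂ)
    (hv : ∀ j, MemLp (v j) 2 volume) (hsupp : ∀ j, HasCompactSupport (v j)) :
    -- the normalized Wronskian is well defined outside the spectrum of the free operator
    (∀ w ∉ ArbitraryOrder.operatorSpectrum (0 : Fin N → ℝ → ℂ), ∀ x : ℝ,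
      ∃! d, ArbitraryOrder.IsNormalizedWronskian v x w d) ∧
    ∀ z ∉ ArbitraryOrder.operatorSpectrum v,
      -- the resolvent kernels exist
      (∃ K K₀ : ℝ → ℝ → ℂ, ArbitraryOrder.IsResolventKernelPair v z K K₀) ∧
      ∀ K K₀ : ℝ → ℝ → ℂ, ArbitraryOrder.IsResolventKernelPair v z K K₀ → ∀ x : ℝ,
        DifferentiableAt ℂ (fun w => ArbitraryOrder.normalizedWronskian v x w) z ∧
        ArbitraryOrder.normalizedWronskian v x z ≠ 0 ∧
        Tendsto (fun p : ℝ × ℝ => ∫ y in p.1..p.2, (K y y - K₀ y y)) (atBot ×ˢ atTop)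
          (𝓝 (-(ArbitraryOrder.normalizedWronskian v x z)⁻¹ *
            deriv (fun w => ArbitraryOrder.normalizedWronskian v x w) z)) := by
  have hN' : 0 < N := hN
  have hv' := fun j => locallyIntegrable_of_memLp (hv j)
  refine ⟨fun w hw x => ?_, fun z hz => ?_⟩
  · obtain ⟨R, hR⟩ := not_not.1 hw
    exact existsUnique_isNormalizedWronskian hN' hv' hsupp
      (ne_pow_of_isResolvent hN' (fun _ => HasCompactSupport.zero) hR) x
  · obtain ⟨R, hR⟩ := not_not.1 hz
    obtain ⟨a, b, hab⟩ := exists_supportedIn hsupp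
    obtain ⟨ζ, hζ, hζ'⟩ := exists_numbering_family hN' (ne_pow_of_isResolvent hN' hsupp hR)
    obtain ⟨u, hu⟩ := exists_distinguished_family hN' hv' hsupp hζ'
    have huz := hu.self_of_nhds
    have hdet := huz.det_jetMatrix_ne_zero hN' hv hab hR
    have hpair := huz.isResolventKernelPair hN' hv hsupp hR
    refine ⟨⟨_, _, hpair⟩, fun K K₀ hK x => ?_⟩
    have hd := hasDerivAt_normalizedWronskian hu hN' hv' hsupp hζ hdet x
    have hne : normalizedWronskian v x z ≠ 0 := by
      rw [normalizedWronskian_eq hN' hv' hsupp huz x]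
      exact div_ne_zero (hdet x) (det_jetMatrix_expSystem_ne_zero huz.injective x)
    refine ⟨hd.differentiableAt, hne, ?_⟩
    rw [hd.deriv, neg_mul, inv_mul_cancel_left₀ hne]
    -- The diagonal difference is the same for every normalized pair, so the Green functions may
    -- replace the given kernels.
    simp only [hK.sub_eq hpair]
    exact tendsto_integral_greenKernel_sub hu hN' hv hab hζ hdet x
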